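/- Let $k\ge 1$ be an integer. For a finite set $\mathcal D$ of $n$ integers let $\nu_{\mathcal D}(p)$ be the number of residue classes modulo the prime $p$ occupied by elements of $\mathcal D$, let $$\mathfrak S(\mathcal D)=\prod_{p}\Big(1-\frac1p\Big)^{-n}\Big(1-\frac{\nu_{\mathcal D}(p)}p\Big),$$ and let $\pi_n(x,\mathcal D)$ be the number of positive integers $m\le x$ such that $m+d$ is prime for every $d\in\mathcal D$. Denote by $p_n$ the $n$th prime. For a set $\mathcal D_k=\{d_1<d_2<\cdots<d_k\}$ of $k$ integers let $N_k(x,\mathcal D_k)$ be the number of $n$ with $p_{n+k}\le x$ and $p_{n+i}-p_n=d_i$ for $1\le i\le k$. The set $\mathcal D_k$ is called a $k$-tuple jumping champion for $x$ if $N_k(x,\mathcal D_k)=\max_{\mathcal D}N_k(x,\mathcal D)$, where the maximum is over all sets $\mathcal D$ of $k$ distinct integers. Assume the following strong form of the Hardy–Littlewood conjecture for this $k$: for $n=k+1$ and $n=k+2$, as $x\to\infty$, $$\pi_n(x,\{0\}\cup\mathcal D_{n-1})=\mathfrak S(\{0\}\cup\mathcal D_{n-1})\frac{x}{\log^n x}\,(1+E_n),\qquad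 E_{k+1}=o\Big(\frac1{(\log\log x)^2}\Big),\quad E_{k+2}=o(1),$$ uniformly for all sets $\mathcal D_{n-1}$ of $n-1$ distinct integers in $[2,\log^{k+1}x]$ with $\mathfrak S(\{0\}\cup\mathcal D_{n-1})\ne0$. **Theorem.** The greatest common divisor of the elements of any sufficiently large $k$-tuple jumping champion is square-free. That is: there is $X$ such that for every real $x\ge X$ every $k$-tuple jumping champion for $x$ has square-free gcd; and there is $M$ such that every set with largest element at least $M$ which is a $k$-tuple jumping champion for some real $x$ with $N_k(x,\cdot)>0$ at that set has square-free gcd. -/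

import Mathlib

open Filter

namespace JumpingChampion

noncomputable section

/-- The number `ν_D(p)` of residue classes modulo `p` occupied by the elements of `D`. -/
def residueCount (D : Finset ℤ) (p : ℕ) : ℕ :=
  (D.image fun d => d % (p : ℤ)).card

/-- The factor of the singular series at `p`, for a set `D` of `n` integers:
`(1 - 1/p)^(-n) * (1 - ν_D(p)/p)`. -/
def localFactor (D : Finset ℤ) (p : ℕ) : ℝ :=
  ((1 - 1 / (p : ℝ)) ^ D.card)⁻¹ * (1 - (residueCount D p : ℝ) / (p : ℝ))

/-- The singular series `𝔖(D)`: the product of the local factors over all primes. -/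
def singularSeries (D : Finset ℤ) : ℝ :=
  ∏' p : Nat.Primes, localFactor D p

/-- `π_n(x, D)` with `n = #D`: the number of positive integers `m ≤ x` such that `m + d` is a
prime for every `d ∈ D`. (`Int.toNat` sends negative integers to `0`, which is not a prime.) -/
def tupleCount (x : ℝ) (D : Finset ℤ) : ℕ :=
  ((Finset.Icc 1 ⌊x⌋₊).filter fun m : ℕ => ∀ d ∈ D, ((m : ℤ) + d).toNat.Prime).card

/-- The set of the differences `p_{n+1} - p_n, …, p_{n+k} - p_n`, where `p_0 = 2, p_1 = 3, …` are
the primes in increasing order. -/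
def primeDifferences (k n : ℕ) : Finset ℤ :=
  (Finset.Icc 1 k).image fun i =>
    (Nat.nth Nat.Prime (n + i) : ℤ) - (Nat.nth Nat.Prime n : ℤ)

/-- `N_k(x, D)`: the number of `n` with `p_{n+k} ≤ x` such that the differences
`p_{n+i} - p_n`, `1 ≤ i ≤ k`, are the elements of `D` in increasing order. (These differences
increase with `i`, so it is enough to compare the two sets.) -/
def gapCount (k : ℕ) (x : ℝ) (D : Finset ℤ) : ℕ :=
  {n : ℕ | (Nat.nth Nat.Prime (n + k) : ℝ) ≤ x ∧ primeDifferences k n = D}.ncard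

/-- `D` is a `k`-tuple jumping champion for `x`: a set of `k` integers at which
`N_k(x, ·)` attains its maximum over all sets of `k` integers. -/
def IsChampion (k : ℕ) (x : ℝ) (D : Finset ℤ) : Prop :=
  D.card = k ∧ ∀ D' : Finset ℤ, D'.card = k → gapCount k x D' ≤ gapCount k x D

/-- For sets `D` of `n - 1` integers in `[2, (log x)^(k+1)]` with `𝔖({0} ∪ D) ≠ 0`,
`π_n(x, {0} ∪ D) = 𝔖({0} ∪ D) * x / (log x)^n * (1 + o(g x))` as `x → ∞`, uniformly in `D`. -/
def UniformTupleAsymptotic (k n : ℕ) (g : ℝ → ℝ) : Prop :=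
  ∀ ε : ℝ, 0 < ε → ∀ᶠ x : ℝ in atTop, ∀ D : Finset ℤ,
    D.card + 1 = n →
    (∀ d ∈ D, 2 ≤ d ∧ (d : ℝ) ≤ Real.log x ^ (k + 1)) →
    singularSeries (insert 0 D) ≠ 0 →
    |(tupleCount x (insert 0 D) : ℝ) - singularSeries (insert 0 D) * (x / Real.log x ^ n)| ≤
      ε * g x * (singularSeries (insert 0 D) * (x / Real.log x ^ n))

/-- The strong form of the Hardy–Littlewood conjecture for the parameter `k`. -/
def StrongHardyLittlewood (k : ℕ) : Prop :=
  UniformTupleAsymptotic k (k + 1) (fun x => 1 / Real.log (Real.log x) ^ 2) ∧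
    UniformTupleAsymptotic k (k + 2) (fun _ => 1)

/-- The set counted by `gapCount` is finite. -/
theorem finite_gapCount_set (k : ℕ) (x : ℝ) (D : Finset ℤ) :
    {n : ℕ | (Nat.nth Nat.Prime (n + k) : ℝ) ≤ x ∧ primeDifferences k n = D}.Finite := by
  refine (Set.finite_Iic ⌊x⌋₊).subset fun n hn => ?_
  have h1 : n + k ≤ Nat.nth Nat.Prime (n + k) :=
    (Nat.nth_strictMono Nat.infinite_setOfPred_prime).id_le _
  have h2 := Nat.le_floor hn.1
  exact Set.mem_Iic.2 (by omega)

end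

end JumpingChampion

/-!
Write `L = log x`, `T = {0} ∪ D`, and `X = 𝔖(T) x / L ^ (k+1)`, the number of occurrences of `T` as
a tuple of primes that the conjecture predicts. Let `H` be the largest element of `D`. An occurrence
of `T` fails to be a tuple of consecutive primes exactly when it is interrupted, that is, when
`m + e` is prime for some `e ∉ D` in `(0, H)`. By the conjecture for `k + 2`, the number of
occurrences of `T ∪ {e}` is asymptotically `𝔖(T ∪ {e}) x / L ^ (k+2)`.

Suppose that `p² ∣ d` for every `d ∈ D`, and put `D' = D / p`. Every element of `T' = {0} ∪ D'` is
divisible by `p`, hence `𝔖(T) = 𝔖(T')` (`singularSeries_dilate_eq`). Each possible interruption `e'`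
of `D'` gives one of `D`, namely `p e'`, with at least the same singular series. But there are also
interruptions `e` of `D` that are not divisible by `p`, and these contribute a further
`c (H / L) X` with some constant `c > 0` (`exists_sum_singularSeries_insert_dilate_ge`). Therefore
`D'` should beat `D`. This is a proof as long as `c (H / L)` dominates the two errors: the relative
error `o(1 / (log L)²)` in the conjecture for `k + 1`, and the error `O((H / L)²)` in counting the
interruptions of `D` by inclusion and exclusion. So it has to be shown that the maximum `H` of a
champion is of the order `L / (log L)²` at least (`exists_eventually_le_of_isChampion`), and that it
is at most `δ L` for a given small `δ` (`eventually_lt_of_isChampion_dilate`).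

* The error in the inclusion and exclusion is a sum over pairs of the numbers of occurrences of
  `T ∪ {e, f}`, about which nothing is assumed. It is bounded by an upper bound sieve of the correct
  order of magnitude, uniform in the tuple (`exists_tupleCount_le`), together with the fact that
  `𝔖(T ∪ {e})` is `O(𝔖(T))` on average over `e` (`exists_sum_singularSeries_insert_le`). The sieve is
  Selberg's; the lower bound for its denominator comes from a comparison of sums of multiplicative
  functions over squarefree integers, so that no asymptotic formula for such sums is needed.
* The first competitor is `{P, 2P, …, kP}` with `P` the product of the primes up to `(log L) / 4`
  (`primorialTuple`). Its elements are at most `√L`, hence it is almost never interrupted, and up to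
  a factor `1 + o(1)` its singular series is the largest that is possible for sets of moderate size,
  since primes above the bound hardly matter. It tends to infinity. As `N_k(x, D) H ≤ k x`, it
  follows that a champion has `H ≤ L ^ (k+1)`, so that the conjecture applies to it. And a set with
  `H > δ L` that is divisible by the square of a prime is interrupted so often that it is rarer than
  `{P, …, kP}`.
* If `H` is much smaller than `L / (log L)²`, some prime `q` of size `O(log L)` does not divide `H`.
  Multiplication by `q` increases the singular series by a factor of at least `1 + 1 / q`
  (`mul_singularSeries_le_dilate`), while the set remains too short for interruptions to matter.
  Hence `q D` beats `D`.
-/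

namespace JumpingChampion

/-! ### Residue counts -/

theorem residueCount_le_card (D : Finset ℤ) (p : ℕ) : residueCount D p ≤ D.card :=
  Finset.card_image_le

theorem residueCount_le {p : ℕ} (hp : 0 < p) (D : Finset ℤ) : residueCount D p ≤ p := by
  have hp' : (0 : ℤ) < p := by exact_mod_cast hp
  have : (D.image fun d => d % (p : ℤ)) ⊆ Finset.Ico (0 : ℤ) p := by
    intro r hr
    obtain ⟨d, -, rfl⟩ := Finset.mem_image.1 hr
    exact Finset.mem_Ico.2 ⟨Int.emod_nonneg _ hp'.ne', Int.emod_lt_of_pos _ hp'⟩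
  simpa [residueCount] using Finset.card_le_card this

theorem residueCount_pos {D : Finset ℤ} (hD : D.Nonempty) (p : ℕ) : 0 < residueCount D p :=
  Finset.card_pos.2 (hD.image _)

theorem residueCount_insert_of_dvd {D : Finset ℤ} {e : ℤ} {p : ℕ}
    (h : ∃ d ∈ D, (p : ℤ) ∣ e - d) : residueCount (insert e D) p = residueCount D p := by
  obtain ⟨d, hd, hdvd⟩ := h
  unfold residueCount
  rw [Finset.image_insert, Finset.insert_eq_of_mem]
  exact Finset.mem_image.2 ⟨d, hd, Int.modEq_iff_dvd.2 hdvd⟩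

theorem residueCount_insert_of_not_dvd {D : Finset ℤ} {e : ℤ} {p : ℕ}
    (h : ¬ ∃ d ∈ D, (p : ℤ) ∣ e - d) : residueCount (insert e D) p = residueCount D p + 1 := by
  unfold residueCount
  rw [Finset.image_insert, Finset.card_insert_of_notMem]
  intro hmem
  obtain ⟨d, hd, hde⟩ := Finset.mem_image.1 hmem
  exact h ⟨d, hd, Int.ModEq.dvd hde⟩

theorem residueCount_eq_card {D : Finset ℤ} {p : ℕ}
    (h : ∀ a ∈ D, ∀ b ∈ D, (p : ℤ) ∣ a - b → a = b) : residueCount D p = D.card := by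
  refine Finset.card_image_of_injOn fun a ha b hb hab => h a ha b hb ?_
  exact Int.ModEq.dvd (Eq.symm hab)

theorem residueCount_eq_one {D : Finset ℤ} {p : ℕ} (hD : D.Nonempty)
    (h : ∀ a ∈ D, (p : ℤ) ∣ a) : residueCount D p = 1 := by
  unfold residueCount
  rw [Finset.card_eq_one]
  refine ⟨0, ?_⟩
  ext r
  simp only [Finset.mem_image, Finset.mem_singleton]
  constructor
  · rintro ⟨d, hd, rfl⟩
    exact Int.emod_eq_zero_of_dvd (h d hd)
  · rintro rfl
    obtain ⟨d, hd⟩ := hD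
    exact ⟨d, hd, Int.emod_eq_zero_of_dvd (h d hd)⟩

theorem two_le_residueCount {D : Finset ℤ} {p : ℕ} {a b : ℤ} (ha : a ∈ D) (hb : b ∈ D)
    (hab : ¬ (p : ℤ) ∣ a - b) : 2 ≤ residueCount D p := by
  have h : 1 < residueCount D p := by
    unfold residueCount
    rw [Finset.one_lt_card]
    exact ⟨a % p, Finset.mem_image_of_mem _ ha, b % p, Finset.mem_image_of_mem _ hb,
      fun h => hab (Int.ModEq.dvd (Eq.symm h))⟩
  exact h

/-- The set of the `q * d` for `d ∈ D`. -/
def dilate (q : ℕ) (D : Finset ℤ) : Finset ℤ := D.image fun d => (q : ℤ) * d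

theorem mem_dilate {q : ℕ} {D : Finset ℤ} {e : ℤ} : e ∈ dilate q D ↔ ∃ d ∈ D, (q : ℤ) * d = e := by
  simp [dilate]

theorem card_dilate {q : ℕ} (hq : 0 < q) (D : Finset ℤ) : (dilate q D).card = D.card := by
  refine Finset.card_image_of_injective _ fun a b hab => ?_
  have : (q : ℤ) ≠ 0 := by exact_mod_cast hq.ne'
  exact mul_left_cancel₀ this hab

theorem dilate_insert (q : ℕ) (e : ℤ) (D : Finset ℤ) :
    dilate q (insert e D) = insert ((q : ℤ) * e) (dilate q D) := by
  simp [dilate, Finset.image_insert]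

theorem dilate_insert_zero (q : ℕ) (D : Finset ℤ) :
    dilate q (insert 0 D) = insert 0 (dilate q D) := by
  simp [dilate_insert]

theorem residueCount_dilate_of_coprime {p q : ℕ} (hpq : IsCoprime (p : ℤ) (q : ℤ))
    (D : Finset ℤ) : residueCount (dilate q D) p = residueCount D p := by
  unfold residueCount dilate
  rw [Finset.image_image]
  have key : ∀ a b : ℤ, a % p = b % p ↔ ((q : ℤ) * a) % p = ((q : ℤ) * b) % p := by
    intro a b
    constructor
    · intro h
      exact Int.ModEq.mul_left _ h
    · intro h
      have h1 : (p : ℤ) ∣ q * b - q * a := Int.ModEq.dvd h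
      rw [← mul_sub] at h1
      exact (Int.modEq_iff_dvd.2 (hpq.dvd_of_dvd_mul_left h1))
  refine le_antisymm ?_ ?_
  · refine Finset.card_le_card_of_surjOn (fun r => (q * r) % p) ?_
    rintro r hr
    obtain ⟨d, hd, rfl⟩ := Finset.mem_image.1 (Finset.mem_coe.1 hr)
    refine ⟨d % p, Finset.mem_coe.2 (Finset.mem_image_of_mem _ hd), ?_⟩
    simp [Int.mul_emod]
  · have : (D.image fun d => d % (p : ℤ)).card ≤
        (D.image ((fun d => d % (p : ℤ)) ∘ fun d => (q : ℤ) * d)).card := by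
      refine Finset.card_le_card_of_injOn (fun r => (q * r) % p) ?_ ?_
      · intro r hr
        obtain ⟨d, hd, rfl⟩ := Finset.mem_image.1 (Finset.mem_coe.1 hr)
        refine Finset.mem_coe.2 (Finset.mem_image.2 ⟨d, hd, ?_⟩)
        simp [Int.mul_emod]
      · intro r hr s hs hrs
        obtain ⟨a, ha, rfl⟩ := Finset.mem_image.1 (Finset.mem_coe.1 hr)
        obtain ⟨b, hb, rfl⟩ := Finset.mem_image.1 (Finset.mem_coe.1 hs)
        have := (key (a % p) (b % p)).2 hrs
        simpa using this
    exact this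

/-! ### Local factors -/

theorem localFactor_nonneg (D : Finset ℤ) {p : ℕ} (hp : p.Prime) : 0 ≤ localFactor D p := by
  have hp1 : (1 : ℝ) < p := by exact_mod_cast hp.one_lt
  have h1 : (1 : ℝ) / p ≤ 1 := by rw [div_le_one (by linarith)]; exact hp1.le
  have h2 : (residueCount D p : ℝ) / p ≤ 1 := by
    rw [div_le_one (by linarith)]
    exact_mod_cast residueCount_le hp.pos D
  exact mul_nonneg (inv_nonneg.2 (pow_nonneg (by linarith) _)) (by linarith)

theorem localFactor_eq_zero {D : Finset ℤ} {p : ℕ} (hp : p.Prime) (h : residueCount D p = p) :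
    localFactor D p = 0 := by
  have : (p : ℝ) ≠ 0 := by exact_mod_cast hp.ne_zero
  simp [localFactor, h, div_self this]

/-- Bernoulli's inequality from the other side, with a quadratic error term. -/
theorem pow_one_sub_le (n : ℕ) {t : ℝ} (h0 : 0 ≤ t) (h1 : t ≤ 1) :
    (1 - t) ^ n ≤ 1 - n * t + n ^ 2 * t ^ 2 := by
  induction n with
  | zero => simp
  | succ n ih =>
    have := mul_le_mul_of_nonneg_right ih (by linarith : 0 ≤ 1 - t)
    rw [pow_succ]
    refine this.trans ?_
    push_cast
    have h3 : 0 ≤ (n : ℝ) ^ 2 * t ^ 2 * t := by positivity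
    have h4 : 0 ≤ (n : ℝ) * t ^ 2 := by positivity
    nlinarith [sq_nonneg t]

/-- With `t = 1 / p`, both sides are `1 - v t + O(t ^ 2)`; the relative error is uniform because
`1 - v t` is at least `1 / (n + 1)`. -/
theorem one_add_div_mul_pow_le {n v p : ℕ} (hv : v ≤ n) (hvp : v < p) :
    (1 + ((n : ℝ) - v) / p) * (1 - 1 / (p : ℝ)) ^ n ≤
      (1 + ((n : ℝ) + 1) ^ 4 / p ^ 2) * (1 - v / p) := by
  have hp1 : (1 : ℝ) ≤ p := by exact_mod_cast (by omega : 1 ≤ p)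
  have hv' : (v : ℝ) ≤ n := by exact_mod_cast hv
  have hvp' : (v : ℝ) + 1 ≤ p := by exact_mod_cast hvp
  set t : ℝ := 1 / p with ht
  have ht0 : 0 ≤ t := by positivity
  have ht1 : t ≤ 1 := by rw [ht, div_le_one (by linarith)]; exact hp1
  have hpt : (p : ℝ) * t = 1 := by rw [ht]; field_simp
  have e1 : ((n : ℝ) - v) / p = (n - v) * t := by rw [ht]; ring
  have e2 : ((n : ℝ) + 1) ^ 4 / p ^ 2 = (n + 1) ^ 4 * t ^ 2 := by rw [ht]; ring
  have e3 : (v : ℝ) / p = v * t := by rw [ht]; ring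
  rw [e1, e2, e3]
  have hv0 : (0 : ℝ) ≤ v := by positivity
  -- `1 - v / p` is at least `1 / (v + 1)`, since `v < p`
  have hlow : 1 ≤ (n + 1) * (1 - v * t) := by
    have h1 : t ≤ 1 - v * t := by nlinarith
    have h2 : 1 ≤ (v + 1) * (1 - v * t) := by nlinarith
    have h3 : 0 ≤ 1 - v * t := by linarith
    nlinarith
  have hpow := pow_one_sub_le n ht0 ht1
  have hnv : 0 ≤ ((n : ℝ) - v) * t := mul_nonneg (by linarith) ht0
  calc (1 + ((n : ℝ) - v) * t) * (1 - t) ^ n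
      ≤ (1 + ((n : ℝ) - v) * t) * (1 - n * t + n ^ 2 * t ^ 2) :=
        mul_le_mul_of_nonneg_left hpow (by linarith)
    _ ≤ (1 - v * t) + (n + 1) ^ 3 * t ^ 2 := by
        have h5 : ((n : ℝ) - v) * t * (n ^ 2 * t ^ 2) ≤ n * 1 * (n ^ 2 * t ^ 2) := by
          gcongr
          linarith
        have h6 : 0 ≤ ((n : ℝ) - v) * t * (n * t) := by positivity
        have h7 : 0 ≤ (n : ℝ) * t ^ 2 := by positivity
        have h8 : 0 ≤ (n : ℝ) ^ 2 * t ^ 2 := by positivity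
        nlinarith [sq_nonneg t]
    _ ≤ (1 + (n + 1) ^ 4 * t ^ 2) * (1 - v * t) := by
        have : ((n : ℝ) + 1) ^ 3 * t ^ 2 * 1 ≤
            (n + 1) ^ 3 * t ^ 2 * ((n + 1) * (1 - v * t)) := by gcongr
        nlinarith

/-- The local factor at an unobstructed prime is at least `1 + (n - ν) / p`, up to a factor
`1 + O(1 / p ^ 2)`. -/
theorem one_add_div_le_localFactor {D : Finset ℤ} {p : ℕ} (h : residueCount D p < p) :
    1 + ((D.card : ℝ) - residueCount D p) / p ≤
      (1 + ((D.card : ℝ) + 1) ^ 4 / p ^ 2) * localFactor D p := by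
  have h1 := one_add_div_mul_pow_le (residueCount_le_card D p) h
  rcases Nat.lt_or_ge 1 p with hp | hp
  · have hp1 : (1 : ℝ) < p := by exact_mod_cast hp
    have h2 : (1 : ℝ) / p < 1 := by rw [div_lt_one (by linarith)]; exact hp1
    have h3 : 0 < (1 - 1 / (p : ℝ)) ^ D.card := pow_pos (by linarith) _
    rw [localFactor, mul_left_comm, ← div_eq_inv_mul, le_div_iff₀ h3]
    exact h1
  · have hp1 : p = 1 := by omega
    have h0 : residueCount D p = 0 := by omega
    have hD : D = ∅ := by
      by_contra hne
      exact absurd (residueCount_pos (Finset.nonempty_iff_ne_empty.2 hne) p) (by omega)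
    subst hp1 hD
    norm_num [localFactor, residueCount]

theorem one_le_localFactor {D : Finset ℤ} {p : ℕ} (h : residueCount D p < p) :
    1 ≤ (1 + ((D.card : ℝ) + 1) ^ 4 / p ^ 2) * localFactor D p := by
  refine le_trans ?_ (one_add_div_le_localFactor h)
  have : (residueCount D p : ℝ) ≤ D.card := by exact_mod_cast residueCount_le_card D p
  have : 0 ≤ ((D.card : ℝ) - residueCount D p) / p := div_nonneg (by linarith) (by positivity)
  linarith

theorem localFactor_le_one {D : Finset ℤ} {p : ℕ} (hp : p.Prime)
    (h : residueCount D p = D.card) : localFactor D p ≤ 1 := by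
  have hp1 : (1 : ℝ) < p := by exact_mod_cast hp.one_lt
  have h2 : (1 : ℝ) / p < 1 := by rw [div_lt_one (by linarith)]; exact hp1
  have h3 : 0 < (1 - 1 / (p : ℝ)) ^ D.card := pow_pos (by linarith) _
  rw [localFactor, h, inv_mul_le_one₀ h3]
  have := one_add_mul_le_pow (a := -(1 / (p : ℝ))) (by linarith) D.card
  rw [← sub_eq_add_neg] at this
  refine le_trans (le_of_eq ?_) this
  ring

/-! ### Convergence of the singular series -/

theorem summable_primes_div_sq (C : ℝ) : Summable fun p : Nat.Primes => C / (p : ℝ) ^ 2 := by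
  have h : Summable fun n : ℕ => C / (n : ℝ) ^ 2 := by
    simpa [div_eq_mul_inv] using (Real.summable_nat_pow_inv.2 one_lt_two).mul_left C
  exact h.comp_injective Subtype.val_injective

theorem eventually_cofinite_residueCount_eq_card (D : Finset ℤ) :
    ∀ᶠ p : Nat.Primes in cofinite, residueCount D p = D.card := by
  set B : ℕ := (D ×ˢ D).sup fun x => (x.1 - x.2).natAbs with hB
  have hfin : {p : Nat.Primes | (p : ℕ) ≤ B}.Finite :=
    (Set.finite_Iic B).preimage Subtype.val_injective.injOn
  refine hfin.subset fun p hp => ?_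
  by_contra hlt
  refine hp (residueCount_eq_card fun a ha b hb hab => ?_)
  have hle : (a - b).natAbs ≤ B :=
    Finset.le_sup (f := fun x : ℤ × ℤ => (x.1 - x.2).natAbs)
      (Finset.mem_product.2 ⟨ha, hb⟩ : (a, b) ∈ D ×ˢ D)
  have hlt' : B < (p : ℕ) := by simpa using hlt
  by_contra hne
  have := Nat.le_of_dvd (Int.natAbs_pos.2 (sub_ne_zero.2 hne)) (Int.natCast_dvd.1 hab)
  omega

theorem multipliable_localFactor (D : Finset ℤ) :
    Multipliable fun p : Nat.Primes => localFactor D p := by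
  have hsum : Summable fun p : Nat.Primes => localFactor D p - 1 := by
    refine Summable.of_norm_bounded_eventually
      (summable_primes_div_sq (((D.card : ℝ) + 1) ^ 4)) ?_
    have hlarge : ∀ᶠ p : Nat.Primes in cofinite, D.card < (p : ℕ) := by
      have hfin : {p : Nat.Primes | (p : ℕ) ≤ D.card}.Finite :=
        (Set.finite_Iic D.card).preimage Subtype.val_injective.injOn
      refine hfin.subset fun p hp => ?_
      simpa using hp
    filter_upwards [eventually_cofinite_residueCount_eq_card D, hlarge] with p hp hlt
    have h1 := localFactor_le_one p.2 hp
    have h2 := one_le_localFactor (D := D) (p := p) (by omega)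
    have h3 := localFactor_nonneg D p.2
    have h4 : 0 ≤ ((D.card : ℝ) + 1) ^ 4 / (p : ℝ) ^ 2 := by positivity
    rw [Real.norm_eq_abs, abs_le]
    constructor <;> nlinarith
  simpa using Real.multipliable_one_add_of_summable hsum

theorem tendsto_prod_localFactor (D : Finset ℤ) :
    Tendsto (fun S : Finset Nat.Primes => ∏ p ∈ S, localFactor D p) atTop
      (nhds (singularSeries D)) := by
  have := (multipliable_localFactor D).hasProd
  simpa [HasProd, singularSeries] using this

/-- Singular series are compared through their finite partial products. -/
theorem singularSeries_le_mul {D D' : Finset ℤ} {K : ℝ} (S₀ : Finset Nat.Primes)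
    (h : ∀ S, S₀ ⊆ S → ∏ p ∈ S, localFactor D p ≤ K * ∏ p ∈ S, localFactor D' p) :
    singularSeries D ≤ K * singularSeries D' :=
  le_of_tendsto_of_tendsto (tendsto_prod_localFactor D)
    ((tendsto_prod_localFactor D').const_mul K) ((eventually_ge_atTop S₀).mono fun S hS => h S hS)

theorem le_mul_singularSeries {D : Finset ℤ} {c K : ℝ} (S₀ : Finset Nat.Primes)
    (h : ∀ S, S₀ ⊆ S → c ≤ K * ∏ p ∈ S, localFactor D p) : c ≤ K * singularSeries D :=
  ge_of_tendsto ((tendsto_prod_localFactor D).const_mul K)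
    ((eventually_ge_atTop S₀).mono fun S hS => h S hS)

theorem singularSeries_nonneg (D : Finset ℤ) : 0 ≤ singularSeries D := by
  have := le_mul_singularSeries (D := D) (c := 0) (K := 1) ∅ fun S _ => by
    rw [one_mul]; exact Finset.prod_nonneg fun p _ => localFactor_nonneg D p.2
  simpa using this

theorem sum_inv_sq_le_two (s : Finset ℕ) : ∑ n ∈ s, ((n : ℝ) ^ 2)⁻¹ ≤ 2 := by
  have h0 : ∀ n ∈ s, n ∉ Finset.Ioo 0 (s.sup id + 1) → ((n : ℝ) ^ 2)⁻¹ = 0 := by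
    intro n hn hn'
    have : n ≤ s.sup id := Finset.le_sup (f := id) hn
    have : n = 0 := by
      by_contra h
      exact hn' (Finset.mem_Ioo.2 ⟨by omega, by omega⟩)
    simp [this]
  calc ∑ n ∈ s, ((n : ℝ) ^ 2)⁻¹
      = ∑ n ∈ s with n ∈ Finset.Ioo 0 (s.sup id + 1), ((n : ℝ) ^ 2)⁻¹ := by
        rw [Finset.sum_filter_of_ne]
        intro n hn hne
        by_contra h
        exact hne (h0 n hn h)
    _ ≤ ∑ n ∈ Finset.Ioo 0 (s.sup id + 1), ((n : ℝ) ^ 2)⁻¹ :=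
        Finset.sum_le_sum_of_subset_of_nonneg (fun n hn => (Finset.mem_filter.1 hn).2)
          fun _ _ _ => by positivity
    _ ≤ 2 := by simpa using sum_Ioo_inv_sq_le (α := ℝ) 0 (s.sup id + 1)

theorem prod_le_exp_sum {ι : Type*} (s : Finset ι) (f : ι → ℝ) (hf : ∀ i ∈ s, 0 ≤ f i) :
    ∏ i ∈ s, (1 + f i) ≤ Real.exp (∑ i ∈ s, f i) := by
  rw [Real.exp_sum]
  refine Finset.prod_le_prod (fun i hi => by linarith [hf i hi]) fun i _ => ?_
  rw [add_comm]
  exact Real.add_one_le_exp _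

theorem prod_nat_one_add_div_sq_le (s : Finset ℕ) {C : ℝ} (hC : 0 ≤ C) :
    ∏ p ∈ s, (1 + C / (p : ℝ) ^ 2) ≤ Real.exp (2 * C) := by
  refine (prod_le_exp_sum s _ fun _ _ => by positivity).trans (Real.exp_le_exp.2 ?_)
  have := mul_le_mul_of_nonneg_left (sum_inv_sq_le_two s) hC
  rw [Finset.mul_sum] at this
  simpa [div_eq_mul_inv, mul_comm] using this

theorem prod_primes_one_add_div_sq_le (S : Finset Nat.Primes) {C : ℝ} (hC : 0 ≤ C) :
    ∏ p ∈ S, (1 + C / (p : ℝ) ^ 2) ≤ Real.exp (2 * C) := by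
  have := prod_nat_one_add_div_sq_le (S.image fun p : Nat.Primes => (p : ℕ)) hC
  rwa [Finset.prod_image (g := fun p : Nat.Primes => (p : ℕ))
    fun p _ q _ h => Subtype.val_injective h] at this

/-- If no prime is obstructed, `𝔖(D)` is bounded below by a product over any finite set of primes
of the factors `1 + (n - ν) / p`, up to a constant which depends on `n` only. -/
theorem prod_le_mul_singularSeries {D : Finset ℤ} (h : ∀ p : ℕ, p.Prime → residueCount D p < p)
    (S : Finset Nat.Primes) :
    ∏ p ∈ S, (1 + ((D.card : ℝ) - residueCount D p) / (p : ℝ)) ≤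
      Real.exp (2 * ((D.card : ℝ) + 1) ^ 4) * singularSeries D := by
  refine le_mul_singularSeries S fun S' hS' => ?_
  have hnn : ∀ p : Nat.Primes, 0 ≤ ((D.card : ℝ) - residueCount D p) / (p : ℝ) := fun p => by
    have : (residueCount D p : ℝ) ≤ D.card := by exact_mod_cast residueCount_le_card D p
    exact div_nonneg (by linarith) (by positivity)
  calc ∏ p ∈ S, (1 + ((D.card : ℝ) - residueCount D p) / (p : ℝ))
      ≤ ∏ p ∈ S', (1 + ((D.card : ℝ) - residueCount D p) / (p : ℝ)) :=
        Finset.prod_le_prod_of_subset_of_one_le hS' (fun p _ => by linarith [hnn p])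
          fun p _ _ => by linarith [hnn p]
    _ ≤ ∏ p ∈ S', ((1 + ((D.card : ℝ) + 1) ^ 4 / (p : ℝ) ^ 2) * localFactor D p) :=
        Finset.prod_le_prod (fun p _ => by linarith [hnn p])
          fun p _ => one_add_div_le_localFactor (h p p.2)
    _ ≤ _ := by
        rw [Finset.prod_mul_distrib]
        refine mul_le_mul_of_nonneg_right (prod_primes_one_add_div_sq_le S' (by positivity)) ?_
        exact Finset.prod_nonneg fun p _ => localFactor_nonneg D p.2

theorem one_le_mul_singularSeries {D : Finset ℤ} (h : ∀ p : ℕ, p.Prime → residueCount D p < p) :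
    1 ≤ Real.exp (2 * ((D.card : ℝ) + 1) ^ 4) * singularSeries D := by
  simpa using prod_le_mul_singularSeries h ∅

theorem singularSeries_ne_zero_iff {D : Finset ℤ} :
    singularSeries D ≠ 0 ↔ ∀ p : ℕ, p.Prime → residueCount D p < p := by
  constructor
  · intro h p hp
    refine lt_of_le_of_ne (residueCount_le hp.pos D) fun heq => h ?_
    refine le_antisymm ?_ (singularSeries_nonneg D)
    have := singularSeries_le_mul (D := D) (D' := D) (K := 0) {⟨p, hp⟩} fun S hS => by
      rw [zero_mul]
      refine (Finset.prod_eq_zero (hS (Finset.mem_singleton_self _)) ?_).le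
      exact localFactor_eq_zero hp heq
    simpa using this
  · intro h h0
    have := one_le_mul_singularSeries h
    rw [h0, mul_zero] at this
    linarith

theorem singularSeries_pos_of_ne_zero {D : Finset ℤ} (h : singularSeries D ≠ 0) :
    0 < singularSeries D :=
  lt_of_le_of_ne (singularSeries_nonneg D) (Ne.symm h)

theorem exists_residueCount_eq_of_singularSeries_eq_zero {D : Finset ℤ}
    (h : singularSeries D = 0) : ∃ p : ℕ, p.Prime ∧ residueCount D p = p := by
  by_contra hcon
  push Not at hcon
  exact singularSeries_ne_zero_iff.2
    (fun p hp => lt_of_le_of_ne (residueCount_le hp.pos D) (hcon p hp)) h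

/-! ### Adding an element, and dilation -/

/-- The product `∏ (1 - 1/p)⁻¹ = |m| / φ(|m|)` over the primes `p` that divide `m`. -/
noncomputable def primeWeight (m : ℤ) : ℝ := ∏ p ∈ m.natAbs.primeFactors, (1 - 1 / (p : ℝ))⁻¹

theorem one_div_prime_lt_one {p : ℕ} (hp : p.Prime) : (1 : ℝ) / p < 1 := by
  have hp1 : (1 : ℝ) < p := by exact_mod_cast hp.one_lt
  rw [div_lt_one (by linarith)]
  exact hp1

theorem one_le_inv_one_sub {p : ℕ} (hp : p.Prime) : 1 ≤ (1 - 1 / (p : ℝ))⁻¹ := by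
  have h1 := one_div_prime_lt_one hp
  have h2 : (0 : ℝ) ≤ 1 / p := by positivity
  rw [one_le_inv₀ (by linarith)]
  linarith

theorem localFactor_insert {D : Finset ℤ} {e : ℤ} (he : e ∉ D) (p : ℕ) :
    localFactor (insert e D) p = ((1 - 1 / (p : ℝ)) ^ D.card)⁻¹ *
      ((1 - 1 / (p : ℝ))⁻¹ * (1 - residueCount (insert e D) p / p)) := by
  rw [localFactor, Finset.card_insert_of_notMem he, pow_succ, mul_inv, mul_assoc]

/-- Adding `e` increases the local factor at `p` only if `e` falls into an occupied class. -/
theorem localFactor_insert_le {D : Finset ℤ} {e : ℤ} (he : e ∉ D) {p : ℕ} (hp : p.Prime) :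
    localFactor (insert e D) p ≤
      (∏ d ∈ D, if (p : ℤ) ∣ e - d then (1 - 1 / (p : ℝ))⁻¹ else 1) * localFactor D p := by
  have hlt := one_div_prime_lt_one hp
  have hinv := one_le_inv_one_sub hp
  have hP : 0 < 1 - 1 / (p : ℝ) := by linarith
  have hnn := localFactor_nonneg D hp
  by_cases h : ∃ d ∈ D, (p : ℤ) ∣ e - d
  · have hle : (1 - 1 / (p : ℝ))⁻¹ ≤
        ∏ d ∈ D, if (p : ℤ) ∣ e - d then (1 - 1 / (p : ℝ))⁻¹ else 1 := by
      obtain ⟨d, hd, hdvd⟩ := h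
      rw [← Finset.mul_prod_erase D _ hd, if_pos hdvd]
      refine le_mul_of_one_le_right (by linarith) (Finset.one_le_prod fun i _ => ?_)
      split_ifs <;> linarith
    refine le_trans (le_of_eq ?_) (mul_le_mul_of_nonneg_right hle hnn)
    rw [localFactor_insert he, residueCount_insert_of_dvd h, localFactor]
    ring
  · have h1 : ∏ d ∈ D, (if (p : ℤ) ∣ e - d then (1 - 1 / (p : ℝ))⁻¹ else 1) = 1 := by
      refine Finset.prod_eq_one fun d hd => if_neg fun hdvd => h ⟨d, hd, hdvd⟩
    rw [h1, one_mul, localFactor_insert he, residueCount_insert_of_not_dvd h, localFactor]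
    refine mul_le_mul_of_nonneg_left ?_ (inv_nonneg.2 (pow_nonneg hP.le _))
    rw [inv_mul_le_iff₀ hP]
    have h2 : (0 : ℝ) ≤ residueCount D p / p * (1 / p) := by positivity
    push_cast
    rw [add_div]
    nlinarith

/-- At an unobstructed prime, adding `e` decreases the local factor by `1 + O(1 / p ^ 2)` at most. -/
theorem localFactor_le_insert {D : Finset ℤ} {e : ℤ} (he : e ∉ D) {p : ℕ} (hp : p.Prime)
    (hlt : residueCount (insert e D) p < p) :
    localFactor D p ≤
      (1 + ((D.card : ℝ) + 1) ^ 2 / p ^ 2) * localFactor (insert e D) p := by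
  have hlt1 := one_div_prime_lt_one hp
  have hinv := one_le_inv_one_sub hp
  have hP : 0 < 1 - 1 / (p : ℝ) := by linarith
  have hpow : 0 ≤ ((1 - 1 / (p : ℝ)) ^ D.card)⁻¹ := inv_nonneg.2 (pow_nonneg hP.le _)
  have hC : 0 ≤ ((D.card : ℝ) + 1) ^ 2 / p ^ 2 := by positivity
  by_cases h : ∃ d ∈ D, (p : ℤ) ∣ e - d
  · have hnn := localFactor_nonneg D hp
    have hnn' := localFactor_nonneg (insert e D) hp
    have : localFactor D p ≤ localFactor (insert e D) p := by
      rw [localFactor_insert he, residueCount_insert_of_dvd h, mul_left_comm, ← localFactor]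
      exact le_mul_of_one_le_left hnn hinv
    nlinarith
  · rw [residueCount_insert_of_not_dvd h] at hlt
    rw [localFactor_insert he, residueCount_insert_of_not_dvd h, localFactor, mul_left_comm]
    refine mul_le_mul_of_nonneg_left ?_ hpow
    rw [mul_left_comm, ← div_eq_inv_mul, le_div_iff₀ hP]
    have hvn : (residueCount D p : ℝ) ≤ D.card := by exact_mod_cast residueCount_le_card D p
    have hlt' : (residueCount D p : ℝ) + 1 + 1 ≤ p := by exact_mod_cast hlt
    set v : ℝ := (residueCount D p : ℝ) with hv
    have hv0 : 0 ≤ v := by positivity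
    have hp1 : (1 : ℝ) < p := by exact_mod_cast hp.one_lt
    set t : ℝ := 1 / p with ht
    have hpt : (p : ℝ) * t = 1 := by rw [ht]; field_simp
    have ht0 : 0 ≤ t := by positivity
    have e1 : ((D.card : ℝ) + 1) ^ 2 / p ^ 2 = (D.card + 1) ^ 2 * t ^ 2 := by rw [ht]; ring
    have e2 : v / p = v * t := by rw [ht]; ring
    have e3 : ((residueCount D p + 1 : ℕ) : ℝ) / p = (v + 1) * t := by
      rw [ht, hv]; push_cast; ring
    rw [e1, e2, e3]
    have h1 : t ≤ 1 - (v + 1) * t := by nlinarith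
    have h2 : 1 ≤ (v + 2) * (1 - (v + 1) * t) := by nlinarith
    have h3 : v ≤ ((D.card : ℝ) + 1) ^ 2 * (1 - (v + 1) * t) := by
      have h4 : v * (v + 2) ≤ ((D.card : ℝ) + 1) ^ 2 := by nlinarith
      have h5 : 0 ≤ 1 - (v + 1) * t := by linarith
      calc v ≤ v * ((v + 2) * (1 - (v + 1) * t)) := le_mul_of_one_le_right hv0 h2
        _ = (v * (v + 2)) * (1 - (v + 1) * t) := by ring
        _ ≤ _ := mul_le_mul_of_nonneg_right h4 h5
    have h6 := mul_le_mul_of_nonneg_left h3 (sq_nonneg t)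
    nlinarith

/-- The primes up to `B`, as elements of `Nat.Primes`. -/
noncomputable def primesUpTo (B : ℕ) : Finset Nat.Primes :=
  ((Set.finite_Iic B).preimage (f := fun p : Nat.Primes => (p : ℕ))
    Subtype.val_injective.injOn).toFinset

theorem mem_primesUpTo {B : ℕ} {p : Nat.Primes} : p ∈ primesUpTo B ↔ (p : ℕ) ≤ B := by
  simp [primesUpTo]

theorem prod_primes_ite_dvd {m : ℤ} (hm : m ≠ 0) {S : Finset Nat.Primes}
    (hS : primesUpTo m.natAbs ⊆ S) (f : ℕ → ℝ) :
    ∏ p ∈ S, (if ((p : ℕ) : ℤ) ∣ m then f p else 1) = ∏ p ∈ m.natAbs.primeFactors, f p := by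
  rw [← Finset.prod_filter]
  refine Finset.prod_bij (fun p _ => (p : ℕ)) ?_ ?_ ?_ ?_
  · intro p hp
    rw [Nat.mem_primeFactors]
    exact ⟨p.2, Int.natCast_dvd.1 (Finset.mem_filter.1 hp).2, Int.natAbs_ne_zero.2 hm⟩
  · intro p _ q _ h
    exact Subtype.val_injective h
  · intro p hp
    rw [Nat.mem_primeFactors] at hp
    refine ⟨⟨p, hp.1⟩, Finset.mem_filter.2 ⟨hS (mem_primesUpTo.2 ?_), ?_⟩, rfl⟩
    · exact Nat.le_of_dvd (Nat.pos_of_ne_zero hp.2.2) hp.2.1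
    · exact Int.natCast_dvd.2 hp.2.1
  · intro p _
    rfl

/-- The singular series of the enlarged set, bounded by the arithmetic of the differences `e - d`. -/
theorem singularSeries_insert_le {D : Finset ℤ} {e : ℤ} (he : e ∉ D) :
    singularSeries (insert e D) ≤ (∏ d ∈ D, primeWeight (e - d)) * singularSeries D := by
  refine singularSeries_le_mul (D.biUnion fun d => primesUpTo (e - d).natAbs) fun S hS => ?_
  have h1 : ∏ d ∈ D, primeWeight (e - d) =
      ∏ p ∈ S, ∏ d ∈ D, if ((p : ℕ) : ℤ) ∣ e - d then (1 - 1 / (p : ℝ))⁻¹ else 1 := by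
    rw [Finset.prod_comm]
    refine Finset.prod_congr rfl fun d hd => ?_
    have hne : e - d ≠ 0 := fun h => he (by rwa [sub_eq_zero.1 h])
    rw [prod_primes_ite_dvd hne ((Finset.subset_biUnion_of_mem _ hd).trans hS)
      (fun p => (1 - 1 / (p : ℝ))⁻¹), primeWeight]
  rw [h1, ← Finset.prod_mul_distrib]
  exact Finset.prod_le_prod (fun p _ => localFactor_nonneg _ p.2)
    fun p _ => localFactor_insert_le he p.2

theorem singularSeries_le_insert {D : Finset ℤ} {e : ℤ} (he : e ∉ D)
    (h : ∀ p : ℕ, p.Prime → residueCount (insert e D) p < p) :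
    singularSeries D ≤
      Real.exp (2 * ((D.card : ℝ) + 1) ^ 2) * singularSeries (insert e D) := by
  refine singularSeries_le_mul ∅ fun S _ => ?_
  calc ∏ p ∈ S, localFactor D p
      ≤ ∏ p ∈ S, ((1 + ((D.card : ℝ) + 1) ^ 2 / (p : ℝ) ^ 2) * localFactor (insert e D) p) :=
        Finset.prod_le_prod (fun p _ => localFactor_nonneg _ p.2)
          fun p _ => localFactor_le_insert he p.2 (h p p.2)
    _ ≤ _ := by
        rw [Finset.prod_mul_distrib]
        refine mul_le_mul_of_nonneg_right (prod_primes_one_add_div_sq_le S (by positivity)) ?_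
        exact Finset.prod_nonneg fun p _ => localFactor_nonneg _ p.2

theorem localFactor_le_of_residueCount_le {D D' : Finset ℤ} {p : ℕ} (hp : p.Prime)
    (hcard : D.card = D'.card) (h : residueCount D' p ≤ residueCount D p) :
    localFactor D p ≤ localFactor D' p := by
  have hlt := one_div_prime_lt_one hp
  rw [localFactor, localFactor, hcard]
  refine mul_le_mul_of_nonneg_left ?_ (inv_nonneg.2 (pow_nonneg (by linarith) _))
  have : (residueCount D' p : ℝ) / p ≤ residueCount D p / p := by gcongr
  linarith

theorem localFactor_dilate_of_ne {p q : ℕ} (hp : p.Prime) (hq : q.Prime) (hpq : p ≠ q)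
    (D : Finset ℤ) : localFactor (dilate q D) p = localFactor D p := by
  have : IsCoprime (p : ℤ) (q : ℤ) := Nat.isCoprime_iff_coprime.2 ((Nat.coprime_primes hp hq).2 hpq)
  rw [localFactor, localFactor, residueCount_dilate_of_coprime this, card_dilate hq.pos]

theorem residueCount_dilate_self {q : ℕ} {D : Finset ℤ} (hD : D.Nonempty) :
    residueCount (dilate q D) q = 1 := by
  refine residueCount_eq_one (hD.image _) fun a ha => ?_
  obtain ⟨d, -, rfl⟩ := mem_dilate.1 ha
  exact dvd_mul_right _ _

theorem localFactor_le_dilate {q p : ℕ} (hq : q.Prime) (hp : p.Prime) {D : Finset ℤ}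
    (hD : D.Nonempty) : localFactor D p ≤ localFactor (dilate q D) p := by
  by_cases hpq : p = q
  · subst hpq
    refine localFactor_le_of_residueCount_le hp (card_dilate hq.pos D).symm ?_
    rw [residueCount_dilate_self hD]
    exact residueCount_pos hD p
  · rw [localFactor_dilate_of_ne hp hq hpq]

theorem singularSeries_le_dilate {q : ℕ} (hq : q.Prime) {D : Finset ℤ} (hD : D.Nonempty) :
    singularSeries D ≤ singularSeries (dilate q D) := by
  have := singularSeries_le_mul (D := D) (D' := dilate q D) (K := 1) ∅ fun S _ => by
    rw [one_mul]
    exact Finset.prod_le_prod (fun p _ => localFactor_nonneg _ p.2)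
      fun p _ => localFactor_le_dilate hq p.2 hD
  rwa [one_mul] at this

theorem singularSeries_dilate_eq {q : ℕ} (hq : q.Prime) {D : Finset ℤ} (hD : D.Nonempty)
    (h : ∀ d ∈ D, (q : ℤ) ∣ d) : singularSeries (dilate q D) = singularSeries D := by
  unfold singularSeries
  refine tprod_congr fun p => ?_
  by_cases hpq : (p : ℕ) = q
  · rw [localFactor, localFactor, hpq, residueCount_dilate_self hD, residueCount_eq_one hD h,
      card_dilate hq.pos]
  · exact localFactor_dilate_of_ne p.2 hq hpq D

/-- Dilation by a prime `q` modulo which `D` is not constant gains a factor `1 + 1 / q`. -/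
theorem mul_singularSeries_le_dilate {q : ℕ} (hq : q.Prime) {D : Finset ℤ}
    (h : 2 ≤ residueCount D q) :
    (1 + 1 / (q : ℝ)) * singularSeries D ≤ singularSeries (dilate q D) := by
  have hD : D.Nonempty := by
    by_contra hne
    rw [Finset.not_nonempty_iff_eq_empty] at hne
    subst hne
    simp [residueCount] at h
  have hq0 : (0 : ℝ) < 1 + 1 / q := by positivity
  rw [← le_inv_mul_iff₀ hq0]
  refine singularSeries_le_mul {⟨q, hq⟩} fun S hS => ?_
  have hmem : (⟨q, hq⟩ : Nat.Primes) ∈ S := hS (Finset.mem_singleton_self _)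
  rw [le_inv_mul_iff₀ hq0, ← Finset.mul_prod_erase S _ hmem, ← Finset.mul_prod_erase S _ hmem,
    ← mul_assoc]
  refine mul_le_mul ?_ ?_ (Finset.prod_nonneg fun p _ => localFactor_nonneg _ p.2)
    (localFactor_nonneg _ hq)
  · have hlt := one_div_prime_lt_one hq
    simp only [localFactor, residueCount_dilate_self hD, card_dilate hq.pos]
    rw [mul_left_comm]
    refine mul_le_mul_of_nonneg_left ?_ (inv_nonneg.2 (pow_nonneg (by linarith) _))
    have h2 : (2 : ℝ) ≤ residueCount D q := by exact_mod_cast h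
    have h3 : 2 / (q : ℝ) ≤ residueCount D q / q := by gcongr
    have h4 : 2 / (q : ℝ) = 2 * (1 / q) := by ring
    have h5 : (0 : ℝ) ≤ 1 / q := by positivity
    push_cast
    nlinarith
  · exact Finset.prod_le_prod (fun p _ => localFactor_nonneg _ p.2)
      fun p _ => localFactor_le_dilate hq p.2 hD

/-! ### Averages of singular series -/

theorem inv_one_sub_le {p : ℕ} (hp : p.Prime) : (1 - 1 / (p : ℝ))⁻¹ ≤ 1 + 2 / p := by
  have h2 : (2 : ℝ) ≤ p := by exact_mod_cast hp.two_le
  have hlt := one_div_prime_lt_one hp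
  rw [inv_le_iff_one_le_mul₀ (by linarith)]
  have ht : (1 : ℝ) / p ≤ 1 / 2 := by gcongr
  have ht0 : (0 : ℝ) ≤ 1 / p := by positivity
  have e : (2 : ℝ) / p = 2 * (1 / p) := by ring
  rw [e]
  nlinarith

theorem pow_one_add_le (n : ℕ) {s : ℝ} (h0 : 0 ≤ s) (h1 : s ≤ 1) :
    (1 + s) ^ n ≤ 1 + 2 ^ n * s := by
  suffices h : (1 + s) ^ n ≤ 1 + (2 ^ n - 1) * s by nlinarith
  induction n with
  | zero => simp
  | succ n ih =>
    have hn : (1 : ℝ) ≤ 2 ^ n := one_le_pow₀ one_le_two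
    rw [pow_succ]
    refine (mul_le_mul_of_nonneg_right ih (by linarith)).trans ?_
    rw [pow_succ]
    have : ((2 : ℝ) ^ n - 1) * s * s ≤ (2 ^ n - 1) * s * 1 := by
      gcongr
    nlinarith

theorem inv_one_sub_pow_le {p : ℕ} (hp : p.Prime) (n : ℕ) :
    (1 - 1 / (p : ℝ))⁻¹ ^ n ≤ 1 + 2 ^ (n + 1) / p := by
  have h2 : (2 : ℝ) ≤ p := by exact_mod_cast hp.two_le
  have h := one_le_inv_one_sub hp
  calc (1 - 1 / (p : ℝ))⁻¹ ^ n ≤ (1 + 2 / (p : ℝ)) ^ n := by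
        gcongr
        exact inv_one_sub_le hp
    _ ≤ 1 + 2 ^ n * (2 / p) :=
        pow_one_add_le n (by positivity) (by rw [div_le_one (by linarith)]; exact h2)
    _ = _ := by rw [pow_succ]; ring

theorem card_primeFactors_le {m A : ℕ} (hm : m ≠ 0) (h : m ≤ 2 ^ A) :
    m.primeFactors.card ≤ A := by
  have h1 : 2 ^ m.primeFactors.card ≤ ∏ p ∈ m.primeFactors, p :=
    Finset.pow_card_le_prod _ _ _ fun p hp => (Nat.prime_of_mem_primeFactors hp).two_le
  have h2 := Nat.le_of_dvd (Nat.pos_of_ne_zero hm) (Nat.prod_primeFactors_dvd m)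
  exact (Nat.pow_le_pow_iff_right one_lt_two).1 (h1.trans (h2.trans h))

/-- The primes above `y` contribute a bounded factor to `primeWeight m` when `log |m| = O(y)`. -/
theorem primeWeight_le {m : ℤ} (hm : m ≠ 0) {A y : ℕ} (hy : 1 ≤ y)
    (h : m.natAbs ≤ 2 ^ (A * y)) :
    primeWeight m ≤ Real.exp (2 * A) *
      ∏ p ∈ Nat.primesLE y, if (p : ℤ) ∣ m then (1 - 1 / (p : ℝ))⁻¹ else 1 := by
  have hm' : m.natAbs ≠ 0 := Int.natAbs_ne_zero.2 hm
  have hy' : (0 : ℝ) < y := by exact_mod_cast hy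
  rw [primeWeight, ← Finset.prod_filter_mul_prod_filter_not m.natAbs.primeFactors
    (fun p => y < p)]
  refine mul_le_mul ?_ ?_ (Finset.prod_nonneg fun p hp => ?_) (Real.exp_pos _).le
  · calc ∏ p ∈ m.natAbs.primeFactors with y < p, (1 - 1 / (p : ℝ))⁻¹
        ≤ ∏ p ∈ m.natAbs.primeFactors with y < p, Real.exp (2 / y) := by
          refine Finset.prod_le_prod (fun p hp => ?_) fun p hp => ?_
          · have := one_le_inv_one_sub (Nat.prime_of_mem_primeFactors (Finset.mem_filter.1 hp).1)
            linarith
          · have hpp := Nat.prime_of_mem_primeFactors (Finset.mem_filter.1 hp).1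
            have hyp : (y : ℝ) ≤ p := by exact_mod_cast (Finset.mem_filter.1 hp).2.le
            refine (inv_one_sub_le hpp).trans ?_
            rw [add_comm]
            refine le_trans (by gcongr) (Real.add_one_le_exp _)
      _ ≤ Real.exp (2 * A) := by
          rw [Finset.prod_const, ← Real.exp_nat_mul]
          refine Real.exp_le_exp.2 ?_
          have hc : ((m.natAbs.primeFactors.filter fun p => y < p).card : ℝ) ≤ A * y := by
            exact_mod_cast (Finset.card_filter_le _ _).trans (card_primeFactors_le hm' h)
          calc _ ≤ (A * y : ℝ) * (2 / y) := by gcongr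
            _ = 2 * A := by field_simp
  · rw [← Finset.prod_filter]
    refine Finset.prod_le_prod_of_subset_of_one_le ?_ ?_ ?_
    · intro p hp
      simp only [Finset.mem_filter, Nat.mem_primeFactors, not_lt] at hp
      exact Finset.mem_filter.2 ⟨Nat.mem_primesLE.2 ⟨hp.2, hp.1.1⟩, Int.natCast_dvd.2 hp.1.2.1⟩
    · intro p hp
      have := one_le_inv_one_sub (Nat.prime_of_mem_primeFactors (Finset.mem_filter.1 hp).1)
      linarith
    · intro p hp _
      exact one_le_inv_one_sub (Nat.mem_primesLE.1 (Finset.mem_filter.1 hp).1).2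
  · have := one_le_inv_one_sub (Nat.prime_of_mem_primeFactors (Finset.mem_filter.1 hp).1)
    linarith

/-- A product is bounded by the corresponding power of its largest factor. This separates the
elements of `D` in the average over `e`. -/
theorem prod_le_sum_pow_card {ι : Type*} {s : Finset ι} (hs : s.Nonempty) (u : ι → ℝ)
    (hu : ∀ i ∈ s, 0 ≤ u i) : ∏ i ∈ s, u i ≤ ∑ i ∈ s, u i ^ s.card := by
  obtain ⟨j, hj, hmax⟩ := s.exists_max_image u hs
  calc ∏ i ∈ s, u i ≤ ∏ _i ∈ s, u j := Finset.prod_le_prod hu hmax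
    _ = u j ^ s.card := by rw [Finset.prod_const]
    _ ≤ _ := Finset.single_le_sum (f := fun i => u i ^ s.card)
        (fun i hi => pow_nonneg (hu i hi) _) hj

theorem card_Ioo_filter_dvd_le (H a : ℕ) (ha : 0 < a) (d : ℤ) :
    (((Finset.Ioo (0 : ℤ) H).filter fun e => (a : ℤ) ∣ e - d).card : ℝ) ≤ H / a + 1 := by
  have ha' : (0 : ℤ) < a := by exact_mod_cast ha
  have hsub : ((Finset.Ioo (0 : ℤ) H).filter fun e => (a : ℤ) ∣ e - d) ⊆
      (Finset.Ico (0 : ℤ) H).filter fun e => e ≡ d [ZMOD (a : ℤ)] := by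
    intro e he
    simp only [Finset.mem_filter, Finset.mem_Ioo, Finset.mem_Ico] at he ⊢
    exact ⟨⟨he.1.1.le, he.1.2⟩, (Int.modEq_iff_dvd.2 he.2).symm⟩
  have h1 : ((((Finset.Ico (0 : ℤ) H).filter fun e => e ≡ d [ZMOD (a : ℤ)]).card : ℤ) : ℝ) ≤
      H / a + 1 := by
    rw [Int.Ico_filter_modEq_card _ _ ha']
    have hb := Int.ceil_lt_add_one (((H : ℤ) - d : ℚ) / ((a : ℤ) : ℚ))
    have hc := Int.le_ceil (((0 : ℤ) - d : ℚ) / ((a : ℤ) : ℚ))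
    have h3 : ((max (⌈(((H : ℤ) : ℚ) - d) / ((a : ℤ) : ℚ)⌉ -
        ⌈(((0 : ℤ) : ℚ) - d) / ((a : ℤ) : ℚ)⌉) 0 : ℤ) : ℚ) ≤ H / a + 1 := by
      rw [Int.cast_max, max_le_iff]
      constructor
      · push_cast at hb hc ⊢
        have : ((H : ℚ) - d) / a = H / a + (0 - d) / a := by ring
        linarith
      · push_cast
        positivity
    have h4 := (Rat.cast_le (K := ℝ)).2 h3
    rw [Rat.cast_intCast] at h4
    exact h4.trans (le_of_eq (by push_cast; rfl))
  refine le_trans ?_ h1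
  exact_mod_cast Finset.card_le_card hsub

theorem prod_dvd_iff_of_primes {U : Finset ℕ} (hU : ∀ p ∈ U, p.Prime) (m : ℤ) :
    ((∏ p ∈ U, p : ℕ) : ℤ) ∣ m ↔ ∀ p ∈ U, (p : ℤ) ∣ m := by
  constructor
  · intro h p hp
    exact dvd_trans (by exact_mod_cast Finset.dvd_prod_of_mem (fun p : ℕ => p) hp) h
  · intro h
    rw [Int.natCast_dvd]
    exact Finset.prod_primes_dvd _ (fun p hp => (hU p hp).prime) fun p hp =>
      Int.natCast_dvd.1 (h p hp)

/-- Expanding the product gives a sum over the squarefree `a` composed of primes up to `y`. As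
`a ≤ 4 ^ y ≤ H`, the number of `e` with `a ∣ e - d` is at most `2 H / a`, and the resulting sum
converges. -/
theorem sum_Ioo_prod_ite_dvd_le {y H : ℕ} (hH : 4 ^ y ≤ H) {c : ℝ} (hc : 0 ≤ c) (d : ℤ) :
    ∑ e ∈ Finset.Ioo (0 : ℤ) H,
        ∏ p ∈ Nat.primesLE y, (1 + if (p : ℤ) ∣ e - d then c / p else 0) ≤
      2 * H * Real.exp (2 * c) := by
  have hexp : ∀ e : ℤ, ∏ p ∈ Nat.primesLE y, (1 + if (p : ℤ) ∣ e - d then c / (p : ℝ) else 0) =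
      ∑ U ∈ (Nat.primesLE y).powerset,
        if ((∏ p ∈ U, p : ℕ) : ℤ) ∣ e - d then ∏ p ∈ U, c / (p : ℝ) else 0 := by
    intro e
    rw [Finset.prod_one_add]
    refine Finset.sum_congr rfl fun U hU => ?_
    have hUp : ∀ p ∈ U, p.Prime := fun p hp =>
      (Nat.mem_primesLE.1 (Finset.mem_powerset.1 hU hp)).2
    simp only [prod_dvd_iff_of_primes hUp]
    split_ifs with h
    · exact Finset.prod_congr rfl fun p hp => if_pos (h p hp)
    · push Not at h
      obtain ⟨p, hp, hpd⟩ := h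
      exact Finset.prod_eq_zero hp (if_neg hpd)
  simp_rw [hexp]
  rw [Finset.sum_comm]
  have hbound : ∀ U ∈ (Nat.primesLE y).powerset, ∑ e ∈ Finset.Ioo (0 : ℤ) H,
      (if ((∏ p ∈ U, p : ℕ) : ℤ) ∣ e - d then ∏ p ∈ U, c / (p : ℝ) else 0) ≤
      2 * H * ∏ p ∈ U, c / (p : ℝ) ^ 2 := by
    intro U hU
    have hUs := Finset.mem_powerset.1 hU
    set a : ℕ := ∏ p ∈ U, p with ha
    have ha0 : 0 < a := Finset.prod_pos fun p hp => (Nat.mem_primesLE.1 (hUs hp)).2.pos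
    have haH : a ≤ H := by
      refine le_trans ?_ ((primorial_le_four_pow y).trans hH)
      rw [primorial_eq_prod_primesLE]
      exact Finset.prod_le_prod_of_subset_of_one_le' hUs
        fun p hp _ => (Nat.mem_primesLE.1 hp).2.pos
    rw [← Finset.sum_filter, Finset.sum_const, nsmul_eq_mul]
    have ha0' : (0 : ℝ) < a := by exact_mod_cast ha0
    have h1 : (1 : ℝ) ≤ H / a := by
      rw [le_div_iff₀ ha0', one_mul]; exact_mod_cast haH
    have h2 : ∏ p ∈ U, c / (p : ℝ) ^ 2 = (∏ p ∈ U, c / (p : ℝ)) / a := by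
      rw [ha, Nat.cast_prod, ← Finset.prod_div_distrib]
      exact Finset.prod_congr rfl fun p _ => by rw [sq, div_div]
    have h3 : 0 ≤ ∏ p ∈ U, c / (p : ℝ) := Finset.prod_nonneg fun p _ => by positivity
    calc _ ≤ ((H : ℝ) / a + 1) * ∏ p ∈ U, c / (p : ℝ) := by
          gcongr
          exact card_Ioo_filter_dvd_le H a ha0 d
      _ ≤ (2 * (H / a)) * ∏ p ∈ U, c / (p : ℝ) := by
          gcongr
          linarith
      _ = _ := by rw [h2]; ring
  refine (Finset.sum_le_sum hbound).trans ?_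
  rw [← Finset.mul_sum, ← Finset.prod_one_add]
  exact mul_le_mul_of_nonneg_left (prod_nat_one_add_div_sq_le _ hc) (by positivity)

/-- On average over `e` in an interval of length `H`, adding `e` to `D` multiplies the singular
series by a bounded factor at most. The interval may be much shorter than the distances `|e - d|`:
it is enough that `log H` and `log |e - d|` are of the same order. -/
theorem exists_sum_singularSeries_insert_le (n A : ℕ) (hn : 1 ≤ n) :
    ∃ C : ℝ, 0 < C ∧ ∀ (D : Finset ℤ) (y H : ℕ), D.card = n → 1 ≤ y → 4 ^ y ≤ H →
      (∀ d ∈ D, ∀ e ∈ Finset.Ioo (0 : ℤ) H, (e - d).natAbs ≤ 2 ^ (A * y)) →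
      ∑ e ∈ Finset.Ioo (0 : ℤ) H \ D, singularSeries (insert e D) ≤
        C * H * singularSeries D := by
  refine ⟨Real.exp (2 * A) ^ n * (n * (2 * Real.exp (2 * 2 ^ (n + 1)))), by positivity, ?_⟩
  intro D y H hcard hy hH hdist
  have hD : D.Nonempty := by
    rw [← Finset.card_pos]
    omega
  have hS := singularSeries_nonneg D
  set u : ℤ → ℝ := fun m =>
    ∏ p ∈ Nat.primesLE y, if (p : ℤ) ∣ m then (1 - 1 / (p : ℝ))⁻¹ else 1 with hu
  have hu0 : ∀ m, 0 ≤ u m := fun m => Finset.prod_nonneg fun p hp => by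
    have := one_le_inv_one_sub (Nat.mem_primesLE.1 hp).2
    split_ifs <;> linarith
  have hun : ∀ m, u m ^ n ≤
      ∏ p ∈ Nat.primesLE y, (1 + if (p : ℤ) ∣ m then 2 ^ (n + 1) / (p : ℝ) else 0) := by
    intro m
    rw [hu, ← Finset.prod_pow]
    refine Finset.prod_le_prod (fun p hp => pow_nonneg ?_ _) fun p hp => ?_
    · have := one_le_inv_one_sub (Nat.mem_primesLE.1 hp).2
      split_ifs <;> linarith
    · split_ifs with h
      · exact inv_one_sub_pow_le (Nat.mem_primesLE.1 hp).2 n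
      · simp
  have hterm : ∀ e ∈ Finset.Ioo (0 : ℤ) H \ D, singularSeries (insert e D) ≤
      Real.exp (2 * A) ^ n * singularSeries D * ∑ d ∈ D, u (e - d) ^ n := by
    intro e he
    rw [Finset.mem_sdiff] at he
    refine (singularSeries_insert_le he.2).trans ?_
    have h1 : ∏ d ∈ D, primeWeight (e - d) ≤ ∏ d ∈ D, (Real.exp (2 * A) * u (e - d)) := by
      refine Finset.prod_le_prod (fun d _ => ?_) fun d hd => ?_
      · refine Finset.prod_nonneg fun p hp => ?_
        have := one_le_inv_one_sub (Nat.prime_of_mem_primeFactors hp)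
        linarith
      · have hne : e - d ≠ 0 := fun h => he.2 (by rwa [sub_eq_zero.1 h])
        exact primeWeight_le hne hy (hdist d hd e he.1)
    have h2 : ∏ d ∈ D, u (e - d) ≤ ∑ d ∈ D, u (e - d) ^ n := by
      have := prod_le_sum_pow_card hD (fun d => u (e - d)) fun d _ => hu0 _
      rwa [hcard] at this
    rw [Finset.prod_mul_distrib, Finset.prod_const, hcard] at h1
    calc (∏ d ∈ D, primeWeight (e - d)) * singularSeries D
        ≤ (Real.exp (2 * A) ^ n * ∑ d ∈ D, u (e - d) ^ n) * singularSeries D := by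
          refine mul_le_mul_of_nonneg_right (h1.trans ?_) hS
          gcongr
      _ = _ := by ring
  have hsum : ∑ e ∈ Finset.Ioo (0 : ℤ) H \ D, ∑ d ∈ D, u (e - d) ^ n ≤
      n * (2 * H * Real.exp (2 * 2 ^ (n + 1))) := by
    rw [Finset.sum_comm, ← hcard, ← nsmul_eq_mul]
    refine Finset.sum_le_card_nsmul _ _ _ fun d _ => ?_
    refine le_trans ?_ (sum_Ioo_prod_ite_dvd_le hH (c := 2 ^ (n + 1)) (by positivity) d) |>.trans
      (by rw [hcard])
    refine (Finset.sum_le_sum_of_subset_of_nonneg Finset.sdiff_subset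
      fun e _ _ => pow_nonneg (hu0 _) _).trans ?_
    rw [hcard]
    exact Finset.sum_le_sum fun e _ => hun _
  refine (Finset.sum_le_sum hterm).trans ?_
  rw [← Finset.mul_sum]
  refine (mul_le_mul_of_nonneg_left hsum (by positivity)).trans (le_of_eq ?_)
  ring

/-! ### The gain from dividing by a common prime factor -/

/-- An interval of length `H` contains a positive proportion of elements `t u` with `p ∤ u` outside
`T`, uniformly in the prime `p`. -/
theorem exists_card_multiples_ge (k : ℕ) : ∃ c : ℝ, 0 < c ∧ ∃ H₀ : ℕ, ∀ (p t H : ℕ) (T : Finset ℤ),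
    p.Prime → 0 < t → t ≤ 2 * 4 ^ (k + 2) → H₀ ≤ H → T.card = k + 1 → ∃ Y : Finset ℤ,
      (∀ e ∈ Y, e ∈ Finset.Ioo (0 : ℤ) H \ T ∧ ∃ u : ℕ, ¬ p ∣ u ∧ e = t * u) ∧
      c * H ≤ Y.card := by
  set B : ℕ := 2 * 4 ^ (k + 2) with hB
  have hB0 : 0 < B := by positivity
  refine ⟨1 / (4 * B), by positivity, 4 * B * (k + 3), ?_⟩
  intro p t H T hp ht htB hH hT
  set N : ℕ := (H - 1) / t with hN
  set Y₀ : Finset ℕ := (Finset.Ioc 0 N).filter fun u => ¬ p ∣ u with hY₀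
  have ht' : (t : ℤ) ≠ 0 := by exact_mod_cast ht.ne'
  have hinj : Function.Injective fun u : ℕ => (t : ℤ) * u := fun a b hab => by
    have := mul_left_cancel₀ ht' hab
    exact_mod_cast this
  have hcard₀ : N ≤ 2 * Y₀.card := by
    have h1 := Finset.card_filter_add_card_filter_not (s := Finset.Ioc 0 N) (fun u => p ∣ u)
    rw [Nat.Ioc_filter_dvd_card_eq_div, Nat.card_Ioc] at h1
    have h2 : N / p ≤ N / 2 := Nat.div_le_div_left hp.two_le two_pos
    have h3 : (Finset.filter (fun u => ¬ p ∣ u) (Finset.Ioc 0 N)).card = Y₀.card := rfl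
    omega
  have hHN : H ≤ B * (N + 1) := by
    have h1 : H - 1 < t * (N + 1) := by
      rw [hN]; exact Nat.lt_mul_div_succ _ ht
    have h2 : t * (N + 1) ≤ B * (N + 1) := Nat.mul_le_mul_right _ htB
    omega
  refine ⟨(Y₀.image fun u : ℕ => (t : ℤ) * u) \ T, ?_, ?_⟩
  · intro e he
    rw [Finset.mem_sdiff, Finset.mem_image] at he
    obtain ⟨⟨u, hu, rfl⟩, heT⟩ := he
    rw [hY₀, Finset.mem_filter, Finset.mem_Ioc] at hu
    refine ⟨Finset.mem_sdiff.2 ⟨Finset.mem_Ioo.2 ⟨?_, ?_⟩, heT⟩, u, hu.2, rfl⟩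
    · have := hu.1.1
      positivity
    · have h1 : t * u ≤ H - 1 :=
        (Nat.mul_le_mul_left t hu.1.2).trans (Nat.mul_div_le _ _)
      have h2 : 0 < H := lt_of_lt_of_le (by positivity) hH
      have h3 : t * u < H := by omega
      exact_mod_cast h3
  · have h1 := Finset.le_card_sdiff T (Y₀.image fun u : ℕ => (t : ℤ) * u)
    rw [Finset.card_image_of_injective _ hinj, hT] at h1
    set c : ℕ := ((Y₀.image fun u : ℕ => (t : ℤ) * u) \ T).card
    have h2 : N ≤ 2 * (c + (k + 1)) := by omega
    have h3 : H ≤ B * (2 * c + 2 * k + 3) := hHN.trans (Nat.mul_le_mul_left _ (by omega))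
    have h4 : H ≤ 4 * B * c := by nlinarith
    rw [one_div, inv_mul_le_iff₀ (by positivity)]
    exact_mod_cast h4

theorem residueCount_insert_le (D : Finset ℤ) (e : ℤ) (p : ℕ) :
    residueCount (insert e D) p ≤ residueCount D p + 1 := by
  by_cases h : ∃ d ∈ D, (p : ℤ) ∣ e - d
  · rw [residueCount_insert_of_dvd h]
    omega
  · rw [residueCount_insert_of_not_dvd h]

/-- If all elements of `T` are multiples of the prime `p`, then `T` and its dilation by `p` have
the same singular series, but an interval of length `H` offers more extensions to the dilation
than the interval of length `H / p` offers to `T`. Each extension of `T` by `e` has a counterpart,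
the extension of the dilation by `p * e`; and there are extensions without counterpart, by
non-multiples of `p` or, for `p = 2`, by `e ≡ 2 mod 4`. -/
theorem exists_sum_singularSeries_insert_dilate_ge (k : ℕ) : ∃ c : ℝ, 0 < c ∧ ∃ H₀ : ℕ,
    ∀ (p H : ℕ) (T : Finset ℤ), p.Prime → H₀ ≤ H → T.card = k + 1 → 0 ∈ T →
      (∀ d ∈ T, (p : ℤ) ∣ d) → singularSeries T ≠ 0 →
      ∀ E : Finset ℤ, (∀ e ∈ E, 0 < e ∧ (p : ℤ) * e < H ∧ e ∉ T) →
      ∑ e ∈ E, singularSeries (insert e T) + c * H * singularSeries T ≤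
        ∑ e ∈ Finset.Ioo (0 : ℤ) H \ dilate p T, singularSeries (insert e (dilate p T)) := by
  obtain ⟨c, hc, H₀, hY⟩ := exists_card_multiples_ge k
  refine ⟨c * (Real.exp (2 * ((k : ℝ) + 2) ^ 2))⁻¹, by positivity, H₀, ?_⟩
  intro p H T hp hH hT h0 hdvd hS E hE
  have hp0 : (p : ℤ) ≠ 0 := by exact_mod_cast hp.ne_zero
  have hTne : T.Nonempty := ⟨0, h0⟩
  set T' := dilate p T with hT'
  have h0' : (0 : ℤ) ∈ T' := mem_dilate.2 ⟨0, h0, by simp⟩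
  have hT'card : T'.card = k + 1 := by rw [hT', card_dilate hp.pos, hT]
  have hST' : singularSeries T' = singularSeries T := singularSeries_dilate_eq hp hTne hdvd
  have hν' := singularSeries_ne_zero_iff.1 (hST'.symm ▸ hS)
  -- the step `t` of the extensions without counterpart: a multiple of all small primes but `p`
  set Q : ℕ := ∏ q ∈ (Nat.primesLE (k + 2)).erase p, q with hQ
  set t : ℕ := (if p = 2 then 2 else 1) * Q with ht
  have hprimeQ : ∀ q ∈ (Nat.primesLE (k + 2)).erase p, q.Prime := fun q hq =>
    (Nat.mem_primesLE.1 (Finset.mem_of_mem_erase hq)).2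
  have hQ0 : 0 < Q := Finset.prod_pos fun q hq => (hprimeQ q hq).pos
  have hpQ : ¬ p ∣ Q := by
    rw [hQ, hp.prime.dvd_finsetProd_iff]
    rintro ⟨q, hq, hpq⟩
    exact (Finset.ne_of_mem_erase hq) ((Nat.prime_dvd_prime_iff_eq hp (hprimeQ q hq)).1 hpq).symm
  have hQ4 : Q ≤ 4 ^ (k + 2) := by
    refine le_trans ?_ (primorial_le_four_pow (k + 2))
    rw [primorial_eq_prod_primesLE]
    exact Finset.prod_le_prod_of_subset_of_one_le' (Finset.erase_subset _ _)
      fun q hq _ => (Nat.mem_primesLE.1 hq).2.pos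
  have ht0 : 0 < t := by
    rw [ht]
    split_ifs <;> omega
  have htB : t ≤ 2 * 4 ^ (k + 2) := by
    rw [ht]
    split_ifs <;> omega
  obtain ⟨Y, hYmem, hYcard⟩ := hY p t H T' hp ht0 htB hH hT'card
  set E' := E.filter fun e => singularSeries (insert e T) ≠ 0 with hE'
  have hinj : Set.InjOn (fun e : ℤ => (p : ℤ) * e) E' := fun a _ b _ hab =>
    mul_left_cancel₀ hp0 hab
  have hdisj : Disjoint (E'.image fun e => (p : ℤ) * e) Y := by
    rw [Finset.disjoint_left]
    intro f hf hfY
    obtain ⟨e, he, rfl⟩ := Finset.mem_image.1 hf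
    obtain ⟨-, u, hpu, hfu⟩ := hYmem _ hfY
    have hadm := singularSeries_ne_zero_iff.1 (Finset.mem_filter.1 he).2
    by_cases hp2 : p = 2
    · -- here `e = Q * u` is odd, and `insert e T` meets both classes modulo `2`
      have h1 : e = ((Q * u : ℕ) : ℤ) := by
        rw [ht, if_pos hp2, hp2] at hfu
        push_cast at hfu ⊢
        have : (2 : ℤ) * e = 2 * (Q * u) := by rw [hfu]; ring
        omega
      have h2 : ¬ (p : ℤ) ∣ e - 0 := by
        rw [sub_zero, h1, Int.natCast_dvd_natCast, hp.dvd_mul]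
        tauto
      have h3 := two_le_residueCount (Finset.mem_insert_self e T)
        (Finset.mem_insert_of_mem h0) h2
      have h4 := hadm p hp
      omega
    · rw [ht, if_neg hp2, one_mul] at hfu
      have h1 : (p : ℤ) ∣ ((Q * u : ℕ) : ℤ) := ⟨e, by push_cast; exact hfu.symm⟩
      rw [Int.natCast_dvd_natCast, hp.dvd_mul] at h1
      tauto
  have hsub : (E'.image fun e => (p : ℤ) * e) ∪ Y ⊆ Finset.Ioo (0 : ℤ) H \ T' := by
    refine Finset.union_subset (fun f hf => ?_) fun f hf => (hYmem f hf).1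
    obtain ⟨e, he, rfl⟩ := Finset.mem_image.1 hf
    obtain ⟨h1, h2, h3⟩ := hE e (Finset.mem_filter.1 he).1
    have hp' : (0 : ℤ) < p := by exact_mod_cast hp.pos
    refine Finset.mem_sdiff.2 ⟨Finset.mem_Ioo.2 ⟨by positivity, h2⟩, fun hmem => h3 ?_⟩
    obtain ⟨d, hd, hde⟩ := mem_dilate.1 hmem
    rwa [← mul_left_cancel₀ hp0 hde]
  have hYterm : ∀ e ∈ Y, (Real.exp (2 * ((k : ℝ) + 2) ^ 2))⁻¹ * singularSeries T ≤
      singularSeries (insert e T') := by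
    intro e he
    obtain ⟨hemem, u, hpu, heu⟩ := hYmem e he
    have heT' := (Finset.mem_sdiff.1 hemem).2
    have hadm : ∀ q : ℕ, q.Prime → residueCount (insert e T') q < q := by
      intro q hq
      by_cases hqp : q = p
      · subst hqp
        have h1 : residueCount T' q = 1 := residueCount_dilate_self hTne
        by_cases hq2 : q = 2
        · have h2 : (q : ℤ) ∣ e - 0 := by
            rw [heu, ht, if_pos hq2, hq2, sub_zero]
            exact ⟨Q * u, by push_cast; ring⟩
          rw [residueCount_insert_of_dvd ⟨0, h0', h2⟩, h1]
          exact hq.one_lt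
        · have h2 := residueCount_insert_le T' e q
          have h3 := hq.two_le
          omega
      · rcases Nat.lt_or_ge (k + 2) q with hlt | hge
        · refine lt_of_le_of_lt (residueCount_le_card _ _) ?_
          rw [Finset.card_insert_of_notMem heT', hT'card]
          omega
        · have h1 : q ∣ Q := Finset.dvd_prod_of_mem (fun q : ℕ => q)
            (Finset.mem_erase.2 ⟨hqp, Nat.mem_primesLE.2 ⟨hge, hq⟩⟩)
          have h2 : (q : ℤ) ∣ e - 0 := by
            rw [heu, sub_zero]
            exact_mod_cast (h1.mul_left _).mul_right u
          rw [residueCount_insert_of_dvd ⟨0, h0', h2⟩]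
          exact hν' q hq
    have h1 := singularSeries_le_insert heT' hadm
    rw [hST', hT'card] at h1
    rw [inv_mul_le_iff₀ (Real.exp_pos _)]
    refine h1.trans (le_of_eq ?_)
    push_cast
    ring_nf
  calc ∑ e ∈ E, singularSeries (insert e T) +
        c * (Real.exp (2 * ((k : ℝ) + 2) ^ 2))⁻¹ * H * singularSeries T
      ≤ ∑ e ∈ E'.image (fun e => (p : ℤ) * e), singularSeries (insert e T') +
        ∑ e ∈ Y, singularSeries (insert e T') := by
        refine add_le_add ?_ ?_
        · rw [Finset.sum_image hinj, ← Finset.sum_filter_ne_zero]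
          refine Finset.sum_le_sum fun e _ => ?_
          rw [hT', ← dilate_insert]
          exact singularSeries_le_dilate hp (Finset.insert_nonempty _ _)
        · have h1 := Finset.card_nsmul_le_sum Y _ _ hYterm
          rw [nsmul_eq_mul] at h1
          refine le_trans ?_ h1
          have h2 : 0 ≤ (Real.exp (2 * ((k : ℝ) + 2) ^ 2))⁻¹ * singularSeries T :=
            mul_nonneg (by positivity) (singularSeries_nonneg _)
          calc _ = c * H * ((Real.exp (2 * ((k : ℝ) + 2) ^ 2))⁻¹ * singularSeries T) := by ring
            _ ≤ _ := mul_le_mul_of_nonneg_right hYcard h2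
    _ = ∑ e ∈ (E'.image fun e => (p : ℤ) * e) ∪ Y, singularSeries (insert e T') :=
        (Finset.sum_union hdisj).symm
    _ ≤ _ := Finset.sum_le_sum_of_subset_of_nonneg hsub
        fun e _ _ => singularSeries_nonneg _

/-! ### Sums over squarefree integers -/

/-- The sets of primes whose product is at most `z`; they stand for the squarefree integers up to
`z`. -/
def smallPrimeSets (z : ℕ) : Finset (Finset ℕ) :=
  (Nat.primesLE z).powerset.filter fun U => ∏ p ∈ U, p ≤ z

/-- The sum over the squarefree `n ≤ z` of the products of `f p` over the prime factors of `n`. -/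
noncomputable def squarefreeSum (f : ℕ → ℝ) (z : ℕ) : ℝ :=
  ∑ U ∈ smallPrimeSets z, ∏ p ∈ U, f p

theorem mem_smallPrimeSets {z : ℕ} {U : Finset ℕ} :
    U ∈ smallPrimeSets z ↔ (∀ p ∈ U, p.Prime) ∧ ∏ p ∈ U, p ≤ z := by
  rw [smallPrimeSets, Finset.mem_filter, Finset.mem_powerset]
  constructor
  · rintro ⟨h1, h2⟩
    exact ⟨fun p hp => (Nat.mem_primesLE.1 (h1 hp)).2, h2⟩
  · rintro ⟨h1, h2⟩
    refine ⟨fun p hp => Nat.mem_primesLE.2 ⟨le_trans ?_ h2, h1 p hp⟩, h2⟩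
    exact Nat.le_of_dvd (Finset.prod_pos fun q hq => (h1 q hq).pos)
      (Finset.dvd_prod_of_mem (fun q : ℕ => q) hp)

theorem subset_primesLE_of_mem_smallPrimeSets {z : ℕ} {U : Finset ℕ} (h : U ∈ smallPrimeSets z) :
    U ⊆ Nat.primesLE z :=
  Finset.mem_powerset.1 (Finset.mem_filter.1 h).1

theorem smallPrimeSets_of_subset {z : ℕ} {U V : Finset ℕ} (hU : U ∈ smallPrimeSets z)
    (h : V ⊆ U) : V ∈ smallPrimeSets z := by
  rw [mem_smallPrimeSets] at hU ⊢
  refine ⟨fun p hp => hU.1 p (h hp), le_trans ?_ hU.2⟩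
  exact Finset.prod_le_prod_of_subset_of_one_le' h fun p hp _ => (hU.1 p hp).pos

theorem prod_nonneg_of_nonneg {f : ℕ → ℝ} (hf : ∀ p, 0 ≤ f p) (U : Finset ℕ) :
    0 ≤ ∏ p ∈ U, f p := Finset.prod_nonneg fun p _ => hf p

theorem squarefreeSum_nonneg {f : ℕ → ℝ} (hf : ∀ p, 0 ≤ f p) (z : ℕ) : 0 ≤ squarefreeSum f z :=
  Finset.sum_nonneg fun U _ => prod_nonneg_of_nonneg hf U

theorem one_le_squarefreeSum {f : ℕ → ℝ} (hf : ∀ p, 0 ≤ f p) {z : ℕ} (hz : 1 ≤ z) :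
    1 ≤ squarefreeSum f z := by
  have h : ∅ ∈ smallPrimeSets z := mem_smallPrimeSets.2 ⟨by simp, by simpa using hz⟩
  have := Finset.single_le_sum (f := fun U => ∏ p ∈ U, f p)
    (fun U _ => prod_nonneg_of_nonneg hf U) h
  simpa [squarefreeSum] using this

theorem squarefreeSum_add {f g : ℕ → ℝ} (z : ℕ) : squarefreeSum (fun p => f p + g p) z =
    ∑ x ∈ (smallPrimeSets z).sigma fun U => U.powerset,
      (∏ p ∈ x.2, f p) * ∏ p ∈ x.1 \ x.2, g p := by
  rw [squarefreeSum, Finset.sum_sigma]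
  exact Finset.sum_congr rfl fun U _ => Finset.prod_add _ _ _

/-- A squarefree integer over which `f + g` is expanded is a product of a part for `f` and a part for
`g`; on the latter the condition on the size is dropped. -/
theorem squarefreeSum_add_le {f g : ℕ → ℝ} (hf : ∀ p, 0 ≤ f p) (hg : ∀ p, 0 ≤ g p) (z : ℕ) :
    squarefreeSum (fun p => f p + g p) z ≤
      squarefreeSum f z * ∏ p ∈ Nat.primesLE z, (1 + g p) := by
  rw [squarefreeSum_add, Finset.prod_one_add, squarefreeSum, Finset.sum_mul_sum,
    ← Finset.sum_product']
  set φ : (Σ _ : Finset ℕ, Finset ℕ) → Finset ℕ × Finset ℕ := fun x => (x.2, x.1 \ x.2) with hφ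
  have hinj : Set.InjOn φ ((smallPrimeSets z).sigma fun U => U.powerset) := by
    rintro ⟨U, V⟩ h ⟨U', V'⟩ h' heq
    simp only [Finset.coe_sigma, Set.mem_sigma_iff, Finset.mem_coe, Finset.mem_powerset] at h h'
    simp only [hφ, Prod.mk.injEq] at heq
    obtain ⟨rfl, h2⟩ := heq
    have : U = U' := by
      rw [← Finset.sdiff_union_of_subset h.2, h2, Finset.sdiff_union_of_subset h'.2]
    subst this
    rfl
  rw [← Finset.sum_image (f := fun y : Finset ℕ × Finset ℕ => (∏ p ∈ y.1, f p) * ∏ p ∈ y.2, g p)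
    (g := φ) hinj]
  refine Finset.sum_le_sum_of_subset_of_nonneg ?_ fun y _ _ =>
    mul_nonneg (prod_nonneg_of_nonneg hf _) (prod_nonneg_of_nonneg hg _)
  intro y hy
  obtain ⟨x, hx, rfl⟩ := Finset.mem_image.1 hy
  rw [Finset.mem_sigma, Finset.mem_powerset] at hx
  exact Finset.mem_product.2 ⟨smallPrimeSets_of_subset hx.1 hx.2,
    Finset.mem_powerset.2 (Finset.sdiff_subset.trans (subset_primesLE_of_mem_smallPrimeSets hx.1))⟩

/-- Multiplying two squarefree integers `a` and `b` and dividing by the square of their greatest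
common divisor gives a squarefree integer; so the product of the sums of `f` and `g` is at most
the sum of `f + g`, up to the contribution `∏ (1 + f p * g p)` of the common divisors. -/
theorem squarefreeSum_mul_le {f g : ℕ → ℝ} (hf : ∀ p, 0 ≤ f p) (hg : ∀ p, 0 ≤ g p) (y z : ℕ) :
    squarefreeSum f y * squarefreeSum g z ≤
      (∏ p ∈ Nat.primesLE y, (1 + f p * g p)) * squarefreeSum (fun p => f p + g p) (y * z) := by
  rw [squarefreeSum_add, Finset.prod_one_add, squarefreeSum, squarefreeSum, Finset.sum_mul_sum,
    Finset.sum_mul_sum, ← Finset.sum_product', ← Finset.sum_product']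
  set φ : Finset ℕ × Finset ℕ → Finset ℕ × (Σ _ : Finset ℕ, Finset ℕ) := fun x =>
    (x.1 ∩ x.2, ⟨(x.1 \ x.2) ∪ (x.2 \ x.1), x.1 \ x.2⟩) with hφ
  have hinj : Function.Injective φ := by
    rintro ⟨A, B⟩ ⟨A', B'⟩ h
    simp only [hφ, Prod.mk.injEq, Sigma.mk.injEq, heq_eq_eq] at h
    obtain ⟨h1, h2, h3⟩ := h
    have hA : A = A' := by
      rw [← Finset.sdiff_union_inter A B, h1, h3, Finset.sdiff_union_inter]
    have h4 : B \ A = B' \ A' := by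
      have h5 : ∀ A B : Finset ℕ, B \ A = ((A \ B) ∪ (B \ A)) \ (A \ B) := fun A B => by
        ext p; simp only [Finset.mem_sdiff, Finset.mem_union]; tauto
      rw [h5 A B, h2, h3, ← h5]
    have hB : B = B' := by
      rw [← Finset.sdiff_union_inter B A, h4, Finset.inter_comm, h1, Finset.inter_comm,
        Finset.sdiff_union_inter]
    rw [hA, hB]
  have hterm : ∀ x : Finset ℕ × Finset ℕ, (∏ p ∈ x.1, f p) * ∏ p ∈ x.2, g p =
      (fun y : Finset ℕ × (Σ _ : Finset ℕ, Finset ℕ) => (∏ p ∈ y.1, f p * g p) *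
        ((∏ p ∈ y.2.2, f p) * ∏ p ∈ y.2.1 \ y.2.2, g p)) (φ x) := by
    rintro ⟨A, B⟩
    have h5 : ((A \ B) ∪ (B \ A)) \ (A \ B) = B \ A := by
      ext p; simp only [Finset.mem_sdiff, Finset.mem_union]; tauto
    simp only [hφ, h5]
    rw [← Finset.prod_inter_mul_prod_sdiff A B f, ← Finset.prod_inter_mul_prod_sdiff B A g,
      Finset.inter_comm B A, Finset.prod_mul_distrib]
    ring
  rw [Finset.sum_congr rfl fun x _ => hterm x, ← Finset.sum_image (f := fun y :
    Finset ℕ × (Σ _ : Finset ℕ, Finset ℕ) => (∏ p ∈ y.1, f p * g p) *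
        ((∏ p ∈ y.2.2, f p) * ∏ p ∈ y.2.1 \ y.2.2, g p)) (g := φ) hinj.injOn]
  refine Finset.sum_le_sum_of_subset_of_nonneg ?_ fun y _ _ =>
    mul_nonneg (Finset.prod_nonneg fun p _ => mul_nonneg (hf p) (hg p))
      (mul_nonneg (prod_nonneg_of_nonneg hf _) (prod_nonneg_of_nonneg hg _))
  intro w hw
  obtain ⟨⟨A, B⟩, hx, rfl⟩ := Finset.mem_image.1 hw
  obtain ⟨hA, hB⟩ := Finset.mem_product.1 hx
  simp only at hA hB
  refine Finset.mem_product.2 ⟨Finset.mem_powerset.2 (Finset.inter_subset_left.trans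
    (subset_primesLE_of_mem_smallPrimeSets hA)), Finset.mem_sigma.2 ⟨?_, Finset.mem_powerset.2
    Finset.subset_union_left⟩⟩
  have hA' := mem_smallPrimeSets.1 hA
  have hB' := mem_smallPrimeSets.1 hB
  rw [mem_smallPrimeSets]
  constructor
  · intro p hp
    rcases Finset.mem_union.1 hp with h | h
    · exact hA'.1 p (Finset.mem_sdiff.1 h).1
    · exact hB'.1 p (Finset.mem_sdiff.1 h).1
  · have hd : Disjoint (A \ B) (B \ A) := by
      rw [Finset.disjoint_left]
      intro p hp hp'
      exact (Finset.mem_sdiff.1 hp').2 (Finset.mem_sdiff.1 hp).1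
    simp only [hφ]
    rw [Finset.prod_union hd]
    exact Nat.mul_le_mul ((mem_smallPrimeSets.1 (smallPrimeSets_of_subset hA
      Finset.sdiff_subset)).2) ((mem_smallPrimeSets.1 (smallPrimeSets_of_subset hB
      Finset.sdiff_subset)).2)

/-- Every integer is a square times a squarefree integer, so that the harmonic sum up to `z` is at
most `∑ 1 / b ^ 2 ≤ 2` times the sum over squarefree integers. -/
theorem log_le_two_mul_squarefreeSum (z : ℕ) :
    Real.log (z + 1) ≤ 2 * squarefreeSum (fun p => 1 / (p : ℝ)) z := by
  have h1 : Real.log (z + 1) ≤ ∑ n ∈ Finset.Icc 1 z, ((n : ℝ))⁻¹ := by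
    have := log_add_one_le_harmonic z
    rw [harmonic_eq_sum_Icc] at this
    push_cast at this
    exact this
  refine h1.trans ?_
  choose a b hab ha using Nat.sq_mul_squarefree
  set φ : ℕ → ℕ × Finset ℕ := fun n => (b n, (a n).primeFactors) with hφ
  have hn : ∀ n, (b n) ^ 2 * ∏ p ∈ (a n).primeFactors, p = n := fun n => by
    rw [Nat.prod_primeFactors_of_squarefree (ha n), hab]
  have hinj : Function.Injective φ := by
    intro m n h
    simp only [hφ, Prod.mk.injEq] at h
    rw [← hn m, ← hn n, h.1, h.2]
  have hterm : ∀ n : ℕ, ((n : ℝ))⁻¹ =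
      (fun y : ℕ × Finset ℕ => ((y.1 : ℝ) ^ 2)⁻¹ * ∏ p ∈ y.2, 1 / (p : ℝ)) (φ n) := by
    intro n
    simp only [hφ]
    conv_lhs => rw [← hn n]
    push_cast
    rw [mul_inv]
    simp
  rw [Finset.sum_congr rfl fun n _ => hterm n, ← Finset.sum_image (f := fun y : ℕ × Finset ℕ =>
    ((y.1 : ℝ) ^ 2)⁻¹ * ∏ p ∈ y.2, 1 / (p : ℝ)) (g := φ) hinj.injOn]
  calc _ ≤ ∑ y ∈ Finset.Icc 1 z ×ˢ smallPrimeSets z, ((y.1 : ℝ) ^ 2)⁻¹ * ∏ p ∈ y.2, 1 / (p : ℝ) := by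
        refine Finset.sum_le_sum_of_subset_of_nonneg ?_ fun y _ _ =>
          mul_nonneg (by positivity) (Finset.prod_nonneg fun p _ => by positivity)
        intro y hy
        obtain ⟨n, hnz, rfl⟩ := Finset.mem_image.1 hy
        rw [Finset.mem_Icc] at hnz
        have hb : b n ≠ 0 := by
          intro h
          have := hn n
          rw [h] at this
          simp at this
          omega
        have hb1 : 1 ≤ b n ^ 2 := Nat.one_le_pow _ _ (Nat.pos_of_ne_zero hb)
        have ha1 : 1 ≤ ∏ p ∈ (a n).primeFactors, p :=
          Finset.prod_pos fun p hp => (Nat.prime_of_mem_primeFactors hp).pos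
        refine Finset.mem_product.2 ⟨Finset.mem_Icc.2 ⟨Nat.pos_of_ne_zero hb, ?_⟩,
          mem_smallPrimeSets.2 ⟨fun p hp => Nat.prime_of_mem_primeFactors hp, ?_⟩⟩
        · have := hn n
          simp only [hφ]
          nlinarith
        · have := hn n
          simp only [hφ]
          nlinarith
    _ ≤ _ := by
        rw [squarefreeSum, Finset.sum_product]
        dsimp only
        rw [← Finset.sum_mul_sum]
        refine mul_le_mul_of_nonneg_right (sum_inv_sq_le_two _) ?_
        exact Finset.sum_nonneg fun U _ => Finset.prod_nonneg fun p _ => by positivity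

/-- The sum for `n / p` has the expected order of magnitude, by induction on `n`: the product of the
sums for `n / p` and `1 / p` is bounded by the sum for `(n + 1) / p`. -/
theorem exists_log_pow_le_squarefreeSum (n : ℕ) : ∃ C : ℝ, 0 < C ∧ ∀ y : ℕ, 1 ≤ y →
    Real.log (y + 1) ^ n ≤ C * squarefreeSum (fun p => (n : ℝ) / p) (y ^ n) := by
  induction n with
  | zero =>
    refine ⟨1, one_pos, fun y _ => ?_⟩
    rw [pow_zero, one_mul]
    exact one_le_squarefreeSum (fun p => by positivity) (by simp)
  | succ n ih =>
    obtain ⟨C, hC, h⟩ := ih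
    refine ⟨C * 2 * Real.exp (2 * n), by positivity, fun y hy => ?_⟩
    have hlog : 0 ≤ Real.log ((y : ℝ) + 1) := Real.log_nonneg (by linarith [y.cast_nonneg (α := ℝ)])
    have h1 := squarefreeSum_mul_le (f := fun p => (n : ℝ) / p) (g := fun p => 1 / (p : ℝ))
      (fun p => by positivity) (fun p => by positivity) (y ^ n) y
    have h2 : ∏ p ∈ Nat.primesLE (y ^ n), (1 + (n : ℝ) / p * (1 / p)) ≤ Real.exp (2 * n) := by
      refine le_trans (le_of_eq ?_) (prod_nat_one_add_div_sq_le (Nat.primesLE (y ^ n))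
        (C := n) (by positivity))
      refine Finset.prod_congr rfl fun p _ => ?_
      rw [div_mul_div_comm, mul_one, sq]
    have h3 : (fun p : ℕ => (n : ℝ) / p + 1 / p) = fun p : ℕ => ((n + 1 : ℕ) : ℝ) / p := by
      funext p
      push_cast
      ring
    rw [h3] at h1
    have h0 := squarefreeSum_nonneg (f := fun p => ((n + 1 : ℕ) : ℝ) / p)
      (fun p => by positivity) (y ^ n * y)
    calc Real.log (y + 1) ^ (n + 1) = Real.log (y + 1) ^ n * Real.log (y + 1) := pow_succ _ _
      _ ≤ (C * squarefreeSum (fun p => (n : ℝ) / p) (y ^ n)) *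
          (2 * squarefreeSum (fun p => 1 / (p : ℝ)) y) :=
          mul_le_mul (h y hy) (log_le_two_mul_squarefreeSum y) hlog
            (mul_nonneg hC.le (squarefreeSum_nonneg (fun p => by positivity) _))
      _ = C * 2 * (squarefreeSum (fun p => (n : ℝ) / p) (y ^ n) *
          squarefreeSum (fun p => 1 / (p : ℝ)) y) := by ring
      _ ≤ C * 2 * (Real.exp (2 * n) *
          squarefreeSum (fun p => ((n + 1 : ℕ) : ℝ) / p) (y ^ n * y)) := by
          refine mul_le_mul_of_nonneg_left (h1.trans ?_) (by positivity)
          exact mul_le_mul_of_nonneg_right h2 h0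
      _ = _ := by rw [pow_succ]; ring

/-- The denominator of the upper bound sieve for `D`, bounded below in terms of `𝔖(D)`. -/
theorem exists_log_pow_le_squarefreeSum_residueCount (n : ℕ) : ∃ C : ℝ, 0 < C ∧
    ∀ (D : Finset ℤ) (y : ℕ), D.card = n → singularSeries D ≠ 0 → 1 ≤ y →
      Real.log (y + 1) ^ n ≤ C * singularSeries D *
        squarefreeSum (fun p => (residueCount D p : ℝ) / p) (y ^ n) := by
  obtain ⟨C, hC, h⟩ := exists_log_pow_le_squarefreeSum n
  refine ⟨C * Real.exp (2 * ((n : ℝ) + 1) ^ 4), by positivity, ?_⟩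
  intro D y hcard hS hy
  have hle : ∀ p, (residueCount D p : ℝ) ≤ n := fun p => by
    rw [← hcard]; exact_mod_cast residueCount_le_card D p
  have hnn : ∀ p : ℕ, 0 ≤ ((n : ℝ) - residueCount D p) / p := fun p =>
    div_nonneg (by linarith [hle p]) (by positivity)
  have h1 := squarefreeSum_add_le (f := fun p => (residueCount D p : ℝ) / p)
    (g := fun p => ((n : ℝ) - residueCount D p) / p) (fun p => by positivity) hnn (y ^ n)
  have h2 : (fun p : ℕ => (residueCount D p : ℝ) / p + ((n : ℝ) - residueCount D p) / p) =
      fun p : ℕ => (n : ℝ) / p := by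
    funext p
    ring
  rw [h2] at h1
  have h3 : ∏ p ∈ Nat.primesLE (y ^ n), (1 + ((n : ℝ) - residueCount D p) / p) ≤
      Real.exp (2 * ((n : ℝ) + 1) ^ 4) * singularSeries D := by
    have h4 := prod_le_mul_singularSeries (singularSeries_ne_zero_iff.1 hS) (primesUpTo (y ^ n))
    rw [hcard] at h4
    refine le_trans (le_of_eq ?_) h4
    refine Finset.prod_bij (fun p hp => (⟨p, (Nat.mem_primesLE.1 hp).2⟩ : Nat.Primes)) ?_ ?_ ?_ ?_
    · intro p hp
      exact mem_primesUpTo.2 (Nat.mem_primesLE.1 hp).1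
    · intro p _ q _ hpq
      exact congrArg Subtype.val hpq
    · intro p hp
      exact ⟨p, Nat.mem_primesLE.2 ⟨mem_primesUpTo.1 hp, p.2⟩, rfl⟩
    · intro p _
      rfl
  have h0 := squarefreeSum_nonneg (f := fun p => (residueCount D p : ℝ) / p)
    (fun p => by positivity) (y ^ n)
  calc Real.log (y + 1) ^ n ≤ C * squarefreeSum (fun p => (n : ℝ) / p) (y ^ n) := h y hy
    _ ≤ C * (squarefreeSum (fun p => (residueCount D p : ℝ) / p) (y ^ n) *
        (Real.exp (2 * ((n : ℝ) + 1) ^ 4) * singularSeries D)) := by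
        refine mul_le_mul_of_nonneg_left (h1.trans ?_) hC.le
        exact mul_le_mul_of_nonneg_left h3 h0
    _ = _ := by ring

/-! ### Counting roots of a product of linear forms -/

/-- The Chinese remainder theorem, for counting residues. -/
theorem card_filter_range_mul {a b : ℕ} (hab : a.Coprime b) (ha : 0 < a) (hb : 0 < b)
    {P Q : ℕ → Prop} [DecidablePred P] [DecidablePred Q] (hP : ∀ n, P (n % a) ↔ P n)
    (hQ : ∀ n, Q (n % b) ↔ Q n) :
    ((Finset.range (a * b)).filter fun n => P n ∧ Q n).card =
      ((Finset.range a).filter P).card * ((Finset.range b).filter Q).card := by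
  rw [← Finset.card_product]
  refine Finset.card_bij (fun n _ => (n % a, n % b)) ?_ ?_ ?_
  · intro n hn
    simp only [Finset.mem_filter, Finset.mem_product, Finset.mem_range] at hn ⊢
    exact ⟨⟨Nat.mod_lt _ ha, (hP n).2 hn.2.1⟩, Nat.mod_lt _ hb, (hQ n).2 hn.2.2⟩
  · intro m hm n hn h
    simp only [Finset.mem_filter, Finset.mem_range, Prod.mk.injEq] at hm hn h
    have : m ≡ n [MOD a * b] := (Nat.modEq_and_modEq_iff_modEq_mul hab).1 ⟨h.1, h.2⟩
    exact Nat.ModEq.eq_of_lt_of_lt this hm.1 hn.1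
  · rintro ⟨r, s⟩ hrs
    simp only [Finset.mem_filter, Finset.mem_product, Finset.mem_range] at hrs
    obtain ⟨m, hm1, hm2⟩ := Nat.chineseRemainder hab r s
    have h1 : m % (a * b) % a = r := by
      rw [Nat.mod_mul_right_mod]
      exact Eq.trans hm1 (Nat.mod_eq_of_lt hrs.1.1)
    have h2 : m % (a * b) % b = s := by
      rw [Nat.mod_mul_left_mod]
      exact Eq.trans hm2 (Nat.mod_eq_of_lt hrs.2.1)
    refine ⟨m % (a * b), ?_, by rw [h1, h2]⟩
    simp only [Finset.mem_filter, Finset.mem_range]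
    refine ⟨Nat.mod_lt _ (Nat.mul_pos ha hb), ?_, ?_⟩
    · rw [← hP, h1]; exact hrs.1.2
    · rw [← hQ, h2]; exact hrs.2.2

/-- A property which is periodic modulo `d`, and holds for `c` residues, holds for
`N * c / d + O(d)` of the integers below `N`. -/
theorem abs_count_sub_le {d : ℕ} (hd : 0 < d) {P : ℕ → Prop} [DecidablePred P]
    (hP : ∀ n, P (n % d) ↔ P n) (N : ℕ) :
    |(((Finset.range N).filter P).card : ℝ) -
      (((Finset.range d).filter P).card : ℝ) / d * N| ≤ d := by
  simp only [← Nat.count_eq_card_filter_range]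
  set c := Nat.count P d with hc
  have hcd : c ≤ d := by
    rw [hc, Nat.count_eq_card_filter_range]
    exact (Finset.card_filter_le _ _).trans (by simp)
  have hper : ∀ q r : ℕ, r ≤ d → Nat.count P (d * q + r) = q * c + Nat.count P r := by
    intro q
    induction q with
    | zero => intro r _; simp
    | succ q ih =>
      intro r _
      have h1 : d * (q + 1) + r = (d * q + d) + r := by ring
      rw [h1, Nat.count_add, ih d le_rfl]
      have h2 : (fun k => P (d * q + d + k)) = P := by
        funext k
        have : d * q + d + k = k + d * (q + 1) := by ring
        rw [this, ← hP, Nat.add_mul_mod_self_left, hP]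
      simp only [h2]
      ring
  have hN := hper (N / d) (N % d) (Nat.mod_lt _ hd).le
  rw [Nat.div_add_mod] at hN
  rw [hN]
  have hr : Nat.count P (N % d) ≤ d := by
    rw [Nat.count_eq_card_filter_range]
    refine (Finset.card_filter_le _ _).trans ?_
    rw [Finset.card_range]
    exact (Nat.mod_lt _ hd).le
  have hd' : (0 : ℝ) < d := by exact_mod_cast hd
  have hNr : (N : ℝ) = d * (N / d : ℕ) + (N % d : ℕ) := by
    exact_mod_cast (Nat.div_add_mod N d).symm
  have hmod : ((N % d : ℕ) : ℝ) ≤ d := by exact_mod_cast (Nat.mod_lt N hd).le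
  have hcd' : (c : ℝ) / d ≤ 1 := by
    rw [div_le_one hd']; exact_mod_cast hcd
  have hcd0 : (0 : ℝ) ≤ (c : ℝ) / d := by positivity
  have hr' : (Nat.count P (N % d) : ℝ) ≤ d := by exact_mod_cast hr
  have e : ((N / d * c + Nat.count P (N % d) : ℕ) : ℝ) - (c : ℝ) / d * N =
      Nat.count P (N % d) - (c : ℝ) / d * (N % d : ℕ) := by
    rw [hNr]
    push_cast
    field_simp
    ring
  rw [e, abs_le]
  have h1 : (c : ℝ) / d * (N % d : ℕ) ≤ 1 * d := by gcongr
  have h2 : 0 ≤ (c : ℝ) / d * (N % d : ℕ) := by positivity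
  have h3 : (0 : ℝ) ≤ Nat.count P (N % d) := by positivity
  constructor <;> linarith

/-- The product of the integers `m + h` for `h ∈ D`. -/
def shiftProd (D : Finset ℤ) (m : ℕ) : ℤ := ∏ h ∈ D, ((m : ℤ) + h)

theorem dvd_shiftProd_mod (D : Finset ℤ) (d n : ℕ) :
    (d : ℤ) ∣ shiftProd D (n % d) ↔ (d : ℤ) ∣ shiftProd D n := by
  have h : shiftProd D (n % d) ≡ shiftProd D n [ZMOD (d : ℤ)] := by
    refine Int.ModEq.prod fun h _ => Int.ModEq.add_right _ ?_
    push_cast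
    exact Int.mod_modEq _ _
  rw [← Int.modEq_zero_iff_dvd, ← Int.modEq_zero_iff_dvd]
  exact ⟨fun h' => h.symm.trans h', fun h' => h.trans h'⟩

/-- The product of the `m + h` vanishes modulo `p` exactly for `m` in one of the classes of `-h`. -/
theorem card_filter_dvd_shiftProd_prime (D : Finset ℤ) {p : ℕ} (hp : p.Prime) :
    ((Finset.range p).filter fun n => (p : ℤ) ∣ shiftProd D n).card = residueCount D p := by
  have hp0 : (0 : ℤ) < p := by exact_mod_cast hp.pos
  refine Finset.card_bij (fun n _ => (-(n : ℤ)) % p) ?_ ?_ ?_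
  · intro n hn
    rw [Finset.mem_filter] at hn
    obtain ⟨h, hh, hdvd⟩ :=
      ((Nat.prime_iff_prime_int.1 hp).dvd_finsetProd_iff _).1 hn.2
    refine Finset.mem_image.2 ⟨h, hh, ?_⟩
    refine Int.ModEq.symm (Int.modEq_iff_dvd.2 ?_)
    rwa [sub_neg_eq_add, add_comm]
  · intro m hm n hn h
    rw [Finset.mem_filter, Finset.mem_range] at hm hn
    have h1 : (m : ℤ) ≡ n [ZMOD p] := by
      have := Int.ModEq.neg h
      simpa using this
    exact Nat.ModEq.eq_of_lt_of_lt ((Int.natCast_modEq_iff).1 h1) hm.1 hn.1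
  · intro r hr
    obtain ⟨h, hh, rfl⟩ := Finset.mem_image.1 hr
    have h0 := Int.emod_nonneg (-h) hp0.ne'
    have h1 := Int.emod_lt_of_pos (-h) hp0
    have hcast : (((-h) % p).toNat : ℤ) = (-h) % p := Int.toNat_of_nonneg h0
    refine ⟨((-h) % p).toNat, ?_, ?_⟩
    · rw [Finset.mem_filter, Finset.mem_range]
      refine ⟨by omega, ?_⟩
      refine dvd_trans ?_ (Finset.dvd_prod_of_mem _ hh)
      rw [hcast]
      have h3 : (-h) % p + h = (-h) % p - (-h) := by ring
      rw [h3]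
      exact (Int.mod_modEq (-h) p).symm.dvd
    · rw [hcast]
      have h2 : -((-h) % p) ≡ -(-h) [ZMOD p] := (Int.mod_modEq (-h) p).neg
      rw [neg_neg] at h2
      exact h2

theorem card_filter_dvd_shiftProd (D : Finset ℤ) {U : Finset ℕ} (hU : ∀ p ∈ U, p.Prime) :
    ((Finset.range (∏ p ∈ U, p)).filter fun n => ((∏ p ∈ U, p : ℕ) : ℤ) ∣ shiftProd D n).card =
      ∏ p ∈ U, residueCount D p := by
  induction U using Finset.induction_on with
  | empty => simp
  | insert q U hq ih =>
    have hU' : ∀ p ∈ U, p.Prime := fun p hp => hU p (Finset.mem_insert_of_mem hp)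
    have hqp : q.Prime := hU q (Finset.mem_insert_self _ _)
    have hco : q.Coprime (∏ p ∈ U, p) := by
      refine Nat.Coprime.prod_right fun p hp => (Nat.coprime_primes hqp (hU' p hp)).2 ?_
      rintro rfl
      exact hq hp
    have hpos : 0 < ∏ p ∈ U, p := Finset.prod_pos fun p hp => (hU' p hp).pos
    rw [Finset.prod_insert hq, Finset.prod_insert hq, ← ih hU',
      ← card_filter_dvd_shiftProd_prime D hqp,
      ← card_filter_range_mul hco hqp.pos hpos (dvd_shiftProd_mod D q) (dvd_shiftProd_mod D _)]
    congr 1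
    refine Finset.filter_congr fun n _ => ?_
    push_cast
    have hco' : IsCoprime (q : ℤ) ((∏ p ∈ U, p : ℕ) : ℤ) := Nat.isCoprime_iff_coprime.2 hco
    push_cast at hco'
    exact ⟨fun h => ⟨dvd_of_mul_right_dvd h, dvd_of_mul_left_dvd h⟩,
      fun h => hco'.mul_dvd h.1 h.2⟩

/-! ### The Selberg sieve -/

open scoped ArithmeticFunction.Moebius

/-- Möbius inversion over the interval between `l` and `m` in the lattice of divisors. -/
theorem sum_divisors_between_moebius {P l m : ℕ} (hP : Squarefree P) (hl : l ∣ P) (hm : m ∣ P) :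
    ∑ d ∈ P.divisors, (if l ∣ d then (if d ∣ m then (μ d : ℝ) else 0) else 0) =
      if l = m then (μ l : ℝ) else 0 := by
  have hP0 : P ≠ 0 := hP.ne_zero
  have hm0 : m ≠ 0 := ne_zero_of_dvd_ne_zero hP0 hm
  have hl0 : l ≠ 0 := ne_zero_of_dvd_ne_zero hP0 hl
  by_cases hlm : l ∣ m
  · obtain ⟨e, rfl⟩ := hlm
    have he0 : e ≠ 0 := right_ne_zero_of_mul hm0
    have hsq : Squarefree (l * e) := hP.squarefree_of_dvd hm
    have hco : l.Coprime e := Nat.coprime_of_squarefree_mul hsq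
    have h1 : ∑ d ∈ P.divisors, (if l ∣ d then (if d ∣ l * e then (μ d : ℝ) else 0) else 0) =
        ∑ f ∈ e.divisors, (μ (l * f) : ℝ) := by
      simp_rw [← ite_and]
      rw [← Finset.sum_filter]
      symm
      refine Finset.sum_bij (fun f _ => l * f) ?_ ?_ ?_ ?_
      · intro f hf
        rw [Nat.mem_divisors] at hf
        rw [Finset.mem_filter, Nat.mem_divisors]
        have : l * f ∣ l * e := mul_dvd_mul_left l hf.1
        exact ⟨⟨this.trans hm, hP0⟩, dvd_mul_right _ _, this⟩
      · intro a _ b _ hab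
        exact Nat.eq_of_mul_eq_mul_left (Nat.pos_of_ne_zero hl0) hab
      · intro d hd
        rw [Finset.mem_filter] at hd
        obtain ⟨⟨f, rfl⟩, h2⟩ := hd.2
        exact ⟨f, Nat.mem_divisors.2
          ⟨Nat.dvd_of_mul_dvd_mul_left (Nat.pos_of_ne_zero hl0) h2, he0⟩, rfl⟩
      · intro f _
        rfl
    rw [h1]
    have h2 : ∀ f ∈ e.divisors, (μ (l * f) : ℝ) = μ l * μ f := by
      intro f hf
      have : l.Coprime f := hco.coprime_dvd_right (Nat.dvd_of_mem_divisors hf)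
      rw [ArithmeticFunction.isMultiplicative_moebius.map_mul_of_coprime this]
      push_cast
      ring
    rw [Finset.sum_congr rfl h2, ← Finset.mul_sum]
    have h3 : (∑ f ∈ e.divisors, (μ f : ℝ)) = if e = 1 then 1 else 0 := by
      have h4 : ∑ f ∈ e.divisors, μ f = if e = 1 then 1 else 0 := by
        rw [← ArithmeticFunction.coe_mul_zeta_apply, ArithmeticFunction.moebius_mul_coe_zeta,
          ArithmeticFunction.one_apply]
      exact_mod_cast h4
    rw [h3]
    by_cases he : e = 1
    · simp [he]
    · have : l ≠ l * e := by
        intro h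
        exact he (Nat.eq_of_mul_eq_mul_left (Nat.pos_of_ne_zero hl0) (by rw [← h, mul_one]))
      rw [if_neg he, if_neg this, mul_zero]
  · have : l ≠ m := fun h => hlm (h ▸ dvd_rfl)
    rw [if_neg this]
    refine Finset.sum_eq_zero fun d _ => ?_
    split_ifs with h1 h2
    · exact absurd (h1.trans h2) hlm
    · rfl
    · rfl

/-- The sum of the Selberg terms up to the level `z`. -/
noncomputable def selbergSum (s : BoundingSieve) (z : ℕ) : ℝ :=
  ∑ l ∈ s.prodPrimes.divisors, if l ≤ z then s.selbergTerms l else 0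

/-- The weights that minimize the quadratic form of the Selberg sieve of level `z`. -/
noncomputable def selbergWeight (s : BoundingSieve) (z d : ℕ) : ℝ :=
  if d ∣ s.prodPrimes then
    μ d * (s.nu d)⁻¹ * ((∑ m ∈ s.prodPrimes.divisors,
      if d ∣ m then (if m ≤ z then s.selbergTerms m else 0) else 0) / selbergSum s z)
  else 0

section Selberg

variable {s : BoundingSieve} {z : ℕ}

theorem ite_selbergTerms_nonneg {l : ℕ} (hl : l ∈ s.prodPrimes.divisors) :
    0 ≤ if l ≤ z then s.selbergTerms l else 0 := by
  split_ifs
  · exact (BoundingSieve.selbergTerms_pos (Nat.dvd_of_mem_divisors hl)).le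
  · exact le_rfl

theorem selbergSum_pos (hz : 1 ≤ z) : 0 < selbergSum s z := by
  have h1 : (1 : ℕ) ∈ s.prodPrimes.divisors := Nat.one_mem_divisors.2 s.prodPrimes_ne_zero
  have h2 := Finset.single_le_sum (f := fun l => if l ≤ z then s.selbergTerms l else 0)
    (fun l hl => ite_selbergTerms_nonneg hl) h1
  simp only [hz, if_true] at h2
  exact lt_of_lt_of_le (BoundingSieve.selbergTerms_pos (one_dvd _)) h2

theorem selbergWeight_one (hz : 1 ≤ z) : selbergWeight s z 1 = 1 := by
  have h := (selbergSum_pos (s := s) hz).ne'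
  have h1 : s.nu 1 = 1 := s.nu_mult.map_one
  rw [selbergWeight, if_pos (one_dvd _), h1]
  simp only [one_dvd, if_true]
  rw [← selbergSum, div_self h]
  simp

theorem selbergWeight_eq_zero {d : ℕ} (hd : z < d) : selbergWeight s z d = 0 := by
  unfold selbergWeight
  split_ifs with h
  · rw [Finset.sum_eq_zero, zero_div, mul_zero]
    intro m hm
    split_ifs with h1 h2
    · have := Nat.le_of_dvd (Nat.pos_of_mem_divisors hm) h1
      omega
    · rfl
    · rfl
  · rfl

/-- The sum in the numerator of the weight is part of the one in the denominator, so that only `1 / ν(d)`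
remains, which is at most `d`. -/
theorem abs_selbergWeight_le (hz : 1 ≤ z)
    (hnu : ∀ d, d ∣ s.prodPrimes → 1 ≤ (d : ℝ) * s.nu d) (d : ℕ) :
    |selbergWeight s z d| ≤ d := by
  have hG := selbergSum_pos (s := s) hz
  unfold selbergWeight
  split_ifs with h
  · have hν := BoundingSieve.nu_pos_of_dvd_prodPrimes h
    set A := ∑ m ∈ s.prodPrimes.divisors,
      if d ∣ m then (if m ≤ z then s.selbergTerms m else 0) else 0 with hA
    have hA0 : 0 ≤ A := Finset.sum_nonneg fun m hm => by
      by_cases hdm : d ∣ m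
      · rw [if_pos hdm]; exact ite_selbergTerms_nonneg hm
      · rw [if_neg hdm]
    have hAG : A ≤ selbergSum s z := Finset.sum_le_sum fun m hm => by
      by_cases hdm : d ∣ m
      · rw [if_pos hdm]
      · rw [if_neg hdm]; exact ite_selbergTerms_nonneg hm
    have h1 : |(μ d : ℝ)| ≤ 1 := by
      exact_mod_cast ArithmeticFunction.abs_moebius_le_one
    have h2 : (s.nu d)⁻¹ ≤ d := by
      rw [inv_le_iff_one_le_mul₀ hν]
      exact hnu d h
    have h3 : A / selbergSum s z ≤ 1 := (div_le_one hG).2 hAG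
    rw [abs_mul, abs_mul, abs_of_nonneg (inv_nonneg.2 hν.le),
      abs_of_nonneg (div_nonneg hA0 hG.le)]
    calc _ ≤ 1 * (d : ℝ) * 1 := by gcongr
      _ = d := by ring
  · simp

/-- The linear forms that diagonalize the quadratic form of the sieve, at the optimal weights. -/
theorem sum_nu_mul_selbergWeight {l : ℕ} (hl : l ∣ s.prodPrimes) :
    ∑ d ∈ s.prodPrimes.divisors, (if l ∣ d then s.nu d * selbergWeight s z d else 0) =
      μ l * ((if l ≤ z then s.selbergTerms l else 0) / selbergSum s z) := by
  have h1 : ∀ d ∈ s.prodPrimes.divisors,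
      (if l ∣ d then s.nu d * selbergWeight s z d else 0) =
      ∑ m ∈ s.prodPrimes.divisors, ((if m ≤ z then s.selbergTerms m else 0) / selbergSum s z) *
        (if l ∣ d then (if d ∣ m then (μ d : ℝ) else 0) else 0) := by
    intro d hd
    have hdP := Nat.dvd_of_mem_divisors hd
    have hν := (BoundingSieve.nu_pos_of_dvd_prodPrimes hdP).ne'
    by_cases hld : l ∣ d
    · simp only [if_pos hld]
      rw [selbergWeight, if_pos hdP, Finset.sum_div, Finset.mul_sum, Finset.mul_sum]
      refine Finset.sum_congr rfl fun m _ => ?_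
      split_ifs
      · field_simp
      · simp
      · simp
      · simp
    · simp [hld]
  rw [Finset.sum_congr rfl h1, Finset.sum_comm]
  have h2 : ∀ m ∈ s.prodPrimes.divisors, ∑ d ∈ s.prodPrimes.divisors,
      ((if m ≤ z then s.selbergTerms m else 0) / selbergSum s z) *
        (if l ∣ d then (if d ∣ m then (μ d : ℝ) else 0) else 0) =
      if l = m then ((if m ≤ z then s.selbergTerms m else 0) / selbergSum s z) * μ l else 0 := by
    intro m hm
    rw [← Finset.mul_sum, sum_divisors_between_moebius s.prodPrimes_squarefree hl
      (Nat.dvd_of_mem_divisors hm)]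
    split_ifs <;> simp
  rw [Finset.sum_congr rfl h2, Finset.sum_ite_eq,
    if_pos (Nat.mem_divisors.2 ⟨hl, s.prodPrimes_ne_zero⟩)]
  ring

/-- The minimum of the quadratic form. -/
theorem mainSum_selbergWeight (hz : 1 ≤ z) :
    s.mainSum (BoundingSieve.lambdaSquared (selbergWeight s z)) = (selbergSum s z)⁻¹ := by
  have hG := (selbergSum_pos (s := s) hz).ne'
  rw [BoundingSieve.mainSum_lambdaSquared_eq_sum_mul_sum_sq]
  have h : ∀ l ∈ s.prodPrimes.divisors, (s.selbergTerms l)⁻¹ *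
      (∑ d ∈ s.prodPrimes.divisors, if l ∣ d then s.nu d * selbergWeight s z d else 0) ^ 2 =
      (if l ≤ z then s.selbergTerms l else 0) / selbergSum s z ^ 2 := by
    intro l hl
    have hlP := Nat.dvd_of_mem_divisors hl
    have hh := (BoundingSieve.selbergTerms_pos hlP).ne'
    have hμ : (μ l : ℝ) ^ 2 = 1 := by
      have := ArithmeticFunction.moebius_sq_eq_one_of_squarefree
        (s.prodPrimes_squarefree.squarefree_of_dvd hlP)
      exact_mod_cast this
    rw [sum_nu_mul_selbergWeight hlP, mul_pow, hμ]
    split_ifs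
    · field_simp
    · simp
  rw [Finset.sum_congr rfl h, ← Finset.sum_div, ← selbergSum]
  field_simp

/-- The weights are bounded by `d` and vanish beyond `z`, and the remainders are bounded by
`[d₁, d₂] ≤ d₁ d₂`; hence the error is at most `(∑ d ^ 2) ^ 2`, summed over `d ≤ z`. -/
theorem errSum_selbergWeight_le (hz : 1 ≤ z)
    (hnu : ∀ d, d ∣ s.prodPrimes → 1 ≤ (d : ℝ) * s.nu d)
    (hrem : ∀ d, d ∣ s.prodPrimes → |s.rem d| ≤ d) :
    s.errSum (BoundingSieve.lambdaSquared (selbergWeight s z)) ≤ (z : ℝ) ^ 6 := by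
  set u : ℕ → ℝ := fun d => if d ≤ z then (d : ℝ) else 0 with hu
  have hu0 : ∀ d, 0 ≤ u d := fun d => by
    simp only [hu]; split_ifs <;> positivity
  have hw : ∀ d, |selbergWeight s z d| ≤ u d := by
    intro d
    simp only [hu]
    split_ifs with h
    · exact abs_selbergWeight_le hz hnu d
    · rw [selbergWeight_eq_zero (not_le.1 h), abs_zero]
  have h1 : ∀ d ∈ s.prodPrimes.divisors,
      |BoundingSieve.lambdaSquared (selbergWeight s z) d| * |s.rem d| ≤
      ∑ d1 ∈ s.prodPrimes.divisors, ∑ d2 ∈ s.prodPrimes.divisors,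
        if d = d1.lcm d2 then u d1 * u d2 * (d1 * d2) else 0 := by
    intro d hd
    have hdP := Nat.dvd_of_mem_divisors hd
    have hsub := Nat.divisors_subset_of_dvd s.prodPrimes_ne_zero hdP
    have hnn : ∀ d1 d2 : ℕ, 0 ≤ if d = d1.lcm d2 then u d1 * u d2 * ((d1 : ℝ) * d2) else 0 := by
      intro d1 d2
      have := mul_nonneg (hu0 d1) (hu0 d2)
      split_ifs <;> positivity
    calc |BoundingSieve.lambdaSquared (selbergWeight s z) d| * |s.rem d|
        ≤ (∑ d1 ∈ d.divisors, ∑ d2 ∈ d.divisors, if d = d1.lcm d2 then u d1 * u d2 else 0) * d := by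
          refine mul_le_mul ?_ (hrem d hdP) (abs_nonneg _) ?_
          · refine (Finset.abs_sum_le_sum_abs _ _).trans (Finset.sum_le_sum fun d1 _ => ?_)
            refine (Finset.abs_sum_le_sum_abs _ _).trans (Finset.sum_le_sum fun d2 _ => ?_)
            split_ifs
            · rw [abs_mul]
              exact mul_le_mul (hw d1) (hw d2) (abs_nonneg _) (hu0 d1)
            · simp
          · refine Finset.sum_nonneg fun d1 _ => Finset.sum_nonneg fun d2 _ => ?_
            have := mul_nonneg (hu0 d1) (hu0 d2)
            split_ifs <;> positivity
      _ ≤ ∑ d1 ∈ d.divisors, ∑ d2 ∈ d.divisors,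
            if d = d1.lcm d2 then u d1 * u d2 * ((d1 : ℝ) * d2) else 0 := by
          rw [Finset.sum_mul]
          refine Finset.sum_le_sum fun d1 hd1 => ?_
          rw [Finset.sum_mul]
          refine Finset.sum_le_sum fun d2 hd2 => ?_
          split_ifs with h
          · refine mul_le_mul_of_nonneg_left ?_ (mul_nonneg (hu0 d1) (hu0 d2))
            have h3 : d ≤ d1 * d2 := by
              rw [h]
              exact Nat.le_of_dvd (Nat.mul_pos (Nat.pos_of_mem_divisors hd1)
                (Nat.pos_of_mem_divisors hd2)) (Nat.lcm_dvd_mul d1 d2)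
            exact_mod_cast h3
          · simp
      _ ≤ _ := by
          refine (Finset.sum_le_sum fun d1 _ => Finset.sum_le_sum_of_subset_of_nonneg hsub
            fun d2 _ _ => hnn d1 d2).trans ?_
          exact Finset.sum_le_sum_of_subset_of_nonneg hsub
            fun d1 _ _ => Finset.sum_nonneg fun d2 _ => hnn d1 d2
  have h2 : ∑ d ∈ s.prodPrimes.divisors, u d * d ≤ (z : ℝ) ^ 3 := by
    have h3 : ∀ d : ℕ, u d * d = if d ≤ z then (d : ℝ) * d else 0 := by
      intro d; simp only [hu]; split_ifs <;> simp
    rw [Finset.sum_congr rfl fun d _ => h3 d, ← Finset.sum_filter]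
    have h4 : s.prodPrimes.divisors.filter (fun d => d ≤ z) ⊆ Finset.Icc 1 z := by
      intro d hd
      rw [Finset.mem_filter] at hd
      exact Finset.mem_Icc.2 ⟨Nat.pos_of_mem_divisors hd.1, hd.2⟩
    calc _ ≤ ∑ d ∈ Finset.Icc 1 z, (d : ℝ) * d :=
          Finset.sum_le_sum_of_subset_of_nonneg h4 fun _ _ _ => by positivity
      _ ≤ ∑ _d ∈ Finset.Icc 1 z, (z : ℝ) * z := Finset.sum_le_sum fun d hd => by
          have : (d : ℝ) ≤ z := by exact_mod_cast (Finset.mem_Icc.1 hd).2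
          gcongr
      _ = (z : ℝ) ^ 3 := by
          rw [Finset.sum_const, Nat.card_Icc, nsmul_eq_mul]
          push_cast [Nat.add_sub_cancel]
          ring
  have h2' : 0 ≤ ∑ d ∈ s.prodPrimes.divisors, u d * d :=
    Finset.sum_nonneg fun d _ => mul_nonneg (hu0 d) (by positivity)
  calc s.errSum (BoundingSieve.lambdaSquared (selbergWeight s z))
      ≤ ∑ d ∈ s.prodPrimes.divisors, ∑ d1 ∈ s.prodPrimes.divisors,
        ∑ d2 ∈ s.prodPrimes.divisors, if d = d1.lcm d2 then u d1 * u d2 * (d1 * d2) else 0 :=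
        Finset.sum_le_sum h1
    _ = ∑ d1 ∈ s.prodPrimes.divisors, ∑ d2 ∈ s.prodPrimes.divisors,
        ∑ d ∈ s.prodPrimes.divisors, if d = d1.lcm d2 then u d1 * u d2 * (d1 * d2) else 0 := by
        rw [Finset.sum_comm]
        exact Finset.sum_congr rfl fun d1 _ => Finset.sum_comm
    _ ≤ ∑ d1 ∈ s.prodPrimes.divisors, ∑ d2 ∈ s.prodPrimes.divisors, (u d1 * d1) * (u d2 * d2) := by
        refine Finset.sum_le_sum fun d1 _ => Finset.sum_le_sum fun d2 _ => ?_
        rw [Finset.sum_ite_eq']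
        have := mul_nonneg (hu0 d1) (hu0 d2)
        split_ifs
        · exact le_of_eq (by ring)
        · have := hu0 d1
          have := hu0 d2
          positivity
    _ = (∑ d ∈ s.prodPrimes.divisors, u d * d) ^ 2 := by rw [sq, Finset.sum_mul_sum]
    _ ≤ ((z : ℝ) ^ 3) ^ 2 := by gcongr
    _ = _ := by ring

/-- The Selberg sieve, with a crude remainder term. -/
theorem siftedSum_le_div_selbergSum_add (hz : 1 ≤ z)
    (hnu : ∀ d, d ∣ s.prodPrimes → 1 ≤ (d : ℝ) * s.nu d)
    (hrem : ∀ d, d ∣ s.prodPrimes → |s.rem d| ≤ d) :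
    s.siftedSum ≤ s.totalMass / selbergSum s z + (z : ℝ) ^ 6 := by
  have h := BoundingSieve.siftedSum_le_mainSum_errSum_of_upperMoebius (s := s) _
    (BoundingSieve.upperMoebius_lambdaSquared (selbergWeight s z) (selbergWeight_one hz))
  rw [mainSum_selbergWeight hz, ← div_eq_mul_inv] at h
  linarith [errSum_selbergWeight_le hz hnu hrem]

end Selberg

/-! ### An upper bound for the number of prime tuples -/

/-- The sieve of the values `∏ (m + h)`, for `m < N`, by the primes up to `z`. -/
noncomputable def tupleSieve (D : Finset ℤ) (hD : D.Nonempty)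
    (hadm : ∀ p : ℕ, p.Prime → residueCount D p < p) (z N : ℕ) : BoundingSieve where
  support := (Finset.range N).image fun m => (shiftProd D m).natAbs
  prodPrimes := primorial z
  prodPrimes_squarefree := squarefree_primorial z
  weights n := ((Finset.range N).filter fun m => (shiftProd D m).natAbs = n).card
  weights_nonneg n := by positivity
  totalMass := N
  nu := ArithmeticFunction.prodPrimeFactors fun p => (residueCount D p : ℝ) / p
  nu_mult := ArithmeticFunction.IsMultiplicative.prodPrimeFactors _
  nu_pos_of_prime p hp _ := by
    rw [ArithmeticFunction.prodPrimeFactors_apply hp.ne_zero, hp.primeFactors,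
      Finset.prod_singleton]
    have h1 : (0 : ℝ) < p := by exact_mod_cast hp.pos
    have h2 : (0 : ℝ) < residueCount D p := by exact_mod_cast residueCount_pos hD p
    positivity
  nu_lt_one_of_prime p hp _ := by
    rw [ArithmeticFunction.prodPrimeFactors_apply hp.ne_zero, hp.primeFactors,
      Finset.prod_singleton]
    have h1 : (0 : ℝ) < p := by exact_mod_cast hp.pos
    rw [div_lt_one h1]
    exact_mod_cast hadm p hp

section TupleSieve

variable {D : Finset ℤ} {hD : D.Nonempty} {hadm : ∀ p : ℕ, p.Prime → residueCount D p < p}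
  {z N : ℕ}

theorem tupleSieve_nu {d : ℕ} (hd : d ≠ 0) : (tupleSieve D hD hadm z N).nu d =
    ∏ p ∈ d.primeFactors, (residueCount D p : ℝ) / p :=
  ArithmeticFunction.prodPrimeFactors_apply hd

theorem ne_zero_of_dvd_primorial {d : ℕ} (hd : d ∣ primorial z) : d ≠ 0 :=
  ne_zero_of_dvd_ne_zero (primorial_ne_zero z) hd

theorem one_le_mul_tupleSieve_nu {d : ℕ} (hd : d ∣ primorial z) :
    1 ≤ (d : ℝ) * (tupleSieve D hD hadm z N).nu d := by
  have hsq := (squarefree_primorial z).squarefree_of_dvd hd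
  have h0 : (d : ℝ) ≠ 0 := by exact_mod_cast ne_zero_of_dvd_primorial hd
  have h1 : (∏ p ∈ d.primeFactors, (p : ℝ)) = d := by
    rw [← Nat.cast_prod, Nat.prod_primeFactors_of_squarefree hsq]
  rw [tupleSieve_nu (ne_zero_of_dvd_primorial hd), Finset.prod_div_distrib, h1,
    mul_div_cancel₀ _ h0]
  refine Finset.one_le_prod fun p _ => ?_
  exact_mod_cast residueCount_pos hD p

theorem sum_tupleSieve_support (f : ℕ → ℝ) :
    ∑ n ∈ (tupleSieve D hD hadm z N).support, (tupleSieve D hD hadm z N).weights n * f n =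
      ∑ m ∈ Finset.range N, f (shiftProd D m).natAbs := by
  rw [Finset.sum_comp f fun m => (shiftProd D m).natAbs]
  refine Finset.sum_congr rfl fun n _ => ?_
  rw [nsmul_eq_mul]
  rfl

theorem abs_tupleSieve_rem_le {d : ℕ} (hd : d ∣ primorial z) :
    |(tupleSieve D hD hadm z N).rem d| ≤ d := by
  have hd0 := ne_zero_of_dvd_primorial hd
  have hsq := (squarefree_primorial z).squarefree_of_dvd hd
  have hprod := Nat.prod_primeFactors_of_squarefree hsq
  have h1 : (tupleSieve D hD hadm z N).multSum d =
      ((Finset.range N).filter fun m => (d : ℤ) ∣ shiftProd D m).card := by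
    have := sum_tupleSieve_support (D := D) (hD := hD) (hadm := hadm) (z := z) (N := N)
      fun n => if d ∣ n then 1 else 0
    simp only [mul_ite, mul_one, mul_zero] at this
    rw [BoundingSieve.multSum, this, Finset.sum_boole]
    simp only [Int.natCast_dvd]
  have h2 : (tupleSieve D hD hadm z N).nu d =
      ((Finset.range d).filter fun m => (d : ℤ) ∣ shiftProd D m).card / d := by
    have h3 := card_filter_dvd_shiftProd D (U := d.primeFactors)
      fun p hp => Nat.prime_of_mem_primeFactors hp
    rw [hprod] at h3
    rw [tupleSieve_nu hd0, h3, Finset.prod_div_distrib]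
    rw [← Nat.cast_prod, ← Nat.cast_prod, hprod]
  rw [BoundingSieve.rem, h1, h2]
  exact abs_count_sub_le (Nat.pos_of_ne_zero hd0) (dvd_shiftProd_mod D d) N

/-- The Selberg terms are at least the densities `ν(l) / l`. -/
theorem squarefreeSum_le_selbergSum :
    squarefreeSum (fun p => (residueCount D p : ℝ) / p) z ≤
      selbergSum (tupleSieve D hD hadm z N) z := by
  set s := tupleSieve D hD hadm z N with hs
  have hinj : Set.InjOn (fun U : Finset ℕ => ∏ p ∈ U, p) (smallPrimeSets z) := by
    intro U hU V hV h
    have hU' := (mem_smallPrimeSets.1 (Finset.mem_coe.1 hU)).1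
    have hV' := (mem_smallPrimeSets.1 (Finset.mem_coe.1 hV)).1
    simp only at h
    rw [← Nat.primeFactors_prod hU', ← Nat.primeFactors_prod hV', h]
  have hterm : ∀ U ∈ smallPrimeSets z, ∏ p ∈ U, (residueCount D p : ℝ) / p ≤
      (fun l => if l ≤ z then s.selbergTerms l else 0) (∏ p ∈ U, p) := by
    intro U hU
    have hU' := mem_smallPrimeSets.1 hU
    have h0 : ∏ p ∈ U, p ≠ 0 := (Finset.prod_pos fun p hp => (hU'.1 p hp).pos).ne'
    simp only [hU'.2, if_true]
    rw [BoundingSieve.selbergTerms_apply, hs, tupleSieve_nu h0, Nat.primeFactors_prod hU'.1]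
    refine le_mul_of_one_le_right (Finset.prod_nonneg fun p _ => by positivity)
      (Finset.one_le_prod fun p hp => ?_)
    have hp := hU'.1 p hp
    have hp0 : (0 : ℝ) < p := by exact_mod_cast hp.pos
    rw [tupleSieve_nu hp.ne_zero, hp.primeFactors, Finset.prod_singleton]
    have h1 : (residueCount D p : ℝ) / p < 1 := by
      rw [div_lt_one hp0]; exact_mod_cast hadm p hp
    have h2 : 0 ≤ (residueCount D p : ℝ) / p := by positivity
    rw [one_le_inv₀ (by linarith)]
    linarith
  refine (Finset.sum_le_sum hterm).trans ?_
  rw [← Finset.sum_image (f := fun l => if l ≤ z then s.selbergTerms l else 0)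
    (g := fun U : Finset ℕ => ∏ p ∈ U, p) hinj]
  refine Finset.sum_le_sum_of_subset_of_nonneg ?_ fun l hl _ => ite_selbergTerms_nonneg hl
  intro l hl
  obtain ⟨U, hU, rfl⟩ := Finset.mem_image.1 hl
  refine Nat.mem_divisors.2 ⟨?_, primorial_ne_zero z⟩
  change _ ∣ primorial z
  rw [primorial_eq_prod_primesLE]
  exact Finset.prod_dvd_prod_of_subset _ _ _ (subset_primesLE_of_mem_smallPrimeSets hU)

/-- If `m > z` gives a tuple of primes, no prime up to `z` divides the product of the `m + h`. -/
theorem tupleCount_le_siftedSum_add (x : ℝ) (hD : D.Nonempty)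
    (hadm : ∀ p : ℕ, p.Prime → residueCount D p < p) (hnn : ∀ h ∈ D, 0 ≤ h) (z : ℕ) :
    (tupleCount x D : ℝ) ≤ z + (tupleSieve D hD hadm z (⌊x⌋₊ + 1)).siftedSum := by
  have h1 : (tupleSieve D hD hadm z (⌊x⌋₊ + 1)).siftedSum =
      ((Finset.range (⌊x⌋₊ + 1)).filter fun m =>
        Nat.Coprime (primorial z) (shiftProd D m).natAbs).card := by
    have := sum_tupleSieve_support (D := D) (hD := hD) (hadm := hadm) (z := z) (N := ⌊x⌋₊ + 1)
      fun n => if Nat.Coprime (primorial z) n then 1 else 0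
    simp only [mul_ite, mul_one, mul_zero] at this
    rw [BoundingSieve.siftedSum]
    refine Eq.trans this ?_
    rw [Finset.sum_boole]
  rw [h1]
  have h2 : ((Finset.Icc 1 ⌊x⌋₊).filter fun m : ℕ => ∀ d ∈ D, ((m : ℤ) + d).toNat.Prime) ⊆
      Finset.Icc 1 z ∪ (Finset.range (⌊x⌋₊ + 1)).filter fun m =>
        Nat.Coprime (primorial z) (shiftProd D m).natAbs := by
    intro m hm
    rw [Finset.mem_filter, Finset.mem_Icc] at hm
    rw [Finset.mem_union, Finset.mem_Icc, Finset.mem_filter, Finset.mem_range]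
    by_cases hmz : m ≤ z
    · exact Or.inl ⟨hm.1.1, hmz⟩
    · refine Or.inr ⟨by omega, ?_⟩
      by_contra hco
      obtain ⟨q, hq, hqP, hqF⟩ := Nat.Prime.not_coprime_iff_dvd.1 hco
      rw [hq.dvd_primorial_iff] at hqP
      obtain ⟨d, hd, hqd⟩ := ((Nat.prime_iff_prime_int.1 hq).dvd_finsetProd_iff _).1
        (Int.natCast_dvd.2 hqF)
      have hd0 := hnn d hd
      have hpr := hm.2 d hd
      have hcast : ((((m : ℤ) + d).toNat : ℕ) : ℤ) = (m : ℤ) + d :=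
        Int.toNat_of_nonneg (by positivity)
      rw [← hcast, Int.natCast_dvd_natCast, Nat.prime_dvd_prime_iff_eq hq hpr] at hqd
      omega
  have h3 := (Finset.card_le_card h2).trans (Finset.card_union_le _ _)
  rw [Nat.card_Icc, Nat.add_sub_cancel] at h3
  unfold tupleCount
  exact_mod_cast h3

end TupleSieve

theorem tupleCount_le_div_squarefreeSum (x : ℝ) {D : Finset ℤ} (hD : D.Nonempty)
    (hS : singularSeries D ≠ 0) (hnn : ∀ h ∈ D, 0 ≤ h) {z : ℕ} (hz : 1 ≤ z) :
    (tupleCount x D : ℝ) ≤ z + (z : ℝ) ^ 6 +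
      (⌊x⌋₊ + 1) / squarefreeSum (fun p => (residueCount D p : ℝ) / p) z := by
  have hadm := singularSeries_ne_zero_iff.1 hS
  have h1 := tupleCount_le_siftedSum_add x hD hadm hnn z
  have h2 := siftedSum_le_div_selbergSum_add (s := tupleSieve D hD hadm z (⌊x⌋₊ + 1)) hz
    (fun d hd => one_le_mul_tupleSieve_nu hd) (fun d hd => abs_tupleSieve_rem_le hd)
  have h3 : (tupleSieve D hD hadm z (⌊x⌋₊ + 1)).totalMass = ⌊x⌋₊ + 1 := by
    change ((⌊x⌋₊ + 1 : ℕ) : ℝ) = _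
    push_cast
    rfl
  have h4 := squarefreeSum_le_selbergSum (D := D) (hD := hD) (hadm := hadm) (z := z)
    (N := ⌊x⌋₊ + 1)
  have h5 := one_le_squarefreeSum (f := fun p => (residueCount D p : ℝ) / p)
    (fun p => by positivity) hz
  rw [h3] at h2
  have h6 : ((⌊x⌋₊ : ℝ) + 1) / selbergSum (tupleSieve D hD hadm z (⌊x⌋₊ + 1)) z ≤
      (⌊x⌋₊ + 1) / squarefreeSum (fun p => (residueCount D p : ℝ) / p) z := by
    gcongr
  linarith

/-- The sieve bound for prime tuples: the expected order of magnitude, with a constant that depends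
only on the number of elements of the tuple. -/
theorem exists_tupleCount_le (n : ℕ) (hn : 1 ≤ n) : ∃ C : ℝ, 0 < C ∧ ∀ᶠ x : ℝ in atTop,
    ∀ D : Finset ℤ, D.card = n → (∀ h ∈ D, 0 ≤ h) → singularSeries D ≠ 0 →
      (tupleCount x D : ℝ) ≤ C * (singularSeries D * (x / Real.log x ^ n)) := by
  obtain ⟨C, hC, hCl⟩ := exists_log_pow_le_squarefreeSum_residueCount n
  set K : ℝ := Real.exp (2 * ((n : ℝ) + 1) ^ 4) with hK
  have hK0 : 0 < K := Real.exp_pos _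
  have hn0 : (0 : ℝ) < n := by exact_mod_cast hn
  refine ⟨2 * K + 2 * C * (8 * n) ^ n, by positivity, ?_⟩
  -- `(log x) ^ n` is smaller than `x ^ (1/4)`
  have hlog : ∀ᶠ x : ℝ in atTop, Real.log x ^ n ≤ x ^ (1 / 4 : ℝ) := by
    have := (isLittleO_log_rpow_rpow_atTop (n : ℝ) (by norm_num : (0 : ℝ) < 1 / 4)).bound one_pos
    filter_upwards [this, eventually_ge_atTop 1] with x hx hx1
    rw [Real.norm_eq_abs, Real.norm_eq_abs, one_mul, Real.rpow_natCast,
      abs_of_nonneg (pow_nonneg (Real.log_nonneg hx1) _),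
      abs_of_nonneg (Real.rpow_nonneg (by linarith) _)] at hx
    exact hx
  filter_upwards [hlog, eventually_gt_atTop 1] with x hx hx1
  intro D hcard hnn hS
  have hx0 : 0 < x := by linarith
  have hL : 0 < Real.log x := Real.log_pos hx1
  have hD : D.Nonempty := by rw [← Finset.card_pos]; omega
  have hSpos := singularSeries_pos_of_ne_zero hS
  set r : ℝ := x ^ (1 / (8 * n : ℝ)) with hr
  have hr1 : 1 ≤ r := Real.one_le_rpow hx1.le (by positivity)
  set y : ℕ := ⌊r⌋₊ with hy
  have hy1 : 1 ≤ y := Nat.le_floor (by exact_mod_cast hr1)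
  have hz1 : 1 ≤ y ^ n := Nat.one_le_pow _ _ hy1
  have hyr : (y : ℝ) ≤ r := Nat.floor_le (by linarith)
  have hzx : ((y ^ n : ℕ) : ℝ) ≤ x ^ (1 / 8 : ℝ) := by
    push_cast
    calc (y : ℝ) ^ n ≤ r ^ n := by gcongr
      _ = x ^ (1 / 8 : ℝ) := by
        rw [hr, ← Real.rpow_natCast, ← Real.rpow_mul hx0.le]
        congr 1
        field_simp
  have h1 := tupleCount_le_div_squarefreeSum x hD hS hnn hz1
  have h2 := hCl D y hcard hS hy1
  set G := squarefreeSum (fun p => (residueCount D p : ℝ) / p) (y ^ n) with hG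
  have hG1 : 1 ≤ G := one_le_squarefreeSum (fun p => by positivity) hz1
  -- the main term
  have hlogy : Real.log x / (8 * n) ≤ Real.log (y + 1) := by
    have h3 : Real.log r = Real.log x / (8 * n) := by
      rw [hr, Real.log_rpow hx0]; ring
    rw [← h3]
    exact Real.log_le_log (by linarith) (Nat.lt_floor_add_one r).le
  have h4 : (Real.log x / (8 * n)) ^ n ≤ C * singularSeries D * G :=
    le_trans (by gcongr) h2
  have h5 : (⌊x⌋₊ : ℝ) + 1 ≤ 2 * x := by
    have := Nat.floor_le hx0.le
    linarith
  have hmain : ((⌊x⌋₊ : ℝ) + 1) / G ≤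
      2 * C * (8 * n) ^ n * (singularSeries D * (x / Real.log x ^ n)) := by
    rw [div_le_iff₀ (by linarith)]
    refine h5.trans ?_
    rw [div_pow, div_le_iff₀ (by positivity)] at h4
    have hLn : 0 < Real.log x ^ n := pow_pos hL n
    calc 2 * x = 2 * x / Real.log x ^ n * Real.log x ^ n := by field_simp
      _ ≤ 2 * x / Real.log x ^ n * (C * singularSeries D * G * (8 * n) ^ n) := by gcongr
      _ = _ := by ring
  -- the remainder terms
  have hS1 : 1 ≤ K * singularSeries D := by
    have := one_le_mul_singularSeries (singularSeries_ne_zero_iff.1 hS)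
    rwa [hcard] at this
  have h6 : ((y ^ n : ℕ) : ℝ) + ((y ^ n : ℕ) : ℝ) ^ 6 ≤ 2 * x ^ (3 / 4 : ℝ) := by
    have h7 : ((y ^ n : ℕ) : ℝ) ^ 6 ≤ x ^ (3 / 4 : ℝ) := by
      calc ((y ^ n : ℕ) : ℝ) ^ 6 ≤ (x ^ (1 / 8 : ℝ)) ^ 6 := by gcongr
        _ = x ^ (3 / 4 : ℝ) := by
          rw [← Real.rpow_natCast, ← Real.rpow_mul hx0.le]; norm_num
    have h8 : ((y ^ n : ℕ) : ℝ) ≤ x ^ (3 / 4 : ℝ) :=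
      hzx.trans (Real.rpow_le_rpow_of_exponent_le hx1.le (by norm_num))
    linarith
  have h9 : 2 * x ^ (3 / 4 : ℝ) ≤ 2 * K * (singularSeries D * (x / Real.log x ^ n)) := by
    have hLn : 0 < Real.log x ^ n := pow_pos hL n
    have h10 : x ^ (3 / 4 : ℝ) ≤ x / Real.log x ^ n := by
      rw [le_div_iff₀ hLn]
      calc x ^ (3 / 4 : ℝ) * Real.log x ^ n ≤ x ^ (3 / 4 : ℝ) * x ^ (1 / 4 : ℝ) := by gcongr
        _ = x := by rw [← Real.rpow_add hx0]; norm_num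
    have h11 : 0 ≤ x / Real.log x ^ n := by positivity
    nlinarith
  linarith

/-! ### Consecutive primes and prime tuples -/

theorem nth_prime_strictMono : StrictMono (Nat.nth Nat.Prime) :=
  Nat.nth_strictMono Nat.infinite_setOfPred_prime

theorem prime_nth (n : ℕ) : (Nat.nth Nat.Prime n).Prime :=
  Nat.nth_mem_of_infinite Nat.infinite_setOfPred_prime n

theorem exists_nth_prime_eq {q : ℕ} (hq : q.Prime) : ∃ j, Nat.nth Nat.Prime j = q :=
  ⟨Nat.count Nat.Prime q, Nat.nth_count hq⟩

theorem mem_primeDifferences {k n : ℕ} {d : ℤ} : d ∈ primeDifferences k n ↔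
    ∃ j, n < j ∧ j ≤ n + k ∧ (Nat.nth Nat.Prime j : ℤ) - Nat.nth Nat.Prime n = d := by
  simp only [primeDifferences, Finset.mem_image, Finset.mem_Icc]
  constructor
  · rintro ⟨i, hi, rfl⟩
    exact ⟨n + i, by omega, by omega, rfl⟩
  · rintro ⟨j, h1, h2, rfl⟩
    exact ⟨j - n, by omega, by rw [show n + (j - n) = j by omega]⟩

theorem pos_of_mem_primeDifferences {k n : ℕ} {d : ℤ} (h : d ∈ primeDifferences k n) : 0 < d := by
  obtain ⟨j, h1, -, rfl⟩ := mem_primeDifferences.1 h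
  have := nth_prime_strictMono h1
  omega

theorem le_of_mem_primeDifferences {k n : ℕ} {d : ℤ} (h : d ∈ primeDifferences k n) :
    d + Nat.nth Nat.Prime n ≤ Nat.nth Nat.Prime (n + k) := by
  obtain ⟨j, -, h2, rfl⟩ := mem_primeDifferences.1 h
  have := nth_prime_strictMono.monotone h2
  omega

theorem exists_of_gapCount_pos {k : ℕ} {x : ℝ} {D : Finset ℤ} (h : 0 < gapCount k x D) :
    ∃ n, (Nat.nth Nat.Prime (n + k) : ℝ) ≤ x ∧ primeDifferences k n = D :=
  Set.nonempty_of_ncard_ne_zero h.ne'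

theorem pos_of_gapCount_pos {k : ℕ} {x : ℝ} {D : Finset ℤ} (h : 0 < gapCount k x D) :
    ∀ d ∈ D, 0 < d := by
  obtain ⟨n, -, rfl⟩ := exists_of_gapCount_pos h
  exact fun d hd => pos_of_mem_primeDifferences hd

theorem le_of_gapCount_pos {k : ℕ} {x : ℝ} {D : Finset ℤ} (h : 0 < gapCount k x D) :
    ∀ d ∈ D, (d : ℝ) ≤ x := by
  obtain ⟨n, hn, rfl⟩ := exists_of_gapCount_pos h
  intro d hd
  have h1 := le_of_mem_primeDifferences hd
  have h2 : (d : ℝ) + Nat.nth Nat.Prime n ≤ Nat.nth Nat.Prime (n + k) := by exact_mod_cast h1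
  have h3 : (0 : ℝ) ≤ Nat.nth Nat.Prime n := by positivity
  linarith

/-- The set counted by `tupleCount`. -/
noncomputable def tupleSet (x : ℝ) (D : Finset ℤ) : Finset ℕ :=
  (Finset.Icc 1 ⌊x⌋₊).filter fun m : ℕ => ∀ d ∈ D, ((m : ℤ) + d).toNat.Prime

theorem mem_tupleSet {x : ℝ} {D : Finset ℤ} {m : ℕ} : m ∈ tupleSet x D ↔
    (1 ≤ m ∧ m ≤ ⌊x⌋₊) ∧ ∀ d ∈ D, ((m : ℤ) + d).toNat.Prime := by
  simp [tupleSet]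

theorem card_tupleSet (x : ℝ) (D : Finset ℤ) : (tupleSet x D).card = tupleCount x D := rfl

theorem tupleSet_insert (x : ℝ) (D : Finset ℤ) (e : ℤ) : tupleSet x (insert e D) =
    (tupleSet x D).filter fun m : ℕ => ((m : ℤ) + e).toNat.Prime := by
  ext m
  simp only [Finset.mem_filter, mem_tupleSet, Finset.forall_mem_insert]
  tauto

/-- Between consecutive primes `p_n, …, p_{n+k}` there is no further prime. -/
theorem gapCount_le_card {k : ℕ} {x : ℝ} {D E : Finset ℤ}
    (hE : ∀ e ∈ E, 0 < e ∧ e ∉ D ∧ ∃ d ∈ D, e < d) :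
    gapCount k x D ≤
      ((tupleSet x (insert 0 D)).filter fun m : ℕ => ∀ e ∈ E, ¬ ((m : ℤ) + e).toNat.Prime).card := by
  rw [← Set.ncard_coe_finset]
  refine Set.ncard_le_ncard_of_injOn (fun n => Nat.nth Nat.Prime n) ?_
    nth_prime_strictMono.injective.injOn (Finset.finite_toSet _)
  rintro n ⟨hnx, hD⟩
  subst hD
  rw [Finset.mem_coe, Finset.mem_filter, mem_tupleSet]
  refine ⟨⟨⟨(prime_nth n).pos, Nat.le_floor (le_trans ?_ hnx)⟩, ?_⟩, ?_⟩
  · exact_mod_cast nth_prime_strictMono.monotone (Nat.le_add_right n k)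
  · intro d hd
    rcases Finset.mem_insert.1 hd with rfl | hd
    · simp [prime_nth n]
    · obtain ⟨j, -, -, rfl⟩ := mem_primeDifferences.1 hd
      simp [prime_nth j]
  · intro e he hpr
    obtain ⟨h0, hnot, d, hd, hed⟩ := hE e he
    obtain ⟨j, hj⟩ := exists_nth_prime_eq hpr
    obtain ⟨i, -, hi, rfl⟩ := mem_primeDifferences.1 hd
    have hj' : (Nat.nth Nat.Prime j : ℤ) = Nat.nth Nat.Prime n + e := by
      rw [hj]; exact Int.toNat_of_nonneg (by omega)
    refine hnot (mem_primeDifferences.2 ⟨j, ?_, ?_, by omega⟩)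
    · rw [← nth_prime_strictMono.lt_iff_lt]; omega
    · have : j < i := by rw [← nth_prime_strictMono.lt_iff_lt]; omega
      omega

theorem gapCount_le_tupleCount (k : ℕ) (x : ℝ) (D : Finset ℤ) :
    gapCount k x D ≤ tupleCount x (insert 0 D) := by
  refine (gapCount_le_card (E := ∅) (by simp)).trans ?_
  rw [← card_tupleSet]
  exact Finset.card_filter_le _ _

/-- Bonferroni's inequality for the primes in between. -/
theorem gapCount_add_sum_le {k : ℕ} {x : ℝ} {D E : Finset ℤ}
    (hE : ∀ e ∈ E, 0 < e ∧ e ∉ D ∧ ∃ d ∈ D, e < d) :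
    gapCount k x D + ∑ e ∈ E, tupleCount x (insert e (insert 0 D)) ≤
      tupleCount x (insert 0 D) +
        ∑ e ∈ E, ∑ f ∈ E.erase e, tupleCount x (insert f (insert e (insert 0 D))) := by
  set A := tupleSet x (insert 0 D) with hA
  have h1 := gapCount_le_card (k := k) (x := x) hE
  rw [← hA] at h1
  have h2 : ∀ e, tupleCount x (insert e (insert 0 D)) =
      ∑ m ∈ A, if ((m : ℤ) + e).toNat.Prime then 1 else 0 := by
    intro e
    rw [← card_tupleSet, tupleSet_insert, Finset.card_filter]
  have h3 : ∀ e f, tupleCount x (insert f (insert e (insert 0 D))) =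
      ∑ m ∈ A, if ((m : ℤ) + e).toNat.Prime then
        (if ((m : ℤ) + f).toNat.Prime then 1 else 0) else 0 := by
    intro e f
    rw [← card_tupleSet, tupleSet_insert, tupleSet_insert, Finset.card_filter, Finset.sum_filter]
  have h4 : ∀ m : ℕ, ∑ e ∈ E, ∑ f ∈ E.erase e, (if ((m : ℤ) + e).toNat.Prime then
      (if ((m : ℤ) + f).toNat.Prime then 1 else 0) else 0) =
      (E.filter fun e => ((m : ℤ) + e).toNat.Prime).card *
        ((E.filter fun e => ((m : ℤ) + e).toNat.Prime).card - 1) := by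
    intro m
    set R := E.filter fun e => ((m : ℤ) + e).toNat.Prime with hR
    have h5 : ∀ e ∈ E, (∑ f ∈ E.erase e, if ((m : ℤ) + e).toNat.Prime then
        (if ((m : ℤ) + f).toNat.Prime then 1 else 0) else 0) =
        if ((m : ℤ) + e).toNat.Prime then R.card - 1 else 0 := by
      intro e he
      split_ifs with h
      · rw [← Finset.card_filter, Finset.filter_erase, ← hR,
          Finset.card_erase_of_mem (Finset.mem_filter.2 ⟨he, h⟩)]
      · simp
    rw [Finset.sum_congr rfl h5, ← Finset.sum_filter, ← hR, Finset.sum_const, smul_eq_mul]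
  have h6 : ∑ e ∈ E, tupleCount x (insert e (insert 0 D)) =
      ∑ m ∈ A, (E.filter fun e => ((m : ℤ) + e).toNat.Prime).card := by
    simp only [h2]
    rw [Finset.sum_comm]
    simp only [Finset.card_filter]
  have h7 : ∑ e ∈ E, ∑ f ∈ E.erase e, tupleCount x (insert f (insert e (insert 0 D))) =
      ∑ m ∈ A, (E.filter fun e => ((m : ℤ) + e).toNat.Prime).card *
        ((E.filter fun e => ((m : ℤ) + e).toNat.Prime).card - 1) := by
    simp only [h3]
    rw [← Finset.sum_congr rfl fun m _ => h4 m, Finset.sum_comm (s := A)]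
    exact Finset.sum_congr rfl fun e _ => Finset.sum_comm
  rw [h6, h7, ← card_tupleSet, ← hA]
  refine (Nat.add_le_add_right h1 _).trans ?_
  rw [Finset.card_filter, Finset.card_eq_sum_ones A, ← Finset.sum_add_distrib,
    ← Finset.sum_add_distrib]
  refine Finset.sum_le_sum fun m _ => ?_
  set r := (E.filter fun e => ((m : ℤ) + e).toNat.Prime).card with hr
  split_ifs with h
  · have : r = 0 := by
      rw [hr, Finset.card_eq_zero, Finset.filter_eq_empty_iff]
      exact fun e he => h e he
    simp [this]
  · rcases Nat.lt_or_ge r 2 with h2 | h2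
    · omega
    · obtain ⟨s, hs⟩ : ∃ s, r = s + 2 := ⟨r - 2, by omega⟩
      rw [hs]
      have : s + 2 - 1 = s + 1 := by omega
      rw [this]
      nlinarith

/-- A tuple of primes without a further prime in between consists of consecutive primes. -/
theorem mem_image_nth_of_no_prime_between {k : ℕ} {x : ℝ} {D : Finset ℤ} {H : ℤ} {m : ℕ}
    (hcard : D.card = k) (hpos : ∀ d ∈ D, 0 < d ∧ d ≤ H) (hH : H ∈ D)
    (hm : m ∈ tupleSet x (insert 0 D)) (hmx : (m : ℝ) + H ≤ x)
    (hno : ∀ e ∈ Finset.Ioo 0 H \ D, ¬ ((m : ℤ) + e).toNat.Prime) :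
    ∃ n, ((Nat.nth Nat.Prime (n + k) : ℝ) ≤ x ∧ primeDifferences k n = D) ∧
      Nat.nth Nat.Prime n = m := by
  rw [mem_tupleSet] at hm
  obtain ⟨-, hpr⟩ := hm
  have hmp : m.Prime := by simpa using hpr 0 (Finset.mem_insert_self _ _)
  obtain ⟨n, hn⟩ := exists_nth_prime_eq hmp
  obtain ⟨J, hJ⟩ := exists_nth_prime_eq (hpr H (Finset.mem_insert_of_mem hH))
  have hH0 := (hpos H hH).1
  have hJ' : (Nat.nth Nat.Prime J : ℤ) = m + H := by
    rw [hJ]; exact Int.toNat_of_nonneg (by omega)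
  have hnJ : n < J := by rw [← nth_prime_strictMono.lt_iff_lt]; omega
  set φ : ℕ → ℤ := fun j => (Nat.nth Nat.Prime j : ℤ) - m with hφ
  have hinj : Function.Injective φ := by
    intro i j hij
    simp only [hφ] at hij
    exact nth_prime_strictMono.injective (by omega)
  have himage : (Finset.Ioc n J).image φ = D := by
    ext e
    rw [Finset.mem_image]
    constructor
    · rintro ⟨j, hj, rfl⟩
      rw [Finset.mem_Ioc] at hj
      have h1 := nth_prime_strictMono hj.1
      have h2 := nth_prime_strictMono.monotone hj.2
      by_contra hnot
      have hne : φ j ≠ H := fun h => hnot (h ▸ hH)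
      refine hno (φ j) (Finset.mem_sdiff.2 ⟨Finset.mem_Ioo.2 ⟨?_, ?_⟩, hnot⟩) ?_
      · simp only [hφ]; omega
      · simp only [hφ] at hne ⊢; omega
      · have : (m : ℤ) + φ j = Nat.nth Nat.Prime j := by simp only [hφ]; ring
        rw [this, Int.toNat_natCast]
        exact prime_nth j
    · intro he
      obtain ⟨j, hj⟩ := exists_nth_prime_eq (hpr e (Finset.mem_insert_of_mem he))
      have he0 := hpos e he
      have hj' : (Nat.nth Nat.Prime j : ℤ) = m + e := by
        rw [hj]; exact Int.toNat_of_nonneg (by omega)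
      refine ⟨j, Finset.mem_Ioc.2 ⟨?_, ?_⟩, ?_⟩
      · rw [← nth_prime_strictMono.lt_iff_lt]; omega
      · rw [← nth_prime_strictMono.le_iff_le]; omega
      · simp only [hφ]; omega
  have hJn : J = n + k := by
    have := congrArg Finset.card himage
    rw [Finset.card_image_of_injective _ hinj, Nat.card_Ioc, hcard] at this
    omega
  subst hJn
  refine ⟨n, ⟨?_, ?_⟩, hn⟩
  · have : (Nat.nth Nat.Prime (n + k) : ℝ) = m + H := by exact_mod_cast hJ'
    rw [this]
    exact hmx
  · rw [← himage]
    ext e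
    rw [mem_primeDifferences, Finset.mem_image]
    simp only [hφ, Finset.mem_Ioc, hn]
    exact ⟨fun ⟨j, h1, h2, h3⟩ => ⟨j, ⟨h1, h2⟩, h3⟩, fun ⟨j, h1, h3⟩ => ⟨j, h1.1, h1.2, h3⟩⟩

/-- A prime tuple either consists of consecutive primes up to `x`, or has a further prime in
between, or ends beyond `x`. -/
theorem tupleCount_le_gapCount_add {k : ℕ} (x : ℝ) {D : Finset ℤ} {H : ℕ}
    (hcard : D.card = k) (hpos : ∀ d ∈ D, 0 < d ∧ d ≤ H) (hH : (H : ℤ) ∈ D) :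
    tupleCount x (insert 0 D) ≤ gapCount k x D +
      ∑ e ∈ Finset.Ioo 0 (H : ℤ) \ D, tupleCount x (insert e (insert 0 D)) + H := by
  set F := (finite_gapCount_set k x D).toFinset with hF
  have hFcard : F.card = gapCount k x D := by
    rw [hF, gapCount, Set.ncard_eq_toFinset_card _ (finite_gapCount_set k x D)]
  have hsub : tupleSet x (insert 0 D) ⊆ (F.image fun n => Nat.nth Nat.Prime n) ∪
      ((Finset.Ioo 0 (H : ℤ) \ D).biUnion fun e => tupleSet x (insert e (insert 0 D))) ∪
      Finset.Ioc (⌊x⌋₊ - H) ⌊x⌋₊ := by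
    intro m hm
    have hm' := mem_tupleSet.1 hm
    rw [Finset.mem_union, Finset.mem_union]
    by_cases hno : ∀ e ∈ Finset.Ioo 0 (H : ℤ) \ D, ¬ ((m : ℤ) + e).toNat.Prime
    · by_cases hmx : m + H ≤ ⌊x⌋₊
      · have hx0 : 0 ≤ x := by
          by_contra hx
          have := Nat.floor_of_nonpos (not_le.1 hx).le
          omega
        have hmx' : (m : ℝ) + ((H : ℤ) : ℝ) ≤ x := by
          have h1 : ((m + H : ℕ) : ℝ) ≤ x := le_trans (by exact_mod_cast hmx) (Nat.floor_le hx0)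
          push_cast at h1 ⊢
          exact h1
        obtain ⟨n, h1, h2⟩ := mem_image_nth_of_no_prime_between hcard hpos hH hm hmx' hno
        exact Or.inl (Or.inl (Finset.mem_image.2 ⟨n, by simpa [hF] using h1, h2⟩))
      · exact Or.inr (Finset.mem_Ioc.2 ⟨by omega, hm'.1.2⟩)
    · push Not at hno
      obtain ⟨e, he, hpr⟩ := hno
      refine Or.inl (Or.inr (Finset.mem_biUnion.2 ⟨e, he, ?_⟩))
      rw [tupleSet_insert]
      exact Finset.mem_filter.2 ⟨hm, hpr⟩
  rw [← card_tupleSet, ← hFcard]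
  refine (Finset.card_le_card hsub).trans ((Finset.card_union_le _ _).trans ?_)
  refine Nat.add_le_add ((Finset.card_union_le _ _).trans (Nat.add_le_add Finset.card_image_le ?_))
    ?_
  · exact Finset.card_biUnion_le
  · rw [Nat.card_Ioc]
    omega

theorem sum_range_sub_le (a : ℕ → ℕ) (ha : Monotone a) (k N : ℕ) :
    ∑ n ∈ Finset.range (N + 1), (a (n + k) - a n) ≤ k * a (N + k) := by
  have h1 : ∑ n ∈ Finset.range (N + 1), (a (n + k) - a n) + ∑ n ∈ Finset.range (N + 1), a n =
      ∑ n ∈ Finset.range (N + 1), a (k + n) := by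
    rw [← Finset.sum_add_distrib]
    refine Finset.sum_congr rfl fun n _ => ?_
    rw [add_comm k n]
    exact Nat.sub_add_cancel (ha (Nat.le_add_right n k))
  have h2 := Finset.sum_range_add a k (N + 1)
  have h3 := Finset.sum_range_add a (N + 1) k
  rw [add_comm k (N + 1)] at h2
  have h4 : ∑ n ∈ Finset.range k, a (N + 1 + n) ≤ k * a (N + k) := by
    have := Finset.sum_le_card_nsmul (Finset.range k) (fun n => a (N + 1 + n)) (a (N + k))
      fun n hn => ha (by rw [Finset.mem_range] at hn; omega)
    simpa using this
  omega

/-- Long gaps are rare: the gaps `p_{n+k} - p_n` up to `x` cover each integer at most `k` times. -/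
theorem gapCount_mul_le {k : ℕ} {x : ℝ} (hx : 0 ≤ x) {D : Finset ℤ} {d : ℕ} (hd : (d : ℤ) ∈ D) :
    (gapCount k x D : ℝ) * d ≤ k * x := by
  set F := (finite_gapCount_set k x D).toFinset with hF
  have hFcard : F.card = gapCount k x D := by
    rw [hF, gapCount, Set.ncard_eq_toFinset_card _ (finite_gapCount_set k x D)]
  rcases F.eq_empty_or_nonempty with hempty | hne
  · rw [← hFcard, hempty]
    simpa using mul_nonneg (Nat.cast_nonneg k) hx
  · have hmem : ∀ n ∈ F, (Nat.nth Nat.Prime (n + k) : ℝ) ≤ x ∧ primeDifferences k n = D :=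
      fun n hn => by simpa [hF] using hn
    set N := F.max' hne with hN
    have hNx := (hmem N (F.max'_mem hne)).1
    have h1 : F.card * d ≤ ∑ n ∈ Finset.range (N + 1),
        (Nat.nth Nat.Prime (n + k) - Nat.nth Nat.Prime n) := by
      rw [← smul_eq_mul]
      refine le_trans (Finset.card_nsmul_le_sum F
        (fun n => Nat.nth Nat.Prime (n + k) - Nat.nth Nat.Prime n) d fun n hn => ?_) ?_
      · have := le_of_mem_primeDifferences ((hmem n hn).2.symm ▸ hd)
        omega
      · refine Finset.sum_le_sum_of_subset fun n hn => ?_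
        exact Finset.mem_range.2 (Nat.lt_succ_of_le (F.le_max' n hn))
    have h2 := h1.trans (sum_range_sub_le _ nth_prime_strictMono.monotone k N)
    rw [← hFcard]
    calc (F.card : ℝ) * d ≤ k * Nat.nth Nat.Prime (N + k) := by exact_mod_cast h2
      _ ≤ k * x := by gcongr

/-- If all residue classes modulo `p` are occupied, one of the `m + d` is divisible by `p`, hence equal
to `p`. -/
theorem tupleCount_le_card {x : ℝ} {D : Finset ℤ} (hnn : ∀ d ∈ D, 0 ≤ d)
    (hS : singularSeries D = 0) : tupleCount x D ≤ D.card := by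
  obtain ⟨p, hp, hν⟩ := exists_residueCount_eq_of_singularSeries_eq_zero hS
  have hpD : p ≤ D.card := hν ▸ residueCount_le_card D p
  have hp0 : (0 : ℤ) < p := by exact_mod_cast hp.pos
  have himage : (D.image fun d => d % (p : ℤ)) = Finset.Ico (0 : ℤ) p := by
    refine Finset.eq_of_subset_of_card_le ?_ ?_
    · intro r hr
      obtain ⟨d, -, rfl⟩ := Finset.mem_image.1 hr
      exact Finset.mem_Ico.2 ⟨Int.emod_nonneg _ hp0.ne', Int.emod_lt_of_pos _ hp0⟩
    · have : (D.image fun d => d % (p : ℤ)).card = p := hν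
      rw [this]
      simp
  have hsub : tupleSet x D ⊆ Finset.Icc 1 p := by
    intro m hm
    rw [mem_tupleSet] at hm
    have h1 : (-(m : ℤ)) % p ∈ Finset.Ico (0 : ℤ) p :=
      Finset.mem_Ico.2 ⟨Int.emod_nonneg _ hp0.ne', Int.emod_lt_of_pos _ hp0⟩
    rw [← himage] at h1
    obtain ⟨d, hd, hdm⟩ := Finset.mem_image.1 h1
    have h2 : (p : ℤ) ∣ d - -(m : ℤ) := Int.ModEq.dvd (Eq.symm hdm)
    have hd0 := hnn d hd
    have hcast : ((((m : ℤ) + d).toNat : ℕ) : ℤ) = (m : ℤ) + d :=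
      Int.toNat_of_nonneg (by positivity)
    have h3 : d - -(m : ℤ) = (m : ℤ) + d := by ring
    rw [h3, ← hcast, Int.natCast_dvd_natCast,
      Nat.prime_dvd_prime_iff_eq hp (hm.2 d hd)] at h2
    exact Finset.mem_Icc.2 ⟨hm.1.1, by omega⟩
  rw [← card_tupleSet]
  refine (Finset.card_le_card hsub).trans ?_
  rw [Nat.card_Icc]
  omega

/-! ### Multiples of a primorial -/

/-- The set `{P, 2P, …, kP}`, where `P` is the product of the primes up to `y`. -/
noncomputable def primorialTuple (k y : ℕ) : Finset ℤ := dilate (primorial y) (Finset.Icc 1 (k : ℤ))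

theorem insert_zero_primorialTuple (k y : ℕ) :
    insert 0 (primorialTuple k y) = dilate (primorial y) (Finset.Icc 0 (k : ℤ)) := by
  rw [primorialTuple, ← dilate_insert_zero]
  congr 1
  ext a
  simp only [Finset.mem_insert, Finset.mem_Icc]
  omega

theorem card_primorialTuple (k y : ℕ) : (primorialTuple k y).card = k := by
  rw [primorialTuple, card_dilate (primorial_pos y)]
  simp

theorem card_insert_zero_primorialTuple (k y : ℕ) :
    (insert 0 (primorialTuple k y)).card = k + 1 := by
  rw [insert_zero_primorialTuple, card_dilate (primorial_pos y)]
  simp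

theorem primorialTuple_bounds {k y : ℕ} (hy : 2 ≤ y) {d : ℤ} (hd : d ∈ primorialTuple k y) :
    2 ≤ d ∧ d ≤ (k * primorial y : ℕ) := by
  obtain ⟨i, hi, rfl⟩ := mem_dilate.1 hd
  rw [Finset.mem_Icc] at hi
  have h1 : 2 ≤ primorial y := by
    have := primorial_mono hy
    rwa [primorial_two] at this
  have h2 : (2 : ℤ) ≤ primorial y := by exact_mod_cast h1
  push_cast
  constructor <;> nlinarith

theorem residueCount_primorialTuple_of_le {k y p : ℕ} (hp : p.Prime) (hpy : p ≤ y) :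
    residueCount (insert 0 (primorialTuple k y)) p = 1 := by
  refine residueCount_eq_one (Finset.insert_nonempty _ _) fun a ha => ?_
  rw [insert_zero_primorialTuple] at ha
  obtain ⟨i, -, rfl⟩ := mem_dilate.1 ha
  exact dvd_mul_of_dvd_left (by exact_mod_cast hp.dvd_primorial_iff.2 hpy) _

theorem residueCount_primorialTuple_of_lt {k y p : ℕ} (hp : p.Prime) (hpy : y < p) (hk : k < p) :
    residueCount (insert 0 (primorialTuple k y)) p = k + 1 := by
  have hco : IsCoprime (p : ℤ) (primorial y : ℤ) := by
    rw [Nat.isCoprime_iff_coprime, hp.coprime_iff_not_dvd, hp.dvd_primorial_iff]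
    omega
  rw [insert_zero_primorialTuple, residueCount_dilate_of_coprime hco, residueCount_eq_card]
  · simp
  · intro a ha b hb hab
    rw [Finset.mem_Icc] at ha hb
    have h := Int.eq_zero_of_abs_lt_dvd hab (by rw [abs_lt]; omega)
    omega

theorem residueCount_primorialTuple_lt {k y : ℕ} (hk : k + 1 ≤ y) (p : ℕ) (hp : p.Prime) :
    residueCount (insert 0 (primorialTuple k y)) p < p := by
  rcases Nat.lt_or_ge y p with h | h
  · rw [residueCount_primorialTuple_of_lt hp h (by omega)]
    omega
  · rw [residueCount_primorialTuple_of_le hp h]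
    exact hp.one_lt

theorem singularSeries_primorialTuple_ne_zero {k y : ℕ} (hk : k + 1 ≤ y) :
    singularSeries (insert 0 (primorialTuple k y)) ≠ 0 :=
  singularSeries_ne_zero_iff.2 (residueCount_primorialTuple_lt hk)

theorem tendsto_sum_primesUpTo_inv :
    Tendsto (fun y : ℕ => ∑ p ∈ primesUpTo y, 1 / (p : ℝ)) atTop atTop := by
  have h := (not_summable_iff_tendsto_nat_atTop_of_nonneg (fun n => Set.indicator_nonneg
    (fun p _ => by positivity) n)).1 not_summable_one_div_on_primes
  refine (h.comp (tendsto_add_atTop_nat 1)).congr fun y => ?_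
  simp only [Function.comp]
  rw [Finset.sum_indicator_eq_sum_filter]
  symm
  refine Finset.sum_bij (fun p _ => (p : ℕ)) ?_ ?_ ?_ ?_
  · intro p hp
    rw [Finset.mem_filter, Finset.mem_range]
    exact ⟨Nat.lt_succ_of_le (mem_primesUpTo.1 hp), p.2⟩
  · intro p _ q _ h
    exact Subtype.val_injective h
  · intro p hp
    rw [Finset.mem_filter, Finset.mem_range] at hp
    exact ⟨⟨p, hp.2⟩, mem_primesUpTo.2 (Nat.le_of_lt_succ hp.1), rfl⟩
  · intro p _
    rfl

theorem one_add_sum_le_prod {ι : Type*} (s : Finset ι) (f : ι → ℝ) (hf : ∀ i, 0 ≤ f i) :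
    1 + ∑ i ∈ s, f i ≤ ∏ i ∈ s, (1 + f i) := by
  classical
  induction s using Finset.induction_on with
  | empty => simp
  | insert a s ha ih =>
    rw [Finset.sum_insert ha, Finset.prod_insert ha]
    have h1 := Finset.sum_nonneg fun i (_ : i ∈ s) => hf i
    nlinarith [hf a]

theorem tendsto_singularSeries_primorialTuple {k : ℕ} (hk : 1 ≤ k) :
    Tendsto (fun y => singularSeries (insert 0 (primorialTuple k y))) atTop atTop := by
  have hC : 0 < Real.exp (2 * ((k : ℝ) + 1 + 1) ^ 4) := Real.exp_pos _
  refine tendsto_atTop_mono' atTop ?_ (tendsto_sum_primesUpTo_inv.const_mul_atTop (inv_pos.2 hC))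
  filter_upwards [eventually_ge_atTop (k + 1)] with y hy
  rw [inv_mul_le_iff₀ hC]
  have h := prod_le_mul_singularSeries (residueCount_primorialTuple_lt hy) (primesUpTo y)
  rw [card_insert_zero_primorialTuple] at h
  push_cast at h
  refine le_trans ?_ h
  have hk' : (1 : ℝ) ≤ k := by exact_mod_cast hk
  calc ∑ p ∈ primesUpTo y, 1 / (p : ℝ) ≤ ∏ p ∈ primesUpTo y, (1 + 1 / (p : ℝ)) := by
        have := one_add_sum_le_prod (primesUpTo y) (fun p => 1 / (p : ℝ)) fun p => by positivity
        linarith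
    _ ≤ _ := by
        refine Finset.prod_le_prod (fun p _ => by positivity) fun p hp => ?_
        rw [residueCount_primorialTuple_of_le p.2 (mem_primesUpTo.1 hp)]
        push_cast
        gcongr
        linarith

/-- The number of primes above `y` that divide `m` is `O(log m / log y)`, and each of them contributes
a factor `1 + O(1 / y)`. -/
theorem prod_primeFactors_gt_le {m : ℕ} (hm : m ≠ 0) {A y : ℕ} (hy : 2 ≤ y)
    (h : m ≤ 2 ^ (A * y)) {c : ℝ} (hc : 0 ≤ c) :
    ∏ p ∈ m.primeFactors with y < p, (1 + c / (p : ℝ)) ≤ Real.exp (c * A / Real.log y) := by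
  set F := m.primeFactors.filter fun p => y < p with hF
  have hy' : (0 : ℝ) < y := by exact_mod_cast (by omega : 0 < y)
  have hlog : 0 < Real.log y := Real.log_pos (by exact_mod_cast (by omega : 1 < y))
  have h1 : y ^ F.card ≤ m := by
    calc y ^ F.card ≤ ∏ p ∈ F, p :=
          Finset.pow_card_le_prod _ _ _ fun p hp => (Finset.mem_filter.1 hp).2.le
      _ ≤ ∏ p ∈ m.primeFactors, p :=
          Finset.prod_le_prod_of_subset_of_one_le' (Finset.filter_subset _ _)
            fun p hp _ => (Nat.prime_of_mem_primeFactors hp).pos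
      _ ≤ m := Nat.le_of_dvd (Nat.pos_of_ne_zero hm) (Nat.prod_primeFactors_dvd m)
  have h2 : (F.card : ℝ) * Real.log y ≤ A * y := by
    have h3 : ((y : ℝ) ^ F.card) ≤ 2 ^ (A * y) := by exact_mod_cast h1.trans h
    have h4 := Real.log_le_log (by positivity) h3
    rw [Real.log_pow, Real.log_pow] at h4
    refine h4.trans ?_
    push_cast
    have : Real.log 2 ≤ 1 := by linarith [Real.log_two_lt_d9]
    exact mul_le_of_le_one_right (by positivity) this
  calc ∏ p ∈ F, (1 + c / (p : ℝ)) ≤ Real.exp (∑ p ∈ F, c / (p : ℝ)) :=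
        prod_le_exp_sum F _ fun p _ => by positivity
    _ ≤ Real.exp (F.card * (c / y)) := by
        refine Real.exp_le_exp.2 ?_
        rw [← nsmul_eq_mul]
        refine Finset.sum_le_card_nsmul _ _ _ fun p hp => ?_
        have : (y : ℝ) ≤ p := by exact_mod_cast (Finset.mem_filter.1 hp).2.le
        gcongr
    _ ≤ Real.exp (c * A / Real.log y) := by
        refine Real.exp_le_exp.2 ?_
        rw [le_div_iff₀ hlog]
        calc (F.card : ℝ) * (c / y) * Real.log y = c / y * (F.card * Real.log y) := by ring
          _ ≤ c / y * (A * y) := by gcongr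
          _ = c * A := by field_simp

/-- The multiples of a primorial nearly maximize the singular series: beyond `y`, another tuple
can only profit from the few primes that divide one of its differences. -/
theorem singularSeries_le_primorialTuple {k A y : ℕ} (hy : 2 * (k + 1) ≤ y) {T : Finset ℤ}
    (hT : T.card = k + 1)
    (hdiff : ∀ a ∈ T, ∀ b ∈ T, (a - b).natAbs ≤ 2 ^ (A * y)) :
    singularSeries T ≤ Real.exp ((k + 1) ^ 2 * (2 * k * A / Real.log y)) *
      singularSeries (insert 0 (primorialTuple k y)) := by
  set Ts := insert 0 (primorialTuple k y) with hTs
  have hTne : T.Nonempty := by rw [← Finset.card_pos]; omega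
  have hcard : T.card = Ts.card := by rw [hT, hTs, card_insert_zero_primorialTuple]
  have hlogy : 0 ≤ Real.log y := Real.log_natCast_nonneg y
  set w : ℕ → ℝ := fun p => if y < p then 1 + 2 * k / (p : ℝ) else 1 with hw
  have hw1 : ∀ p, 1 ≤ w p := fun p => by
    simp only [hw]
    have : (0 : ℝ) ≤ 2 * k / p := by positivity
    split_ifs <;> linarith
  have hoff : ∀ x ∈ T.offDiag, x.1 - x.2 ≠ 0 := fun x hx =>
    sub_ne_zero.2 (Finset.mem_offDiag.1 hx).2.2
  -- the factor at `p` is increased by `w p` for each difference divisible by `p`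
  have hlocal : ∀ p : ℕ, p.Prime → localFactor T p ≤
      (∏ x ∈ T.offDiag, if (p : ℤ) ∣ x.1 - x.2 then w p else 1) * localFactor Ts p := by
    intro p hp
    have hprod1 : ∀ x ∈ T.offDiag, 1 ≤ if (p : ℤ) ∣ x.1 - x.2 then w p else 1 := fun x _ => by
      split_ifs
      · exact hw1 p
      · exact le_rfl
    have hnn := localFactor_nonneg Ts hp
    rcases Nat.lt_or_ge y p with hyp | hyp
    · have hν : residueCount Ts p = k + 1 := residueCount_primorialTuple_of_lt hp hyp (by omega)
      by_cases hdvd : ∃ x ∈ T.offDiag, (p : ℤ) ∣ x.1 - x.2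
      · obtain ⟨x, hx, hpx⟩ := hdvd
        have h1 : w p ≤ ∏ x ∈ T.offDiag, if (p : ℤ) ∣ x.1 - x.2 then w p else 1 := by
          rw [← Finset.mul_prod_erase _ _ hx, if_pos hpx]
          exact le_mul_of_one_le_right (by linarith [hw1 p])
            (Finset.one_le_prod fun z hz => hprod1 z (Finset.mem_of_mem_erase hz))
        refine le_trans ?_ (mul_le_mul_of_nonneg_right h1 hnn)
        have hlt := one_div_prime_lt_one hp
        rw [localFactor, localFactor, hcard, mul_left_comm]
        refine mul_le_mul_of_nonneg_left ?_ (inv_nonneg.2 (pow_nonneg (by linarith) _))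
        have hp0 : (0 : ℝ) < p := by exact_mod_cast hp.pos
        have hν1 : (1 : ℝ) / p ≤ residueCount T p / p := by
          gcongr
          exact_mod_cast residueCount_pos hTne p
        have hpk : 2 * ((k : ℝ) + 1) ≤ p := by exact_mod_cast hy.trans hyp.le
        simp only [hw, hyp, if_true, hν]
        have ht0 : 0 < (1 : ℝ) / p := by positivity
        have ht : 2 * ((k : ℝ) + 1) * (1 / p) ≤ 1 := by
          rw [mul_one_div, div_le_one hp0]; exact hpk
        have e1 : 2 * (k : ℝ) / p = 2 * k * (1 / p) := by ring
        have e2 : ((k + 1 : ℕ) : ℝ) / p = (k + 1) * (1 / p) := by push_cast; ring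
        rw [e1, e2]
        have h2 : 2 * ((k : ℝ) + 1) * (1 / p) * (k * (1 / p)) ≤ 1 * (k * (1 / p)) := by gcongr
        nlinarith
      · have hνT : residueCount T p = T.card := by
          refine residueCount_eq_card fun a ha b hb hab => ?_
          by_contra hne
          exact hdvd ⟨(a, b), Finset.mem_offDiag.2 ⟨ha, hb, hne⟩, hab⟩
        have h1 := localFactor_le_of_residueCount_le (D := T) (D' := Ts) hp hcard
          (by rw [hν, hνT, hT])
        exact h1.trans (le_mul_of_one_le_left hnn (Finset.one_le_prod hprod1))
    · have hν : residueCount Ts p = 1 := residueCount_primorialTuple_of_le hp hyp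
      have h1 := localFactor_le_of_residueCount_le (D := T) (D' := Ts) hp hcard
        (by rw [hν]; exact residueCount_pos hTne p)
      exact h1.trans (le_mul_of_one_le_left hnn (Finset.one_le_prod hprod1))
  have hmain : singularSeries T ≤
      (∏ x ∈ T.offDiag, ∏ p ∈ (x.1 - x.2).natAbs.primeFactors, w p) * singularSeries Ts := by
    refine singularSeries_le_mul (T.offDiag.biUnion fun x => primesUpTo (x.1 - x.2).natAbs)
      fun S hS => ?_
    have h1 : ∏ x ∈ T.offDiag, ∏ p ∈ (x.1 - x.2).natAbs.primeFactors, w p =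
        ∏ p ∈ S, ∏ x ∈ T.offDiag, if ((p : ℕ) : ℤ) ∣ x.1 - x.2 then w p else 1 := by
      rw [Finset.prod_comm]
      refine Finset.prod_congr rfl fun x hx => ?_
      rw [prod_primes_ite_dvd (hoff x hx)
        ((Finset.subset_biUnion_of_mem (fun x : ℤ × ℤ => primesUpTo (x.1 - x.2).natAbs) hx).trans hS)
        w]
    rw [h1, ← Finset.prod_mul_distrib]
    exact Finset.prod_le_prod (fun p _ => localFactor_nonneg _ p.2) fun p _ => hlocal p p.2
  refine hmain.trans (mul_le_mul_of_nonneg_right ?_ (singularSeries_nonneg _))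
  calc ∏ x ∈ T.offDiag, ∏ p ∈ (x.1 - x.2).natAbs.primeFactors, w p
      ≤ ∏ _x ∈ T.offDiag, Real.exp (2 * k * A / Real.log y) := by
        refine Finset.prod_le_prod (fun x _ => Finset.prod_nonneg fun p _ => by
          linarith [hw1 p]) fun x hx => ?_
        simp only [hw]
        rw [← Finset.prod_filter]
        have hx' := Finset.mem_offDiag.1 hx
        exact prod_primeFactors_gt_le (Int.natAbs_ne_zero.2 (hoff x hx)) (by omega)
          (hdiff _ hx'.1 _ hx'.2.1) (by positivity)
    _ ≤ _ := by
        rw [Finset.prod_const, ← Real.exp_nat_mul]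
        refine Real.exp_le_exp.2 (mul_le_mul_of_nonneg_right ?_ (by positivity))
        rw [Finset.offDiag_card, hT]
        have : (k + 1) * (k + 1) - (k + 1) ≤ (k + 1) ^ 2 := by
          rw [sq]; omega
        exact_mod_cast this

/-! ### Primes that do not divide a given integer -/

theorem eventually_exp_le_primorial :
    ∀ᶠ z : ℕ in atTop, Real.exp ((z : ℝ) / 2) ≤ primorial z := by
  have h1 : Tendsto (fun z : ℕ => (z : ℝ)) atTop atTop := tendsto_natCast_atTop_atTop
  have h2 := (isLittleO_log_rpow_atTop (by norm_num : (0 : ℝ) < 1 / 2)).bound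
    (by norm_num : (0 : ℝ) < 1 / 100)
  have h3 := h1.eventually h2
  filter_upwards [h3, eventually_ge_atTop 100] with z hz hz100
  have hz' : (100 : ℝ) ≤ z := by exact_mod_cast hz100
  have hlog : 0 ≤ Real.log z := Real.log_nonneg (by linarith)
  rw [← Real.sqrt_eq_rpow, Real.norm_eq_abs, Real.norm_eq_abs, abs_of_nonneg hlog,
    abs_of_nonneg (Real.sqrt_nonneg _)] at hz
  have hsq : √(z : ℝ) * √z = z := Real.mul_self_sqrt (by linarith)
  have hsz : √(z : ℝ) ≤ z := by
    rw [Real.sqrt_le_left (by linarith)]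
    nlinarith
  have hlog1 : Real.log ((z : ℝ) + 1) ≤ Real.log z + 1 := by
    have h4 : Real.log ((z : ℝ) + 1) ≤ Real.log (2 * z) := Real.log_le_log (by linarith)
      (by linarith)
    rw [Real.log_mul (by norm_num) (by linarith)] at h4
    linarith [Real.log_two_lt_d9]
  have hθ := Chebyshev.theta_ge z
  have hmul : √(z : ℝ) * Real.log z ≤ 1 / 100 * z := by
    calc √(z : ℝ) * Real.log z ≤ √z * (1 / 100 * √z) := by gcongr
      _ = 1 / 100 * (√z * √z) := by ring
      _ = _ := by rw [hsq]
  have hlow : (z : ℝ) / 2 ≤ Chebyshev.theta z := by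
    have h5 := Real.log_two_gt_d9
    nlinarith
  rw [Chebyshev.theta_eq_log_primorial, Nat.floor_natCast] at hlow
  rw [← Real.exp_log (by exact_mod_cast primorial_pos z : (0 : ℝ) < primorial z)]
  exact Real.exp_le_exp.2 hlow

/-- A nonzero integer that is smaller than the primorial of `z` is not divisible by all primes up to
`z`. -/
theorem eventually_exists_prime_not_dvd : ∀ᶠ z : ℕ in atTop, ∀ g : ℕ, g ≠ 0 →
    (g : ℝ) < Real.exp ((z : ℝ) / 2) → ∃ q : ℕ, q.Prime ∧ q ≤ z ∧ ¬ q ∣ g := by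
  filter_upwards [eventually_exp_le_primorial] with z hz g hg hlt
  by_contra! hcon
  have h1 : primorial z ∣ g := by
    rw [primorial_eq_prod_primesLE]
    exact Finset.prod_primes_dvd _ (fun p hp => (Nat.mem_primesLE.1 hp).2.prime)
      fun p hp => hcon p (Nat.mem_primesLE.1 hp).2 (Nat.mem_primesLE.1 hp).1
  have h2 : (primorial z : ℝ) ≤ g := by exact_mod_cast Nat.le_of_dvd (Nat.pos_of_ne_zero hg) h1
  linarith

/-! ### Asymptotic bounds for tuples of moderate size -/

/-- The sets of `k` integers in `[2, (log x)^(k+1)]` to which the hypothesis on prime tuples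
applies. -/
structure IsModerate (k : ℕ) (x : ℝ) (D : Finset ℤ) : Prop where
  card_eq : D.card = k
  two_le : ∀ d ∈ D, 2 ≤ d
  le_log : ∀ d ∈ D, (d : ℝ) ≤ Real.log x ^ (k + 1)
  ne_zero : singularSeries (insert 0 D) ≠ 0

/-- The number of occurrences of `{0} ∪ D` as a prime tuple up to `x` that the conjecture predicts. -/
noncomputable def mainTerm (k : ℕ) (x : ℝ) (D : Finset ℤ) : ℝ :=
  singularSeries (insert 0 D) * (x / Real.log x ^ (k + 1))

/-- The bound for the primes in the primorial whose multiples form the first competitor. -/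
noncomputable def smoothBound (x : ℝ) : ℕ := ⌊Real.log (Real.log x) / 4⌋₊

theorem tendsto_log_log : Tendsto (fun x : ℝ => Real.log (Real.log x)) atTop atTop :=
  Real.tendsto_log_atTop.comp Real.tendsto_log_atTop

theorem tendsto_smoothBound : Tendsto smoothBound atTop atTop :=
  tendsto_nat_floor_atTop.comp (tendsto_log_log.atTop_div_const (by norm_num))

theorem eventually_mul_log_pow_le (M : ℕ) {K : ℝ} (hK : 0 < K) :
    ∀ᶠ x : ℝ in atTop, K * Real.log x ^ M ≤ x := by
  have h := (Real.isLittleO_pow_log_id_atTop (n := M)).bound (inv_pos.2 hK)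
  filter_upwards [h, eventually_ge_atTop 1] with x hx hx1
  rw [Real.norm_eq_abs, Real.norm_eq_abs, id, abs_of_nonneg (pow_nonneg (Real.log_nonneg hx1) _),
    abs_of_nonneg (by linarith : (0 : ℝ) ≤ x), le_inv_mul_iff₀ hK] at hx
  exact hx

theorem eventually_mul_loglog_le (M : ℕ) {K : ℝ} (hK : 0 < K) :
    ∀ᶠ x : ℝ in atTop, K * Real.log (Real.log x) ^ M ≤ Real.log x :=
  Real.tendsto_log_atTop.eventually (eventually_mul_log_pow_le M hK)

/-- The primorial of the bound is small compared with `log x`, but of the same logarithmic order as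
the elements of the sets under consideration. -/
theorem eventually_smoothBound_bounds (k : ℕ) : ∀ᶠ x : ℝ in atTop,
    ((k * 4 ^ smoothBound x : ℕ) : ℝ) ≤ √(Real.log x) ∧
    (4 : ℝ) ^ smoothBound x ≤ √(Real.log x) ∧
    Real.log x ^ (k + 1) ≤ 2 ^ (8 * (k + 1) * smoothBound x) := by
  have h1 := tendsto_log_log.eventually_ge_atTop (15 : ℝ)
  have h2 := tendsto_log_log.eventually_ge_atTop (7 * Real.log (k + 1))
  filter_upwards [h1, h2, Real.tendsto_log_atTop.eventually_gt_atTop (1 : ℝ)] with x hl hk hL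
  set l := Real.log (Real.log x) with hl'
  set y := smoothBound x with hy
  have hL0 : 0 < Real.log x := by linarith
  have hyl : (y : ℝ) ≤ l / 4 := Nat.floor_le (by linarith)
  have hyl' : l / 4 < y + 1 := Nat.lt_floor_add_one _
  have hlog4 : Real.log 4 = 2 * Real.log 2 := by
    rw [show (4 : ℝ) = 2 ^ 2 by norm_num, Real.log_pow]; push_cast; ring
  have hl2 := Real.log_two_lt_d9
  have hl2' := Real.log_two_gt_d9
  have hsqrt : √(Real.log x) = Real.exp (l / 2) := by
    rw [Real.sqrt_eq_rpow, Real.rpow_def_of_pos hL0]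
    congr 1
    rw [hl']; ring
  have hpow : (4 : ℝ) ^ y ≤ Real.exp (7 / 20 * l) := by
    rw [← Real.rpow_natCast, Real.rpow_def_of_pos (by norm_num)]
    refine Real.exp_le_exp.2 ?_
    rw [hlog4]
    nlinarith
  refine ⟨?_, ?_, ?_⟩
  · rw [hsqrt]
    push_cast
    have hk1 : (k : ℝ) ≤ Real.exp (l / 7) := by
      calc (k : ℝ) ≤ k + 1 := by linarith
        _ = Real.exp (Real.log (k + 1)) := (Real.exp_log (by positivity)).symm
        _ ≤ _ := Real.exp_le_exp.2 (by linarith)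
    calc (k : ℝ) * 4 ^ y ≤ Real.exp (l / 7) * Real.exp (7 / 20 * l) := by gcongr
      _ = Real.exp (l / 7 + 7 / 20 * l) := (Real.exp_add _ _).symm
      _ ≤ _ := Real.exp_le_exp.2 (by linarith)
  · rw [hsqrt]
    exact hpow.trans (Real.exp_le_exp.2 (by linarith))
  · have h3 : Real.log x ≤ 2 ^ (8 * y) := by
      rw [← Real.exp_log hL0, ← Real.rpow_natCast, Real.rpow_def_of_pos (by norm_num)]
      refine Real.exp_le_exp.2 ?_
      push_cast
      nlinarith
    calc Real.log x ^ (k + 1) ≤ (2 ^ (8 * y)) ^ (k + 1) := by gcongr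
      _ = 2 ^ (8 * (k + 1) * y) := by rw [← pow_mul]; congr 1; ring

theorem IsModerate.nonneg {k : ℕ} {x : ℝ} {D : Finset ℤ} (h : IsModerate k x D) :
    ∀ d ∈ insert 0 D, 0 ≤ d := by
  intro d hd
  rcases Finset.mem_insert.1 hd with rfl | hd
  · exact le_rfl
  · linarith [h.two_le d hd]

theorem IsModerate.zero_notMem {k : ℕ} {x : ℝ} {D : Finset ℤ} (h : IsModerate k x D) : 0 ∉ D :=
  fun h0 => by linarith [h.two_le 0 h0]

theorem IsModerate.card_insert {k : ℕ} {x : ℝ} {D : Finset ℤ} (h : IsModerate k x D) :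
    (insert 0 D).card = k + 1 := by
  rw [Finset.card_insert_of_notMem h.zero_notMem, h.card_eq]

theorem singularSeries_eq_zero_of_one_mem {D : Finset ℤ} (h0 : 0 ∈ D) (h1 : 1 ∈ D) :
    singularSeries D = 0 := by
  by_contra h
  have h2 := singularSeries_ne_zero_iff.1 h 2 Nat.prime_two
  have h3 : 2 ≤ residueCount D 2 := two_le_residueCount h1 h0 (by norm_num)
  omega

/-- The main term exceeds every power of `log x`. -/
theorem eventually_log_pow_le_mainTerm (k M : ℕ) {K : ℝ} (hK : 0 < K) :
    ∀ᶠ x : ℝ in atTop, ∀ D, IsModerate k x D → K * Real.log x ^ M ≤ mainTerm k x D := by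
  set c : ℝ := Real.exp (2 * ((k : ℝ) + 1 + 1) ^ 4) with hc
  have hc0 : 0 < c := Real.exp_pos _
  filter_upwards [eventually_mul_log_pow_le (M + (k + 1)) (mul_pos hK hc0),
    eventually_gt_atTop 1] with x hx hx1 D hD
  have hL : 0 < Real.log x := Real.log_pos hx1
  have h1 := one_le_mul_singularSeries (singularSeries_ne_zero_iff.1 hD.ne_zero)
  rw [hD.card_insert] at h1
  push_cast at h1
  rw [mainTerm, ← mul_div_assoc, le_div_iff₀ (by positivity)]
  calc K * Real.log x ^ M * Real.log x ^ (k + 1) = K * Real.log x ^ (M + (k + 1)) * 1 := by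
        rw [pow_add]; ring
    _ ≤ K * Real.log x ^ (M + (k + 1)) * (c * singularSeries (insert 0 D)) := by gcongr
    _ = (K * c * Real.log x ^ (M + (k + 1))) * singularSeries (insert 0 D) := by ring
    _ ≤ x * singularSeries (insert 0 D) :=
        mul_le_mul_of_nonneg_right hx (singularSeries_nonneg _)
    _ = _ := by ring

theorem mainTerm_nonneg {k : ℕ} {x : ℝ} (hx : 1 ≤ x) (D : Finset ℤ) : 0 ≤ mainTerm k x D :=
  mul_nonneg (singularSeries_nonneg _)
    (div_nonneg (by linarith) (pow_nonneg (Real.log_nonneg hx) _))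

theorem eventually_abs_tupleCount_sub_le {k : ℕ} (hHL : StrongHardyLittlewood k) {ε : ℝ}
    (hε : 0 < ε) : ∀ᶠ x : ℝ in atTop, ∀ D, IsModerate k x D →
      |(tupleCount x (insert 0 D) : ℝ) - mainTerm k x D| ≤
        ε / Real.log (Real.log x) ^ 2 * mainTerm k x D := by
  filter_upwards [hHL.1 ε hε] with x hx D hD
  have := hx D (by rw [hD.card_eq]) (fun d hd => ⟨hD.two_le d hd, hD.le_log d hd⟩) hD.ne_zero
  rw [mul_one_div] at this
  exact this

/-- The number of tuples with one additional element, both when the enlarged tuple is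
unobstructed and when it is not. -/
theorem eventually_tupleCount_insert_bounds {k : ℕ} (hHL : StrongHardyLittlewood k) {ε : ℝ}
    (hε : 0 < ε) : ∀ᶠ x : ℝ in atTop, ∀ D, IsModerate k x D → ∀ e : ℤ, 0 < e → e ∉ D →
      (e : ℝ) ≤ Real.log x ^ (k + 1) →
      (1 - ε) * (singularSeries (insert e (insert 0 D)) * (x / Real.log x ^ (k + 2))) ≤
        tupleCount x (insert e (insert 0 D)) ∧
      (tupleCount x (insert e (insert 0 D)) : ℝ) ≤
        (1 + ε) * (singularSeries (insert e (insert 0 D)) * (x / Real.log x ^ (k + 2))) +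
          (k + 2) := by
  filter_upwards [hHL.2 ε hε] with x hx D hD e he heD heL
  have hnn : ∀ d ∈ insert e (insert 0 D), 0 ≤ d := by
    intro d hd
    rcases Finset.mem_insert.1 hd with rfl | hd
    · exact he.le
    · exact hD.nonneg d hd
  have heT : e ∉ insert 0 D := by
    rw [Finset.mem_insert]
    rintro (h | h)
    · omega
    · exact heD h
  by_cases hS : singularSeries (insert e (insert 0 D)) = 0
  · rw [hS, zero_mul, mul_zero, mul_zero, zero_add]
    refine ⟨by positivity, ?_⟩
    have h1 := tupleCount_le_card (x := x) hnn hS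
    rw [Finset.card_insert_of_notMem heT, hD.card_insert] at h1
    have h2 : (tupleCount x (insert e (insert 0 D)) : ℝ) ≤ ((k + 1 + 1 : ℕ) : ℝ) := by
      exact_mod_cast h1
    push_cast at h2
    linarith
  · have he1 : e ≠ 1 := by
      rintro rfl
      exact hS (singularSeries_eq_zero_of_one_mem
        (Finset.mem_insert_of_mem (Finset.mem_insert_self _ _)) (Finset.mem_insert_self _ _))
    have h1 := hx (insert e D) (by rw [Finset.card_insert_of_notMem heD, hD.card_eq]) (by
      intro d hd
      rcases Finset.mem_insert.1 hd with rfl | hd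
      · exact ⟨by omega, heL⟩
      · exact ⟨hD.two_le d hd, hD.le_log d hd⟩) (by rwa [Finset.insert_comm])
    rw [Finset.insert_comm, mul_one, abs_le] at h1
    have hk : (0 : ℝ) ≤ k := by positivity
    constructor <;> nlinarith [h1.1, h1.2]

theorem Ioo_sdiff_insert_zero (H : ℤ) (D : Finset ℤ) :
    Finset.Ioo 0 H \ insert 0 D = Finset.Ioo 0 H \ D := by
  ext e
  simp only [Finset.mem_sdiff, Finset.mem_Ioo, Finset.mem_insert]
  constructor
  · rintro ⟨h, h'⟩
    exact ⟨h, fun h0 => h' (Or.inr h0)⟩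
  · rintro ⟨h, h'⟩
    exact ⟨h, by rintro (h0 | h0) <;> [omega; exact h' h0]⟩

theorem card_Ioo_sdiff_le (H : ℕ) (D : Finset ℤ) :
    ((Finset.Ioo (0 : ℤ) H \ D).card : ℝ) ≤ H := by
  have h6 := Finset.card_le_card (Finset.sdiff_subset : Finset.Ioo (0 : ℤ) H \ D ⊆ _)
  have h7 : (Finset.Ioo (0 : ℤ) H \ D).card ≤ H := by
    rw [Int.card_Ioo] at h6; omega
  exact_mod_cast h7

/-- The average of the singular series of the tuples with one additional element. -/
theorem exists_eventually_sum_singularSeries_le (k n : ℕ) (hn : 1 ≤ n) : ∃ C : ℝ, 0 < C ∧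
    ∀ᶠ x : ℝ in atTop, ∀ (T : Finset ℤ) (H : ℕ), T.card = n →
      (∀ d ∈ T, 0 ≤ d ∧ (d : ℝ) ≤ Real.log x ^ (k + 1)) → √(Real.log x) ≤ H →
      (H : ℝ) ≤ Real.log x ^ (k + 1) →
      ∑ e ∈ Finset.Ioo (0 : ℤ) H \ T, singularSeries (insert e T) ≤
        C * H * singularSeries T := by
  obtain ⟨C, hC, h⟩ := exists_sum_singularSeries_insert_le n (8 * (k + 1)) hn
  refine ⟨C, hC, ?_⟩
  filter_upwards [eventually_smoothBound_bounds k, tendsto_smoothBound.eventually_ge_atTop 1]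
    with x hx hy T H hT hd hH hH'
  refine h T (smoothBound x) H hT hy ?_ ?_
  · have := hx.2.1.trans hH
    exact_mod_cast this
  · intro d hdT e he
    rw [Finset.mem_Ioo] at he
    obtain ⟨hd0, hdL⟩ := hd d hdT
    have h1 : (((e - d).natAbs : ℕ) : ℝ) ≤ Real.log x ^ (k + 1) := by
      have he1 : (e : ℝ) < H := by exact_mod_cast he.2
      have he0 : (0 : ℝ) < e := by exact_mod_cast he.1
      have hd0' : (0 : ℝ) ≤ d := by exact_mod_cast hd0
      rw [Nat.cast_natAbs, Int.cast_abs, Int.cast_sub, abs_le]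
      constructor <;> linarith
    exact_mod_cast h1.trans hx.2.2

/-- The sum over pairs of additional elements, bounded by the sieve. -/
theorem exists_eventually_sum_sum_tupleCount_le (k : ℕ) : ∃ C : ℝ, 0 < C ∧
    ∀ᶠ x : ℝ in atTop, ∀ D, IsModerate k x D → ∀ H : ℕ, √(Real.log x) ≤ H →
      (H : ℝ) ≤ Real.log x ^ (k + 1) →
      ∑ e ∈ Finset.Ioo (0 : ℤ) H \ D, ∑ f ∈ (Finset.Ioo (0 : ℤ) H \ D).erase e,
        (tupleCount x (insert f (insert e (insert 0 D))) : ℝ) ≤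
          C * (H / Real.log x) ^ 2 * mainTerm k x D := by
  obtain ⟨C₁, hC₁, h1⟩ := exists_eventually_sum_singularSeries_le k (k + 1) (by omega)
  obtain ⟨C₂, hC₂, h2⟩ := exists_eventually_sum_singularSeries_le k (k + 2) (by omega)
  obtain ⟨C₃, hC₃, h3⟩ := exists_tupleCount_le (k + 3) (by omega)
  refine ⟨C₃ * C₂ * C₁ + 1, by positivity, ?_⟩
  filter_upwards [h1, h2, h3, eventually_log_pow_le_mainTerm k 2
    (by positivity : (0 : ℝ) < (k : ℝ) + 3), eventually_gt_atTop 1]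
    with x h1 h2 h3 hJ hx1 D hD H hH hH'
  have hL : 0 < Real.log x := Real.log_pos hx1
  have hx0 : 0 < x := by linarith
  set T := insert 0 D with hT
  set E := Finset.Ioo (0 : ℤ) H \ D with hE
  have hET : E = Finset.Ioo (0 : ℤ) H \ T := (Ioo_sdiff_insert_zero _ _).symm
  have hTb : ∀ d ∈ T, 0 ≤ d ∧ (d : ℝ) ≤ Real.log x ^ (k + 1) := by
    intro d hd
    refine ⟨hD.nonneg d hd, ?_⟩
    rcases Finset.mem_insert.1 hd with rfl | hd
    · rw [Int.cast_zero]; positivity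
    · exact hD.le_log d hd
  have hS1 := h1 T H hD.card_insert hTb hH hH'
  rw [← hET] at hS1
  set Y : ℝ := x / Real.log x ^ (k + 3) with hY
  have hY0 : 0 ≤ Y := by positivity
  have hterm : ∀ e ∈ E, ∀ f ∈ E.erase e, (tupleCount x (insert f (insert e T)) : ℝ) ≤
      C₃ * (singularSeries (insert f (insert e T)) * Y) + (k + 3) := by
    intro e he f hf
    have he' := Finset.mem_sdiff.1 (hET ▸ he)
    have hf' := Finset.mem_sdiff.1 (hET ▸ Finset.mem_of_mem_erase hf)
    have hfe := Finset.ne_of_mem_erase hf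
    have hfT : f ∉ insert e T := by
      rw [Finset.mem_insert]
      rintro (h | h)
      · exact hfe h
      · exact hf'.2 h
    have hcard : (insert f (insert e T)).card = k + 3 := by
      rw [Finset.card_insert_of_notMem hfT, Finset.card_insert_of_notMem he'.2, hD.card_insert]
    have hnn : ∀ h ∈ insert f (insert e T), 0 ≤ h := by
      intro h hh
      rcases Finset.mem_insert.1 hh with rfl | hh
      · exact (Finset.mem_Ioo.1 hf'.1).1.le
      rcases Finset.mem_insert.1 hh with rfl | hh
      · exact (Finset.mem_Ioo.1 he'.1).1.le
      · exact hD.nonneg h hh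
    by_cases hS : singularSeries (insert f (insert e T)) = 0
    · have h4 := tupleCount_le_card (x := x) hnn hS
      rw [hcard] at h4
      rw [hS, zero_mul, mul_zero, zero_add]
      exact_mod_cast h4
    · have := h3 _ hcard hnn hS
      have hk : (0 : ℝ) ≤ k := by positivity
      linarith
  have hinner : ∀ e ∈ E, ∑ f ∈ E.erase e, (tupleCount x (insert f (insert e T)) : ℝ) ≤
      C₃ * C₂ * H * Y * singularSeries (insert e T) + H * (k + 3) := by
    intro e he
    have he' := Finset.mem_sdiff.1 (hET ▸ he)
    have heI := Finset.mem_Ioo.1 he'.1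
    have heH : (e : ℝ) ≤ H := by exact_mod_cast heI.2.le
    have hS2 := h2 (insert e T) H
      (by rw [Finset.card_insert_of_notMem he'.2, hD.card_insert]) (by
        intro d hd
        rcases Finset.mem_insert.1 hd with rfl | hd
        · exact ⟨heI.1.le, heH.trans hH'⟩
        · exact hTb d hd) hH hH'
    have hsub : E.erase e ⊆ Finset.Ioo (0 : ℤ) H \ insert e T := by
      intro f hf
      have hf' := Finset.mem_sdiff.1 (hET ▸ Finset.mem_of_mem_erase hf)
      refine Finset.mem_sdiff.2 ⟨hf'.1, ?_⟩
      rw [Finset.mem_insert]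
      rintro (h | h)
      · exact Finset.ne_of_mem_erase hf h
      · exact hf'.2 h
    have hcardE : ((E.erase e).card : ℝ) ≤ H :=
      le_trans (by exact_mod_cast Finset.card_erase_le) (card_Ioo_sdiff_le H D)
    calc ∑ f ∈ E.erase e, (tupleCount x (insert f (insert e T)) : ℝ)
        ≤ ∑ f ∈ E.erase e, (C₃ * (singularSeries (insert f (insert e T)) * Y) + (k + 3)) :=
          Finset.sum_le_sum (hterm e he)
      _ = C₃ * Y * ∑ f ∈ E.erase e, singularSeries (insert f (insert e T)) +
          (E.erase e).card * (k + 3) := by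
          rw [Finset.sum_add_distrib, Finset.sum_const, nsmul_eq_mul, Finset.mul_sum]
          congr 1
          exact Finset.sum_congr rfl fun f _ => by ring
      _ ≤ C₃ * Y * (C₂ * H * singularSeries (insert e T)) + H * (k + 3) := by
          gcongr
          exact (Finset.sum_le_sum_of_subset_of_nonneg hsub
            fun f _ _ => singularSeries_nonneg _).trans hS2
      _ = _ := by ring
  have hcardE : (E.card : ℝ) ≤ H := card_Ioo_sdiff_le H D
  have hJ' := hJ D hD
  have hJ2 : (H : ℝ) * (H * (k + 3)) ≤ (H / Real.log x) ^ 2 * mainTerm k x D := by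
    calc (H : ℝ) * (H * (k + 3)) = (H / Real.log x) ^ 2 * ((k + 3) * Real.log x ^ 2) := by
          field_simp
      _ ≤ _ := by gcongr
  calc ∑ e ∈ E, ∑ f ∈ E.erase e, (tupleCount x (insert f (insert e T)) : ℝ)
      ≤ ∑ e ∈ E, (C₃ * C₂ * H * Y * singularSeries (insert e T) + H * (k + 3)) :=
        Finset.sum_le_sum hinner
    _ = C₃ * C₂ * H * Y * ∑ e ∈ E, singularSeries (insert e T) + E.card * (H * (k + 3)) := by
        rw [Finset.sum_add_distrib, Finset.sum_const, nsmul_eq_mul, Finset.mul_sum]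
    _ ≤ C₃ * C₂ * H * Y * (C₁ * H * singularSeries T) + H * (H * (k + 3)) := by
        gcongr
    _ = C₃ * C₂ * C₁ * (H / Real.log x) ^ 2 * mainTerm k x D + H * (H * (k + 3)) := by
        rw [hY, mainTerm, ← hT]
        have : Real.log x ^ (k + 3) = Real.log x ^ (k + 1) * Real.log x ^ 2 := by
          rw [← pow_add]
        rw [this]
        field_simp
    _ ≤ _ := by
        rw [add_mul, one_mul, add_mul]
        linarith

/-! ### Lower bounds for gap counts, and the competitor -/

theorem IsModerate.exists_max {k : ℕ} {x : ℝ} {D : Finset ℤ} (h : IsModerate k x D) (hk : 1 ≤ k) :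
    ∃ H : ℕ, (H : ℤ) ∈ D ∧ ∀ d ∈ D, 0 < d ∧ d ≤ (H : ℤ) := by
  have hne : D.Nonempty := Finset.card_pos.1 (by rw [h.card_eq]; omega)
  have h2 := h.two_le _ (D.max'_mem hne)
  refine ⟨(D.max' hne).toNat, ?_, fun d hd => ⟨by linarith [h.two_le d hd], ?_⟩⟩
  · rw [Int.toNat_of_nonneg (by omega)]
    exact D.max'_mem hne
  · rw [Int.toNat_of_nonneg (by omega)]
    exact D.le_max' d hd

/-- The number of interruptions by a prime between the elements, counted with multiplicity. -/
theorem exists_eventually_sum_tupleCount_le {k : ℕ} (hHL : StrongHardyLittlewood k) :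
    ∃ C : ℝ, 0 < C ∧ ∀ᶠ x : ℝ in atTop, ∀ D, IsModerate k x D → ∀ H : ℕ, √(Real.log x) ≤ H →
      (H : ℝ) ≤ Real.log x ^ (k + 1) →
      ∑ e ∈ Finset.Ioo (0 : ℤ) H \ D, (tupleCount x (insert e (insert 0 D)) : ℝ) ≤
          C * (H / Real.log x) * mainTerm k x D := by
  obtain ⟨C₁, hC₁, h1⟩ := exists_eventually_sum_singularSeries_le k (k + 1) (by omega)
  refine ⟨2 * C₁ + 1, by positivity, ?_⟩
  filter_upwards [h1, eventually_tupleCount_insert_bounds hHL one_pos,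
    eventually_log_pow_le_mainTerm k 1 (by positivity : (0 : ℝ) < (k : ℝ) + 2),
    eventually_gt_atTop 1] with x h1 h2 hJ hx1 D hD H hH hH'
  have hL : 0 < Real.log x := Real.log_pos hx1
  have hTb : ∀ d ∈ insert 0 D, 0 ≤ d ∧ (d : ℝ) ≤ Real.log x ^ (k + 1) := by
    intro d hd
    refine ⟨hD.nonneg d hd, ?_⟩
    rcases Finset.mem_insert.1 hd with rfl | hd
    · rw [Int.cast_zero]; positivity
    · exact hD.le_log d hd
  have hS := h1 (insert 0 D) H hD.card_insert hTb hH hH'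
  rw [Ioo_sdiff_insert_zero] at hS
  set E := Finset.Ioo (0 : ℤ) H \ D with hE
  set Y : ℝ := x / Real.log x ^ (k + 2) with hY
  have hY0 : 0 ≤ Y := by positivity
  have hterm : ∀ e ∈ E, (tupleCount x (insert e (insert 0 D)) : ℝ) ≤
      2 * Y * singularSeries (insert e (insert 0 D)) + (k + 2) := by
    intro e he
    obtain ⟨he1, he2⟩ := Finset.mem_sdiff.1 he
    have he3 := Finset.mem_Ioo.1 he1
    have heH : (e : ℝ) ≤ H := by exact_mod_cast he3.2.le
    have := (h2 D hD e he3.1 he2 (heH.trans hH')).2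
    linarith
  have hJ' := hJ D hD
  calc ∑ e ∈ E, (tupleCount x (insert e (insert 0 D)) : ℝ)
      ≤ ∑ e ∈ E, (2 * Y * singularSeries (insert e (insert 0 D)) + (k + 2)) :=
        Finset.sum_le_sum hterm
    _ = 2 * Y * ∑ e ∈ E, singularSeries (insert e (insert 0 D)) + E.card * (k + 2) := by
        rw [Finset.sum_add_distrib, Finset.sum_const, nsmul_eq_mul, Finset.mul_sum]
    _ ≤ 2 * Y * (C₁ * H * singularSeries (insert 0 D)) + H * (k + 2) := by
        gcongr
        exact_mod_cast card_Ioo_sdiff_le H D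
    _ = 2 * C₁ * (H / Real.log x) * mainTerm k x D +
          (H / Real.log x) * ((k + 2) * Real.log x ^ 1) := by
        rw [hY, mainTerm, show k + 2 = k + 1 + 1 by ring, pow_succ]
        field_simp
    _ ≤ 2 * C₁ * (H / Real.log x) * mainTerm k x D + (H / Real.log x) * mainTerm k x D := by
        gcongr
    _ = _ := by ring

/-- Most occurrences of a tuple of primes consist of consecutive primes when the tuple is short
compared with `log x`. -/
theorem exists_eventually_le_gapCount {k : ℕ} (hk : 1 ≤ k) (hHL : StrongHardyLittlewood k) :
    ∃ C : ℝ, 0 < C ∧ ∀ ε : ℝ, 0 < ε → ∀ᶠ x : ℝ in atTop, ∀ D, IsModerate k x D → ∀ H : ℕ,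
      (∀ d ∈ D, d ≤ (H : ℤ)) → √(Real.log x) ≤ H → (H : ℝ) ≤ Real.log x ^ (k + 1) →
      (1 - ε / Real.log (Real.log x) ^ 2 - C * (H / Real.log x)) * mainTerm k x D ≤
        gapCount k x D := by
  obtain ⟨C, hC, h1⟩ := exists_eventually_sum_tupleCount_le hHL
  refine ⟨C + 1, by positivity, fun ε hε => ?_⟩
  filter_upwards [h1, eventually_abs_tupleCount_sub_le hHL hε,
    eventually_log_pow_le_mainTerm k 1 one_pos, eventually_gt_atTop 1]
    with x h1 h2 hJ hx1 D hD H hDH hH hH'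
  have hL : 0 < Real.log x := Real.log_pos hx1
  obtain ⟨H₁, hH₁, hb⟩ := hD.exists_max hk
  have hHH : H₁ ≤ H := by exact_mod_cast hDH _ hH₁
  have h3 : (tupleCount x (insert 0 D) : ℝ) ≤ gapCount k x D +
      ∑ e ∈ Finset.Ioo (0 : ℤ) H₁ \ D, (tupleCount x (insert e (insert 0 D)) : ℝ) + H₁ := by
    exact_mod_cast tupleCount_le_gapCount_add x hD.card_eq hb hH₁
  have h4 : ∑ e ∈ Finset.Ioo (0 : ℤ) H₁ \ D, (tupleCount x (insert e (insert 0 D)) : ℝ) ≤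
      ∑ e ∈ Finset.Ioo (0 : ℤ) H \ D, (tupleCount x (insert e (insert 0 D)) : ℝ) := by
    refine Finset.sum_le_sum_of_subset_of_nonneg (Finset.sdiff_subset_sdiff ?_ subset_rfl)
      fun _ _ _ => by positivity
    exact Finset.Ioo_subset_Ioo le_rfl (by exact_mod_cast hHH)
  have h5 := h1 D hD H hH hH'
  have h6 := (abs_le.1 (h2 D hD)).1
  have h7 : (H₁ : ℝ) ≤ H / Real.log x * mainTerm k x D := by
    calc (H₁ : ℝ) ≤ H := by exact_mod_cast hHH
      _ = H / Real.log x * (1 * Real.log x ^ 1) := by field_simp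
      _ ≤ _ := by gcongr; exact hJ D hD
  linarith

theorem eventually_isModerate_primorialTuple (k : ℕ) :
    ∀ᶠ x : ℝ in atTop, IsModerate k x (primorialTuple k (smoothBound x)) ∧
      ∀ d ∈ primorialTuple k (smoothBound x), (d : ℝ) ≤ √(Real.log x) := by
  filter_upwards [eventually_smoothBound_bounds k,
    tendsto_smoothBound.eventually_ge_atTop (k + 2),
    Real.tendsto_log_atTop.eventually_ge_atTop (1 : ℝ)] with x h1 hy hL
  have hd : ∀ d ∈ primorialTuple k (smoothBound x), (d : ℝ) ≤ √(Real.log x) := by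
    intro d hd
    have h2 : d ≤ (k * primorial (smoothBound x) : ℕ) :=
      (primorialTuple_bounds (by omega) hd).2
    have h3 : d ≤ (k * 4 ^ smoothBound x : ℕ) :=
      h2.trans (by exact_mod_cast Nat.mul_le_mul le_rfl (primorial_le_four_pow _))
    exact le_trans (by exact_mod_cast h3) h1.1
  refine ⟨⟨card_primorialTuple _ _, fun d hd => (primorialTuple_bounds (by omega) hd).1,
    fun d hd' => (hd d hd').trans ?_, singularSeries_primorialTuple_ne_zero (by omega)⟩, hd⟩
  calc √(Real.log x) ≤ Real.log x := Real.sqrt_le_iff.2 ⟨by linarith, by nlinarith⟩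
    _ ≤ Real.log x ^ (k + 1) := le_self_pow₀ hL (by omega)

theorem eventually_le_gapCount_primorialTuple {k : ℕ} (hk : 1 ≤ k)
    (hHL : StrongHardyLittlewood k) {ε : ℝ} (hε : 0 < ε) : ∀ᶠ x : ℝ in atTop,
      (1 - ε) * mainTerm k x (primorialTuple k (smoothBound x)) ≤
        gapCount k x (primorialTuple k (smoothBound x)) := by
  obtain ⟨C, hC, h⟩ := exists_eventually_le_gapCount hk hHL
  filter_upwards [h (ε / 2) (by positivity), eventually_isModerate_primorialTuple k,
    tendsto_log_log.eventually_ge_atTop (1 : ℝ),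
    (Real.tendsto_sqrt_atTop.comp Real.tendsto_log_atTop).eventually_ge_atTop (4 * C / ε),
    Real.tendsto_log_atTop.eventually_ge_atTop (4 : ℝ), eventually_ge_atTop 1]
    with x h hm hl hs hL hx
  set s := √(Real.log x) with hs'
  have hss : s * s = Real.log x := Real.mul_self_sqrt (by linarith)
  have hs2 : 2 ≤ s := Real.le_sqrt_of_sq_le (by linarith)
  have hc1 : (⌈s⌉₊ : ℝ) ≤ 2 * s := by linarith [Nat.ceil_lt_add_one (by linarith : 0 ≤ s)]
  refine le_trans ?_ (h _ hm.1 ⌈s⌉₊ ?_ (Nat.le_ceil _) ?_)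
  · refine mul_le_mul_of_nonneg_right ?_ (mainTerm_nonneg hx _)
    have h1 : ε / 2 / Real.log (Real.log x) ^ 2 ≤ ε / 2 :=
      div_le_self (by positivity) (one_le_pow₀ hl)
    have h2 : C * (⌈s⌉₊ / Real.log x) ≤ ε / 2 := by
      rw [← hss, ← mul_div_assoc, div_le_iff₀ (by positivity)]
      have h3 : 4 * C ≤ s * ε := (div_le_iff₀ hε).1 hs
      nlinarith
    linarith
  · intro d hd
    exact_mod_cast (hm.2 d hd).trans (Nat.le_ceil s)
  · calc (⌈s⌉₊ : ℝ) ≤ 2 * s := hc1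
      _ ≤ Real.log x := by nlinarith
      _ ≤ Real.log x ^ (k + 1) := le_self_pow₀ (by linarith) (by omega)

/-- Champions fall within the range of the hypothesis on prime tuples, because they are at least
as frequent as the multiples of a primorial. -/
theorem eventually_isModerate_of_isChampion {k : ℕ} (hk : 1 ≤ k) (hHL : StrongHardyLittlewood k) :
    ∀ᶠ x : ℝ in atTop, ∀ D, IsChampion k x D → IsModerate k x D := by
  filter_upwards [eventually_le_gapCount_primorialTuple hk hHL (ε := 1 / 2) (by norm_num),
    tendsto_smoothBound.eventually
      ((tendsto_singularSeries_primorialTuple hk).eventually_ge_atTop (4 * k : ℝ)),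
    eventually_mul_log_pow_le (k + 1) (by positivity : (0 : ℝ) < (k : ℝ) + 1),
    eventually_gt_atTop 1] with x h1 h2 h3 hx1 D hD
  have hL : 0 < Real.log x := Real.log_pos hx1
  have hk1 : (1 : ℝ) ≤ k := by exact_mod_cast hk
  have hP : 0 < Real.log x ^ (k + 1) := by positivity
  have hN : 2 * k * (x / Real.log x ^ (k + 1)) ≤ gapCount k x D := by
    have h4 : (gapCount k x (primorialTuple k (smoothBound x)) : ℝ) ≤ gapCount k x D := by
      exact_mod_cast hD.2 _ (card_primorialTuple _ _)
    refine le_trans ?_ (h1.trans h4)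
    rw [mainTerm]
    have : 0 < x / Real.log x ^ (k + 1) := by positivity
    nlinarith
  have hY : (k : ℝ) + 1 ≤ x / Real.log x ^ (k + 1) := by rwa [le_div_iff₀ hP]
  have hN1 : (k : ℝ) + 1 < gapCount k x D := by nlinarith
  have hpos : 0 < gapCount k x D := by
    have : (0 : ℝ) < gapCount k x D := by linarith
    exact_mod_cast this
  have hd0 := pos_of_gapCount_pos hpos
  have h0D : 0 ∉ D := fun h => lt_irrefl _ (hd0 0 h)
  have hne : singularSeries (insert 0 D) ≠ 0 := by
    intro hS
    have h5 := tupleCount_le_card (x := x) (D := insert 0 D) (by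
      intro d hd
      rcases Finset.mem_insert.1 hd with rfl | hd
      · exact le_rfl
      · exact (hd0 d hd).le) hS
    rw [Finset.card_insert_of_notMem h0D, hD.1] at h5
    have h6 : (gapCount k x D : ℝ) ≤ ((k + 1 : ℕ) : ℝ) := by
      exact_mod_cast (gapCount_le_tupleCount k x D).trans h5
    push_cast at h6
    linarith
  refine ⟨hD.1, fun d hd => ?_, fun d hd => ?_, hne⟩
  · have h7 : d ≠ 1 := by
      rintro rfl
      exact hne (singularSeries_eq_zero_of_one_mem (Finset.mem_insert_self _ _)
        (Finset.mem_insert_of_mem hd))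
    have := hd0 d hd
    omega
  · have h8 : ((d.toNat : ℕ) : ℤ) = d := Int.toNat_of_nonneg (hd0 d hd).le
    have h9 := gapCount_mul_le (k := k) (x := x) (by linarith) (D := D) (d := d.toNat)
      (by rwa [h8])
    have h10 : ((d.toNat : ℕ) : ℝ) = d := by exact_mod_cast congrArg (Int.cast (R := ℝ)) h8
    rw [h10] at h9
    have hdr : (0 : ℝ) < d := by exact_mod_cast hd0 d hd
    have h11 : 2 * k * (x / Real.log x ^ (k + 1)) * d ≤ k * x :=
      (mul_le_mul_of_nonneg_right hN hdr.le).trans h9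
    have h12 : 2 * k * (x / Real.log x ^ (k + 1)) * d =
        (k * x) * (2 * d / Real.log x ^ (k + 1)) := by ring
    have h13 : 2 * (d : ℝ) / Real.log x ^ (k + 1) ≤ 1 := by
      rw [h12] at h11
      exact le_of_mul_le_mul_left (by linarith) (by positivity : 0 < k * x)
    rw [div_le_one hP] at h13
    linarith

/-- Among the sets of moderate size, the multiples of a primorial have asymptotically the largest
singular series. -/
theorem eventually_mainTerm_le_primorialTuple (k : ℕ) {η : ℝ} (hη : 0 < η) :
    ∀ᶠ x : ℝ in atTop, ∀ D, IsModerate k x D →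
      mainTerm k x D ≤ (1 + η) * mainTerm k x (primorialTuple k (smoothBound x)) := by
  have hlim : Tendsto (fun x : ℝ => Real.exp (((k : ℝ) + 1) ^ 2 *
      (2 * k * (8 * (k + 1) : ℕ) / Real.log (smoothBound x)))) atTop (nhds 1) := by
    have h1 : Tendsto (fun x : ℝ => Real.log (smoothBound x : ℝ)) atTop atTop :=
      Real.tendsto_log_atTop.comp (tendsto_natCast_atTop_atTop.comp tendsto_smoothBound)
    have h2 := (h1.const_div_atTop (2 * k * (8 * (k + 1) : ℕ) : ℝ)).const_mul (((k : ℝ) + 1) ^ 2)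
    rw [mul_zero] at h2
    have h3 := (Real.continuous_exp.tendsto 0).comp h2
    rwa [Real.exp_zero] at h3
  filter_upwards [hlim.eventually_le_const (by linarith : (1 : ℝ) < 1 + η),
    eventually_smoothBound_bounds k, tendsto_smoothBound.eventually_ge_atTop (2 * (k + 1)),
    eventually_ge_atTop 1] with x h1 h2 hy hx D hD
  have hL := Real.log_nonneg hx
  have h3 := singularSeries_le_primorialTuple (A := 8 * (k + 1)) hy hD.card_insert (by
    have hb : ∀ d ∈ insert 0 D, 0 ≤ (d : ℝ) ∧ (d : ℝ) ≤ Real.log x ^ (k + 1) := by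
      intro d hd
      refine ⟨by exact_mod_cast hD.nonneg d hd, ?_⟩
      rcases Finset.mem_insert.1 hd with rfl | hd
      · rw [Int.cast_zero]; positivity
      · exact hD.le_log d hd
    intro a ha b hb'
    have h4 : (((a - b).natAbs : ℕ) : ℝ) ≤ Real.log x ^ (k + 1) := by
      rw [Nat.cast_natAbs, Int.cast_abs, Int.cast_sub, abs_le]
      have := hb a ha
      have := hb b hb'
      constructor <;> linarith
    exact_mod_cast h4.trans h2.2.2)
  rw [mainTerm, mainTerm, ← mul_assoc]
  refine mul_le_mul_of_nonneg_right (h3.trans ?_) (by positivity)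
  exact mul_le_mul_of_nonneg_right h1 (singularSeries_nonneg _)

/-! ### Champions divisible by the square of a prime -/

theorem mainTerm_pos {k : ℕ} {x : ℝ} (hx : 1 < x) {D : Finset ℤ} (hD : IsModerate k x D) :
    0 < mainTerm k x D :=
  mul_pos (singularSeries_pos_of_ne_zero hD.ne_zero)
    (div_pos (by linarith) (pow_pos (Real.log_pos hx) _))

theorem singularSeries_insert_zero_dilate {p : ℕ} (hp : p.Prime) {D : Finset ℤ}
    (hpD : ∀ d ∈ D, (p : ℤ) ∣ d) :
    singularSeries (insert 0 (dilate p D)) = singularSeries (insert 0 D) := by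
  rw [← dilate_insert_zero]
  refine singularSeries_dilate_eq hp ⟨0, Finset.mem_insert_self _ _⟩ fun d hd => ?_
  rcases Finset.mem_insert.1 hd with rfl | hd
  · exact dvd_zero _
  · exact hpD d hd

theorem IsModerate.of_dilate {k : ℕ} {x : ℝ} {p : ℕ} (hp : p.Prime) {D : Finset ℤ}
    (hpD : ∀ d ∈ D, (p : ℤ) ∣ d) (h : IsModerate k x (dilate p D)) : IsModerate k x D := by
  have hp2 : (2 : ℤ) ≤ p := by exact_mod_cast hp.two_le
  have hpos : ∀ d ∈ D, 2 ≤ (p : ℤ) * d ∧ 0 < d := by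
    intro d hd
    have h1 := h.two_le _ (mem_dilate.2 ⟨d, hd, rfl⟩)
    exact ⟨h1, by by_contra hd0; nlinarith⟩
  refine ⟨by rw [← h.card_eq, card_dilate hp.pos], fun d hd => ?_, fun d hd => ?_, ?_⟩
  · exact hp2.trans (Int.le_of_dvd (hpos d hd).2 (hpD d hd))
  · refine le_trans ?_ (h.le_log _ (mem_dilate.2 ⟨d, hd, rfl⟩))
    have h0 := (hpos d hd).2
    exact_mod_cast (by nlinarith : d ≤ (p : ℤ) * d)
  · rw [← singularSeries_insert_zero_dilate hp hpD]
    exact h.ne_zero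

/-- By the inequality of Bonferroni, restricted to the additional elements below `H`. -/
theorem exists_eventually_gapCount_add_sum_le {k : ℕ} (hHL : StrongHardyLittlewood k) :
    ∃ C : ℝ, 0 < C ∧ ∀ ε : ℝ, 0 < ε → ∀ᶠ x : ℝ in atTop, ∀ D, IsModerate k x D → ∀ H : ℕ,
      (∃ d ∈ D, (H : ℤ) ≤ d) → √(Real.log x) ≤ H → (H : ℝ) ≤ Real.log x ^ (k + 1) →
      gapCount k x D +
          ∑ e ∈ Finset.Ioo (0 : ℤ) H \ D, (tupleCount x (insert e (insert 0 D)) : ℝ) ≤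
        (1 + ε / Real.log (Real.log x) ^ 2 + C * (H / Real.log x) ^ 2) * mainTerm k x D := by
  obtain ⟨C, hC, h1⟩ := exists_eventually_sum_sum_tupleCount_le k
  refine ⟨C, hC, fun ε hε => ?_⟩
  filter_upwards [h1, eventually_abs_tupleCount_sub_le hHL hε] with x h1 h2 D hD H hdH hH hH'
  obtain ⟨d, hd, hdH⟩ := hdH
  have h3 := gapCount_add_sum_le (k := k) (x := x) (D := D) (E := Finset.Ioo (0 : ℤ) H \ D) (by
    intro e he
    obtain ⟨he1, he2⟩ := Finset.mem_sdiff.1 he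
    have he3 := Finset.mem_Ioo.1 he1
    exact ⟨he3.1, he2, d, hd, by omega⟩)
  have h4 := h1 D hD H hH hH'
  have h5 := (abs_le.1 (h2 D hD)).2
  have h6 : (gapCount k x D : ℝ) +
      ∑ e ∈ Finset.Ioo (0 : ℤ) H \ D, (tupleCount x (insert e (insert 0 D)) : ℝ) ≤
      tupleCount x (insert 0 D) + ∑ e ∈ Finset.Ioo (0 : ℤ) H \ D,
        ∑ f ∈ (Finset.Ioo (0 : ℤ) H \ D).erase e,
          (tupleCount x (insert f (insert e (insert 0 D))) : ℝ) := by
    exact_mod_cast h3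
  linarith

/-- For a set `D` of multiples of `p`, the gaps described by `dilate p D` are interrupted more
often than those described by `D`: besides the interruptions by `p * e` for `e ∈ E`, which
correspond to interruptions of the latter, there are some whose number is proportional to `H`. -/
def HasDilationGain (k : ℕ) (c C : ℝ) : Prop :=
  ∀ ε : ℝ, 0 < ε → ε < 1 → ∀ᶠ x : ℝ in atTop, ∀ (p : ℕ) (D : Finset ℤ), p.Prime →
    (∀ d ∈ D, (p : ℤ) ∣ d) → IsModerate k x (dilate p D) → ∀ H : ℕ,
    (∃ d ∈ dilate p D, (H : ℤ) ≤ d) → √(Real.log x) ≤ H → (H : ℝ) ≤ Real.log x ^ (k + 1) →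
    ∀ E : Finset ℤ, (∀ e ∈ E, 0 < e ∧ (p : ℤ) * e < H ∧ e ∉ D) →
      gapCount k x (dilate p D) +
          (1 - ε) * (x / Real.log x ^ (k + 2) * ∑ e ∈ E, singularSeries (insert e (insert 0 D)) +
            c * (H / Real.log x) * mainTerm k x D) ≤
        (1 + ε / Real.log (Real.log x) ^ 2 + C * (H / Real.log x) ^ 2) * mainTerm k x D

theorem exists_hasDilationGain {k : ℕ} (hHL : StrongHardyLittlewood k) :
    ∃ c C : ℝ, 0 < c ∧ 0 < C ∧ HasDilationGain k c C := by
  obtain ⟨c, hc, H₀, hgain⟩ := exists_sum_singularSeries_insert_dilate_ge k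
  obtain ⟨C, hC, hU⟩ := exists_eventually_gapCount_add_sum_le hHL
  refine ⟨c, C, hc, hC, fun ε hε hε1 => ?_⟩
  filter_upwards [hU ε hε, eventually_tupleCount_insert_bounds hHL hε,
    (Real.tendsto_sqrt_atTop.comp Real.tendsto_log_atTop).eventually_ge_atTop (H₀ : ℝ),
    eventually_gt_atTop 1] with x hU hlow hs hx p D hp hpD hm H hdH hH hH' E hE
  have hL : 0 < Real.log x := Real.log_pos hx
  have hm' := hm.of_dilate hp hpD
  have hSS := singularSeries_insert_zero_dilate hp hpD
  have h1 := hU _ hm H hdH hH hH'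
  have hmt : mainTerm k x (dilate p D) = mainTerm k x D := by rw [mainTerm, mainTerm, hSS]
  rw [hmt] at h1
  have hH₀ : H₀ ≤ H := by exact_mod_cast le_trans hs hH
  have h2 := hgain p H (insert 0 D) hp hH₀ hm'.card_insert (Finset.mem_insert_self _ _) (by
    intro d hd
    rcases Finset.mem_insert.1 hd with rfl | hd
    · exact dvd_zero _
    · exact hpD d hd) hm'.ne_zero E (by
    intro e he
    obtain ⟨h0, h1, h2⟩ := hE e he
    refine ⟨h0, h1, ?_⟩
    rw [Finset.mem_insert]
    rintro (h | h)
    · omega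
    · exact h2 h)
  rw [dilate_insert_zero, Ioo_sdiff_insert_zero] at h2
  set Y : ℝ := x / Real.log x ^ (k + 2) with hY
  have hY0 : 0 ≤ Y := by positivity
  have h3 : (1 - ε) * (Y * ∑ e ∈ Finset.Ioo (0 : ℤ) H \ dilate p D,
      singularSeries (insert e (insert 0 (dilate p D)))) ≤
      ∑ e ∈ Finset.Ioo (0 : ℤ) H \ dilate p D,
        (tupleCount x (insert e (insert 0 (dilate p D))) : ℝ) := by
    rw [Finset.mul_sum, Finset.mul_sum]
    refine Finset.sum_le_sum fun e he => ?_
    obtain ⟨he1, he2⟩ := Finset.mem_sdiff.1 he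
    have he3 := Finset.mem_Ioo.1 he1
    have heH : (e : ℝ) ≤ H := by exact_mod_cast he3.2.le
    rw [mul_comm Y]
    exact (hlow _ hm e he3.1 he2 (heH.trans hH')).1
  have h4 : Y * (c * H * singularSeries (insert 0 D)) = c * (H / Real.log x) * mainTerm k x D := by
    rw [hY, mainTerm, show k + 2 = k + 1 + 1 by ring, pow_succ]
    field_simp
  have h5 : (1 - ε) * (Y * ∑ e ∈ E, singularSeries (insert e (insert 0 D)) +
      c * (H / Real.log x) * mainTerm k x D) ≤
      (1 - ε) * (Y * ∑ e ∈ Finset.Ioo (0 : ℤ) H \ dilate p D,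
        singularSeries (insert e (insert 0 (dilate p D)))) := by
    refine mul_le_mul_of_nonneg_left ?_ (by linarith)
    rw [← h4, ← mul_add]
    exact mul_le_mul_of_nonneg_left h2 hY0
  linarith

/-- A champion divisible by the square of a prime is short compared with `log x`, since otherwise
the loss from interruptions would make it rarer than the multiples of a primorial. -/
theorem eventually_lt_of_isChampion_dilate {k : ℕ} (hk : 1 ≤ k) (hHL : StrongHardyLittlewood k)
    {c C δ : ℝ} (hc : 0 < c) (hδ : 0 < δ) (hδ1 : δ ≤ 1) (hCδ : C * δ ≤ c / 4) (hC : 0 < C)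
    (hG : HasDilationGain k c C) :
    ∀ᶠ x : ℝ in atTop, ∀ (p : ℕ) (D : Finset ℤ), p.Prime → (∀ d ∈ D, (p : ℤ) ∣ d) →
      IsChampion k x (dilate p D) → ∀ d ∈ dilate p D, (d : ℝ) ≤ δ * Real.log x := by
  obtain ⟨ε, hε, hε1, hε2⟩ : ∃ ε : ℝ, 0 < ε ∧ ε ≤ 1 / 4 ∧ ε ≤ c * δ / 32 :=
    ⟨min (1 / 4) (c * δ / 32), by positivity, min_le_left _ _, min_le_right _ _⟩
  filter_upwards [hG ε hε (by linarith), eventually_isModerate_of_isChampion hk hHL,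
    eventually_le_gapCount_primorialTuple hk hHL hε, eventually_mainTerm_le_primorialTuple k hε,
    eventually_isModerate_primorialTuple k,
    Real.tendsto_log_atTop.eventually_ge_atTop (max 1 (4 / δ ^ 2)),
    tendsto_log_log.eventually_ge_atTop (1 : ℝ), eventually_gt_atTop 1]
    with x hG hmod hstar hle hsm hL hl hx p D hp hpD hch d hd
  set L := Real.log x with hL'
  have hL1 : 1 ≤ L := (le_max_left _ _).trans hL
  have hL2 : 4 ≤ L * δ ^ 2 := (div_le_iff₀ (by positivity)).1 ((le_max_right _ _).trans hL)
  by_contra hcon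
  push Not at hcon
  have hm := hmod _ hch
  have hm' := hm.of_dilate hp hpD
  set H : ℕ := ⌊δ * L⌋₊ with hH
  have hHle : (H : ℝ) ≤ δ * L := Nat.floor_le (by positivity)
  have hδL : 2 ≤ δ * L := by nlinarith
  have hHge : δ * L / 2 ≤ H := by linarith [Nat.lt_floor_add_one (δ * L)]
  have hdH : (H : ℤ) ≤ d := by exact_mod_cast hHle.trans hcon.le
  have hsq : √L ≤ δ * L / 2 := by
    refine Real.sqrt_le_iff.2 ⟨by positivity, ?_⟩
    nlinarith
  have h1 := hG p D hp hpD hm H ⟨d, hd, hdH⟩ (hsq.trans hHge) (by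
    calc (H : ℝ) ≤ δ * L := hHle
      _ ≤ 1 * L := by gcongr
      _ = L := one_mul L
      _ ≤ L ^ (k + 1) := le_self_pow₀ hL1 (by omega)) ∅ (by simp)
  rw [Finset.sum_empty, mul_zero, zero_add] at h1
  set X := mainTerm k x D with hX
  have hXpos : 0 < X := mainTerm_pos hx hm'
  set t : ℝ := H / L with ht
  have ht1 : t ≤ δ := (div_le_iff₀ (by linarith)).2 hHle
  have ht2 : δ / 2 ≤ t := (le_div_iff₀ (by linarith)).2 (by linarith)
  have hε3 : ε / Real.log L ^ 2 ≤ ε := div_le_self hε.le (one_le_pow₀ hl)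
  have h2 : (gapCount k x (dilate p D) : ℝ) ≤ (1 - 3 * ε) * X := by
    have h3 : 1 + ε / Real.log L ^ 2 + C * t ^ 2 - (1 - ε) * (c * t) ≤ 1 - 3 * ε := by
      have ht0 : 0 < t := by linarith
      have h4 : C * t ^ 2 ≤ c / 4 * t := by
        have : C * t ≤ C * δ := by gcongr
        nlinarith
      have h5 : c * t / 2 ≤ (1 - ε) * (c * t) := by
        have : 0 < c * t := by positivity
        nlinarith
      have h6 : c * δ / 8 ≤ c * t / 4 := by nlinarith
      linarith
    have h7 := mul_le_mul_of_nonneg_right h3 hXpos.le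
    linarith
  have hXm : X = mainTerm k x (dilate p D) := by
    rw [hX, mainTerm, mainTerm, singularSeries_insert_zero_dilate hp hpD]
  have h8 := hle _ hm
  rw [← hXm] at h8
  have h9 : (gapCount k x (primorialTuple k (smoothBound x)) : ℝ) ≤
      gapCount k x (dilate p D) := by
    exact_mod_cast hch.2 _ (card_primorialTuple _ _)
  have hZ := mainTerm_pos hx hsm.1
  set Z := mainTerm k x (primorialTuple k (smoothBound x))
  have h10 : (1 - 3 * ε) * X ≤ (1 - 3 * ε) * ((1 + ε) * Z) :=
    mul_le_mul_of_nonneg_left h8 (by linarith)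
  have h11 : 0 < ε * Z := by positivity
  have h12 : 0 < ε ^ 2 * Z := by positivity
  nlinarith

/-- A gain of relative size `u / 5` outweighs a loss of relative size `u / 20`, up to quadratic terms. -/
theorem not_le_of_gain {u X X' : ℝ} (hu : 0 < u) (hu' : u ≤ 1 / 40) (hX : 0 < X)
    (hXX' : (1 + u / 5) * X ≤ X') : ¬ (1 - u ^ 2 - u / 20) * X' ≤ (1 + u ^ 2) * X := by
  intro h
  have h1 : (1 - u ^ 2 - u / 20) * ((1 + u / 5) * X) ≤ (1 + u ^ 2) * X :=
    (mul_le_mul_of_nonneg_left hXX' (by nlinarith)).trans h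
  rw [← mul_assoc] at h1
  have h2 := le_of_mul_le_mul_right h1 hX
  nlinarith [mul_pos hu hu, mul_pos (mul_pos hu hu) hu]

/-- A champion is not too short: if `q` is a small prime that does not divide its largest element,
then multiplication by `q` increases the singular series by a factor of at least `1 + 1 / q`, which
outweighs the loss from interruptions. -/
theorem exists_eventually_le_of_isChampion {k : ℕ} (hk : 1 ≤ k) (hHL : StrongHardyLittlewood k) :
    ∃ c : ℝ, 0 < c ∧ ∀ᶠ x : ℝ in atTop, ∀ D, IsChampion k x D →
      ∃ d ∈ D, c * (Real.log x / Real.log (Real.log x) ^ 2) ≤ d := by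
  obtain ⟨C, hC, hlow⟩ := exists_eventually_le_gapCount hk hHL
  set c : ℝ := 1 / (120 * C) with hc
  have hc0 : 0 < c := by positivity
  have hcC : C * c = 1 / 120 := by rw [hc]; field_simp
  refine ⟨c, hc0, ?_⟩
  have hceil : Tendsto (fun x : ℝ => ⌈4 * Real.log (Real.log x)⌉₊) atTop atTop :=
    tendsto_nat_ceil_atTop.comp (tendsto_log_log.const_mul_atTop (by norm_num))
  filter_upwards [hlow 1 one_pos, eventually_abs_tupleCount_sub_le hHL one_pos,
    eventually_isModerate_of_isChampion hk hHL, hceil.eventually eventually_exists_prime_not_dvd,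
    eventually_mul_loglog_le 1 (inv_pos.2 hc0),
    eventually_mul_loglog_le 2 (by positivity : (0 : ℝ) < ((5 * c) ^ 2)⁻¹),
    tendsto_log_log.eventually_ge_atTop (max 40 (6 * c)),
    Real.tendsto_log_atTop.eventually_gt_atTop (1 : ℝ), eventually_gt_atTop 1]
    with x hlow hup hmod hq hl1 hl2 hl hL1 hx D hch
  by_contra! hcon
  set L := Real.log x with hL'
  set l := Real.log L with hl'
  have hl40 : 40 ≤ l := (le_max_left _ _).trans hl
  have hlc : 6 * c ≤ l := (le_max_right _ _).trans hl
  have hL0 : 0 < L := by linarith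
  have hl0 : 0 < l := by linarith
  have hm := hmod D hch
  obtain ⟨H, hH, hHmax⟩ := hm.exists_max hk
  have hHL' : (H : ℝ) < c * (L / l ^ 2) := by exact_mod_cast hcon _ hH
  have hHpos : 0 < H := by exact_mod_cast (hHmax _ hH).1
  set z := ⌈4 * l⌉₊ with hz
  have hz1 : 4 * l ≤ z := Nat.le_ceil _
  have hz2 : (z : ℝ) ≤ 5 * l := by linarith [Nat.ceil_lt_add_one (by linarith : 0 ≤ 4 * l)]
  have hcl : c * (L / l ^ 2) ≤ L := by
    rw [← mul_div_assoc, div_le_iff₀ (by positivity), mul_comm]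
    exact mul_le_mul_of_nonneg_left (by nlinarith) hL0.le
  obtain ⟨q, hqp, hqz, hqH⟩ := hq H hHpos.ne' (by
    refine (hHL'.trans_le hcl).trans_le ?_
    calc L = Real.exp l := (Real.exp_log hL0).symm
      _ ≤ _ := Real.exp_le_exp.2 (by linarith))
  have hq5 : (q : ℝ) ≤ 5 * l := le_trans (by exact_mod_cast hqz) hz2
  have hq0 : (0 : ℝ) < q := by exact_mod_cast hqp.pos
  -- the dilation by `q` stays below `5 c L / l`, where interruptions cost at most `1 / (20 l)`
  have hdq : ∀ d ∈ dilate q D, 2 ≤ d ∧ (d : ℝ) ≤ 5 * c * (L / l) := by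
    intro e he
    obtain ⟨d, hd, rfl⟩ := mem_dilate.1 he
    have h1 := hm.two_le d hd
    have h2 : (1 : ℤ) ≤ q := by exact_mod_cast hqp.one_le
    refine ⟨by nlinarith, ?_⟩
    have h3 : (d : ℝ) ≤ c * (L / l ^ 2) := (hcon d hd).le
    push_cast
    calc (q : ℝ) * d ≤ (5 * l) * (c * (L / l ^ 2)) := by
          refine mul_le_mul hq5 h3 ?_ (by positivity)
          exact_mod_cast (by omega : (0 : ℤ) ≤ d)
      _ = _ := by field_simp
  have h5cL : 6 * c * (L / l) ≤ L := by
    rw [← mul_div_assoc, div_le_iff₀ hl0]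
    nlinarith
  have hcLl : 1 ≤ c * (L / l) := by
    rw [pow_one, inv_mul_le_iff₀ hc0] at hl1
    rw [← mul_div_assoc, le_div_iff₀ hl0]
    linarith
  have hLk : L ≤ L ^ (k + 1) := le_self_pow₀ hL1.le (by omega)
  have hgain : (1 + 1 / (5 * l)) * singularSeries (insert 0 D) ≤
      singularSeries (insert 0 (dilate q D)) := by
    rw [← dilate_insert_zero]
    refine le_trans ?_ (mul_singularSeries_le_dilate hqp (two_le_residueCount (a := (H : ℤ))
      (b := 0) (Finset.mem_insert_of_mem hH) (Finset.mem_insert_self _ _) ?_))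
    · refine mul_le_mul_of_nonneg_right ?_ (singularSeries_nonneg _)
      gcongr
    · rw [sub_zero]
      exact_mod_cast hqH
  have hmq : IsModerate k x (dilate q D) := by
    refine ⟨by rw [card_dilate hqp.pos, hm.card_eq], fun d hd => (hdq d hd).1, fun d hd => ?_, ?_⟩
    · refine (hdq d hd).2.trans (le_trans ?_ (h5cL.trans hLk))
      linarith
    · have h1 : 0 < singularSeries (insert 0 D) := singularSeries_pos_of_ne_zero hm.ne_zero
      have h2 : 0 < (1 + 1 / (5 * l)) * singularSeries (insert 0 D) := by positivity
      linarith
  have hceil1 := Nat.ceil_lt_add_one (by positivity : 0 ≤ 5 * c * (L / l))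
  have h1 := hlow _ hmq ⌈5 * c * (L / l)⌉₊ (by
    intro d hd
    exact_mod_cast (hdq d hd).2.trans (Nat.le_ceil _)) (by
    refine le_trans ?_ (Nat.le_ceil _)
    refine Real.sqrt_le_iff.2 ⟨by positivity, ?_⟩
    rw [inv_mul_le_iff₀ (by positivity)] at hl2
    have : (5 * c * (L / l)) ^ 2 = (5 * c) ^ 2 * L / l ^ 2 * L := by field_simp
    rw [this]
    refine le_mul_of_one_le_left hL0.le ?_
    rw [one_le_div (by positivity)]
    exact hl2) (by linarith)
  have h2 : C * ((⌈5 * c * (L / l)⌉₊ : ℝ) / L) ≤ 1 / (20 * l) := by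
    calc C * ((⌈5 * c * (L / l)⌉₊ : ℝ) / L) ≤ C * (6 * c * (L / l) / L) := by
          gcongr
          linarith
      _ = 6 * (C * c) / l := by field_simp
      _ = _ := by rw [hcC]; field_simp; norm_num
  have h3 : (gapCount k x (dilate q D) : ℝ) ≤ gapCount k x D := by
    exact_mod_cast hch.2 _ hmq.card_eq
  have h4 : (gapCount k x D : ℝ) ≤ tupleCount x (insert 0 D) := by
    exact_mod_cast gapCount_le_tupleCount k x D
  have h5 := (abs_le.1 (hup D hm)).2
  have hXq : (1 + 1 / (5 * l)) * mainTerm k x D ≤ mainTerm k x (dilate q D) := by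
    rw [mainTerm, mainTerm, ← mul_assoc]
    exact mul_le_mul_of_nonneg_right hgain (by positivity)
  have e1 : 1 / l ^ 2 = (1 / l) ^ 2 := by rw [one_div_pow]
  have e2 : 1 / (20 * l) = 1 / l / 20 := by field_simp
  have e3 : 1 / (5 * l) = 1 / l / 5 := by field_simp
  rw [e1] at h1 h5
  rw [e2] at h2
  rw [e3] at hXq
  refine not_le_of_gain (u := 1 / l) (by positivity) (by gcongr) (mainTerm_pos hx hm) hXq ?_
  have h6 := mul_le_mul_of_nonneg_right h2 (mainTerm_nonneg hx.le (k := k) (dilate q D))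
  linarith

/-- A champion is not divisible by the square of a prime `p`: division by `p` leaves the singular
series unchanged and removes a positive proportion of the interruptions. -/
theorem eventually_not_isChampion_dilate {k : ℕ} (hk : 1 ≤ k) (hHL : StrongHardyLittlewood k) :
    ∀ᶠ x : ℝ in atTop, ∀ (p : ℕ) (D : Finset ℤ), p.Prime → (∀ d ∈ D, (p : ℤ) ∣ d) →
      ¬ IsChampion k x (dilate p D) := by
  obtain ⟨c, C, hc, hC, hG⟩ := exists_hasDilationGain hHL
  obtain ⟨c₁, hc₁, hlong⟩ := exists_eventually_le_of_isChampion hk hHL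
  obtain ⟨C₃, hC₃, havg⟩ := exists_eventually_sum_singularSeries_le k (k + 1) (by omega)
  set δ : ℝ := min 1 (c / (4 * C)) with hδ
  have hδ0 : 0 < δ := by positivity
  have hCδ : C * δ ≤ c / 4 := by
    calc C * δ ≤ C * (c / (4 * C)) := by gcongr; exact min_le_right _ _
      _ = c / 4 := by field_simp
  -- `ε` is so small that the errors in the conjecture stay below `c / 2`; those from inclusion and
  -- exclusion are below `c / 4` by the choice of `δ`
  set B : ℝ := c + 2 / c₁ + 2 * C₃ + 1 with hB
  have hB0 : 0 < B := by positivity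
  set ε : ℝ := c / 2 / B with hε
  have hε0 : 0 < ε := by positivity
  have hεB : ε * B = c / 2 := by rw [hε]; field_simp
  have hε1 : ε < 1 := by
    rw [hε, div_lt_one hB0, hB]
    have : 0 < 2 / c₁ := by positivity
    linarith
  filter_upwards [hG ε hε0 hε1, hlong, havg,
    eventually_lt_of_isChampion_dilate hk hHL hc hδ0 (min_le_left _ _) hCδ hC hG,
    eventually_isModerate_of_isChampion hk hHL, eventually_abs_tupleCount_sub_le hHL hε0,
    eventually_tupleCount_insert_bounds hHL hε0,
    eventually_log_pow_le_mainTerm k 1 (by positivity : (0 : ℝ) < (k + 3) / ε),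
    eventually_mul_loglog_le 4 (by positivity : (0 : ℝ) < (c₁ ^ 2)⁻¹),
    tendsto_log_log.eventually_ge_atTop (1 : ℝ),
    Real.tendsto_log_atTop.eventually_ge_atTop (1 : ℝ), eventually_gt_atTop 1]
    with x hG hlong havg hshort hmod hmain hbds hJ hl4 hl hL1 hx p D hp hpD hch
  set L := Real.log x with hL'
  set l := Real.log L with hl'
  have hL0 : 0 < L := by linarith
  have hm := hmod _ hch
  have hm' := hm.of_dilate hp hpD
  obtain ⟨H', hH', hmax'⟩ := hm'.exists_max hk
  set H : ℕ := p * H' with hH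
  have hHmem : (H : ℤ) ∈ dilate p D := mem_dilate.2 ⟨H', hH', by rw [hH]; push_cast; ring⟩
  have hHle : (H : ℝ) ≤ δ * L := by exact_mod_cast hshort p D hp hpD hch _ hHmem
  have hHge : c₁ * (L / l ^ 2) ≤ H := by
    obtain ⟨d, hd, hd'⟩ := hlong _ hch
    obtain ⟨d, hdD, rfl⟩ := mem_dilate.1 hd
    refine hd'.trans ?_
    rw [hH]
    push_cast
    exact mul_le_mul_of_nonneg_left (by exact_mod_cast (hmax' d hdD).2) (by positivity)
  have hHL1 : (H : ℝ) ≤ L := hHle.trans (by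
    have : δ ≤ 1 := min_le_left _ _
    nlinarith)
  have hHL2 : (H : ℝ) ≤ L ^ (k + 1) := hHL1.trans (le_self_pow₀ hL1 (by omega))
  have hsq : √L ≤ H := by
    refine le_trans (Real.sqrt_le_iff.2 ⟨by positivity, ?_⟩) hHge
    rw [inv_mul_le_iff₀ (by positivity)] at hl4
    have : (c₁ * (L / l ^ 2)) ^ 2 = c₁ ^ 2 * L / l ^ 4 * L := by field_simp
    rw [this]
    refine le_mul_of_one_le_left hL0.le ?_
    rw [one_le_div (by positivity)]
    exact hl4
  have hH'H : H' ≤ H := Nat.le_mul_of_pos_left _ hp.pos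
  set E := Finset.Ioo (0 : ℤ) H' \ D with hE
  have hEmem : ∀ e ∈ E, 0 < e ∧ e < H' ∧ e ∉ D := by
    intro e he
    obtain ⟨he1, he2⟩ := Finset.mem_sdiff.1 he
    exact ⟨(Finset.mem_Ioo.1 he1).1, (Finset.mem_Ioo.1 he1).2, he2⟩
  have h1 := hG p D hp hpD hm H ⟨H, hHmem, le_rfl⟩ hsq hHL2 E (by
    intro e he
    obtain ⟨h0, h1, h2⟩ := hEmem e he
    refine ⟨h0, ?_, h2⟩
    rw [hH]
    push_cast
    exact mul_lt_mul_of_pos_left h1 (by exact_mod_cast hp.pos))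
  have h2 : (tupleCount x (insert 0 D) : ℝ) ≤ gapCount k x D +
      ∑ e ∈ E, (tupleCount x (insert e (insert 0 D)) : ℝ) + H' := by
    exact_mod_cast tupleCount_le_gapCount_add x hm'.card_eq hmax' hH'
  have h3 := (abs_le.1 (hmain D hm')).1
  have h4 : (gapCount k x D : ℝ) ≤ gapCount k x (dilate p D) := by
    exact_mod_cast hch.2 _ hm'.card_eq
  set Y : ℝ := x / L ^ (k + 2) with hY
  have hY0 : 0 ≤ Y := by positivity
  set S : ℝ := ∑ e ∈ E, singularSeries (insert e (insert 0 D)) with hS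
  have hH'r : (H' : ℝ) ≤ H := by exact_mod_cast hH'H
  have h5 : ∑ e ∈ E, (tupleCount x (insert e (insert 0 D)) : ℝ) ≤
      (1 + ε) * (Y * S) + H * (k + 2) := by
    calc ∑ e ∈ E, (tupleCount x (insert e (insert 0 D)) : ℝ)
        ≤ ∑ e ∈ E, ((1 + ε) * Y * singularSeries (insert e (insert 0 D)) + (k + 2)) := by
          refine Finset.sum_le_sum fun e he => ?_
          obtain ⟨h0, h1, h2⟩ := hEmem e he
          have heH : (e : ℝ) ≤ H' := by exact_mod_cast h1.le
          have := (hbds D hm' e h0 h2 (heH.trans (hH'r.trans hHL2))).2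
          linarith
      _ = (1 + ε) * Y * S + E.card * (k + 2) := by
          rw [Finset.sum_add_distrib, Finset.sum_const, nsmul_eq_mul, ← Finset.mul_sum]
      _ ≤ (1 + ε) * Y * S + H * (k + 2) := by
          have : (E.card : ℝ) ≤ H := (card_Ioo_sdiff_le H' D).trans hH'r
          gcongr
      _ = _ := by ring
  set X := mainTerm k x D with hX
  have hXpos : 0 < X := mainTerm_pos hx hm'
  have h6 : Y * S ≤ C₃ * (H / L) * X := by
    have h7 : S ≤ C₃ * H * singularSeries (insert 0 D) := by
      refine le_trans ?_ (havg (insert 0 D) H hm'.card_insert ?_ hsq hHL2)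
      · rw [Ioo_sdiff_insert_zero]
        refine Finset.sum_le_sum_of_subset_of_nonneg (Finset.sdiff_subset_sdiff ?_ subset_rfl)
          fun _ _ _ => singularSeries_nonneg _
        exact Finset.Ioo_subset_Ioo le_rfl (by exact_mod_cast hH'H)
      · intro d hd
        refine ⟨hm'.nonneg d hd, ?_⟩
        rcases Finset.mem_insert.1 hd with rfl | hd
        · rw [Int.cast_zero]; positivity
        · exact hm'.le_log d hd
    calc Y * S ≤ Y * (C₃ * H * singularSeries (insert 0 D)) := by gcongr
      _ = _ := by
        rw [hY, hX, mainTerm, ← hL', show k + 2 = k + 1 + 1 by ring, pow_succ]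
        field_simp
  have h7 : (H : ℝ) * (k + 3) ≤ ε * (H / L) * X := by
    have := hJ D hm'
    calc (H : ℝ) * (k + 3) = ε * (H / L) * ((k + 3) / ε * L ^ 1) := by field_simp
      _ ≤ _ := by gcongr
  set t : ℝ := H / L with ht
  have hHpos : (0 : ℝ) < H := lt_of_lt_of_le (by positivity) hHge
  have ht0 : 0 < t := by positivity
  have htδ : t ≤ δ := (div_le_iff₀ hL0).2 hHle
  have hl2 : ε / l ^ 2 ≤ ε / c₁ * t := by
    have : 1 / l ^ 2 ≤ t / c₁ := by
      rw [le_div_iff₀ hc₁, ht, le_div_iff₀ hL0]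
      refine le_trans (le_of_eq ?_) hHge
      ring
    calc ε / l ^ 2 = ε * (1 / l ^ 2) := by ring
      _ ≤ ε * (t / c₁) := by gcongr
      _ = _ := by ring
  have h8 : (1 - ε) * (c * t) * X ≤
      (2 * (ε / c₁ * t) + C * t ^ 2 + 2 * ε * (C₃ * t) + ε * t) * X := by
    have h9 : ε / l ^ 2 * X ≤ ε / c₁ * t * X := by gcongr
    have h10 : ε * (Y * S) ≤ ε * (C₃ * t * X) := by gcongr
    linarith
  have h9 := le_of_mul_le_mul_right h8 hXpos
  have h10 : (1 - ε) * c ≤ 2 * (ε / c₁) + C * t + 2 * ε * C₃ + ε := by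
    refine le_of_mul_le_mul_right ?_ ht0
    linarith
  have h11 : C * t ≤ c / 4 := le_trans (by gcongr) hCδ
  have h12 : ε * B = ε * c + 2 * (ε / c₁) + 2 * ε * C₃ + ε := by rw [hB]; ring
  linarith

/-- A champion with respect to a large `x` has squarefree greatest common divisor. -/
theorem eventually_squarefree_gcd {k : ℕ} (hk : 1 ≤ k) (hHL : StrongHardyLittlewood k) :
    ∀ᶠ x : ℝ in atTop, ∀ D, IsChampion k x D → Squarefree (D.gcd id) := by
  filter_upwards [eventually_not_isChampion_dilate hk hHL,
    eventually_isModerate_of_isChampion hk hHL] with x h1 hmod D hD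
  have hm := hmod D hD
  obtain ⟨H, hH, hmax⟩ := hm.exists_max hk
  have hg0 : D.gcd id ≠ 0 := by
    intro h0
    have := Finset.gcd_eq_zero_iff.1 h0 _ hH
    have := (hmax _ hH).1
    simp_all
  by_contra hsq
  rw [← Int.squarefree_natAbs, Nat.squarefree_iff_prime_squarefree] at hsq
  push Not at hsq
  obtain ⟨p, hp, hpp⟩ := hsq
  have hdvd : ∀ d ∈ D, (p : ℤ) * p ∣ d := by
    intro d hd
    have h2 : ((p * p : ℕ) : ℤ) ∣ D.gcd id := Int.natCast_dvd.2 hpp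
    push_cast at h2
    exact h2.trans (Finset.gcd_dvd hd)
  have hp0 : (p : ℤ) ≠ 0 := by exact_mod_cast hp.ne_zero
  have hDeq : dilate p (D.image fun d => d / (p : ℤ)) = D := by
    ext e
    rw [mem_dilate]
    constructor
    · rintro ⟨e, he, rfl⟩
      obtain ⟨d, hd, rfl⟩ := Finset.mem_image.1 he
      rwa [Int.mul_ediv_cancel' ((dvd_mul_right _ _).trans (hdvd d hd))]
    · intro he
      exact ⟨_, Finset.mem_image_of_mem _ he,
        Int.mul_ediv_cancel' ((dvd_mul_right _ _).trans (hdvd e he))⟩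
  refine h1 p (D.image fun d => d / (p : ℤ)) hp ?_ (by rwa [hDeq])
  intro e he
  obtain ⟨d, hd, rfl⟩ := Finset.mem_image.1 he
  obtain ⟨m, rfl⟩ := hdvd d hd
  rw [mul_assoc, Int.mul_ediv_cancel_left _ hp0]
  exact dvd_mul_right _ _

end JumpingChampion

theorem theoremA2 (k : ℕ) (hk : 1 ≤ k) (hHL : JumpingChampion.StrongHardyLittlewood k) :
    (∃ X : ℝ, ∀ x : ℝ, X ≤ x → ∀ D : Finset ℤ,
      JumpingChampion.IsChampion k x D → Squarefree (D.gcd id)) ∧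
    (∃ M : ℤ, ∀ (x : ℝ) (D : Finset ℤ),
      JumpingChampion.IsChampion k x D → 0 < JumpingChampion.gapCount k x D →
        (∃ d ∈ D, M ≤ d) → Squarefree (D.gcd id)) := by
  obtain ⟨X, hX⟩ := eventually_atTop.1 (JumpingChampion.eventually_squarefree_gcd hk hHL)
  refine ⟨⟨X, hX⟩, ⌈X⌉, fun x D hD hpos ⟨d, hd, hMd⟩ => hX x ?_ D hD⟩
  -- an element of `D` is a difference of primes up to `x`
  calc X ≤ ⌈X⌉ := Int.le_ceil X
    _ ≤ d := by exact_mod_cast hMd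
    _ ≤ x := JumpingChampion.le_of_gapCount_pos hpos d hd
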